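/- Let $\Gamma\subset\mathbb{R}^3$ be a closed (compact, without boundary), connected, oriented surface of class $C^3$ with continuous unit normal field $n$ (for instance the outward one). For $\eta\in C^1(\Gamma)$ with $C^1$ extension $\tilde\eta$ let $\underline{D}_i\eta=\sum_{j}P_{ij}\partial_j\tilde\eta$, where $P=I_3-n\otimes n$; let $\Delta_\Gamma=\sum_i\underline{D}_i^2$ (applied componentwise to vector fields), $W=-(\underline{D}_in_j)_{i,j}$, $H=\mathrm{tr}\,W$, and $K=\kappa_1\kappa_2$, where $\kappa_1,\kappa_2$ are the principal curvatures, i.e. the eigenvalues of $W$ other than the eigenvalue $0$ belonging to $n$. For tangential $X,Y$ let $(\nabla_\Gamma X)_{ij}=\underline{D}_iX_j$ and let $\overline\nabla_YX=P(\nabla_\Gamma X)^TY$ be the Levi-Civita connection. It has the curvature tensor $R(X,Y)Z=\overline\nabla_X\overline\nabla_YZ-\overline\nabla_Y\overline\nabla_XZ-\overline\nabla_{\overline\nabla_XY-\overline\nabla_YX}Z$, and $\mathrm{Ric}(X)=\sum_{i=1,2}R(X,\tau_i)\tau_i$ for any local orthonormal frame $\{\tau_1,\tau_2\}$ of $T\Gamma$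 of class $C^2$. Let $d_\Gamma$ be the exterior derivative on $\Gamma$ and $d_\Gamma^*$ its formal $L^2(\Gamma)$-adjoint, and let $\Theta(X)=X\cdot(\,\cdot\,)$ be the identification of tangential vector fields with 1-forms. The Hodge Laplacian is $\Delta_HX=-\Theta^{-1}(d_\Gamma d_\Gamma^*+d_\Gamma^*d_\Gamma)\Theta(X)$. Regard $\overline\nabla X$ as the $(0,2)$-tensor $(\overline\nabla X)(Y,Z)=\overline\nabla_ZX\cdot Y$ and let $\overline\nabla^*$ be the formal $L^2(\Gamma)$-adjoint of $\overline\nabla$; the Bochner Laplacian is $\Delta_BX=-\overline\nabla^*\overline\nabla X$. All integrals over $\Gamma$ are with respect to the two-dimensional Hausdorff measure. Then for every tangential vector field $X$ of class $C^2$ on $\Gamma$ the fields $\Delta_HX$, $\Delta_BX$ and $\mathrm{Ric}(X)$ are well defined as continuous tangential vector fields, and on $\Gamma$ $$\Delta_HX=P(\Delta_\Gamma X)+(2W^2-HW)X,\qquad \Delta_BX=P(\Delta_\Gamma X)+W^2X,$$ $$\Delta_BX=\Delta_HX+\mathrm{Ric}(X),\qquad \mathrm{Ric}(X)=KX.$$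 -/

import Mathlib

open scoped RealInnerProductSpace Topology MeasureTheory

noncomputable section

namespace SurfaceCalculus

abbrev E2 := EuclideanSpace ℝ (Fin 2)

abbrev E3 := EuclideanSpace ℝ (Fin 3)

/- Functions, vector fields and forms on a surface `Γ ⊆ ℝ³` are represented by maps defined on all
of `ℝ³`; only their values on `Γ` are ever used. Likewise a form at `y ∈ Γ` is represented by a
(multi)linear form on `ℝ³`, of which only the values on tangent vectors at `y` are used. -/

/-! ### Surfaces -/

/-- `μ : U → Γ` is a `C³` local parametrization of `Γ`: `U ⊆ ℝ²` is open and `μ` is a `C³` immersion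
and a homeomorphism of `U` onto a relatively open subset of `Γ`. -/
structure IsLocalParam (Γ : Set E3) (U : Set E2) (μ : E2 → E3) : Prop where
  isOpen : IsOpen U
  contDiffOn : ContDiffOn ℝ 3 μ U
  injective_fderiv : ∀ s ∈ U, Function.Injective (fderiv ℝ μ s)
  isEmbedding : Topology.IsEmbedding (U.domRestrict μ)
  image_eq : ∃ V : Set E3, IsOpen V ∧ μ '' U = Γ ∩ V

/-- The coordinate tangent vector `∂μ/∂sⁱ (s)`. -/
def coordVec (μ : E2 → E3) (s : E2) (i : Fin 2) : E3 :=
  fderiv ℝ μ s (EuclideanSpace.single i 1)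

/-- A closed (compact, without boundary), connected, embedded surface of class `C³` in `ℝ³`. -/
structure IsClosedSurface (Γ : Set E3) : Prop where
  isCompact : IsCompact Γ
  isConnected : IsConnected Γ
  exists_param : ∀ y ∈ Γ, ∃ (U : Set E2) (μ : E2 → E3), IsLocalParam Γ U μ ∧ y ∈ μ '' U

/-- `n` is a continuous unit normal vector field on `Γ` (an orientation of `Γ`). -/
structure IsUnitNormal (Γ : Set E3) (n : E3 → E3) : Prop where
  continuousOn : ContinuousOn n Γ
  norm_eq_one : ∀ y ∈ Γ, ‖n y‖ = 1
  inner_eq_zero : ∀ (U : Set E2) (μ : E2 → E3), IsLocalParam Γ U μ →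
    ∀ s ∈ U, ∀ i, ⟪coordVec μ s i, n (μ s)⟫ = 0

/-! ### Functions of class `C^k` on `Γ` and tangential derivatives -/

/-- `g` is a `C^k` extension, near the point `y`, of the function `f` on `Γ`. -/
def IsLocalExt {F : Type*} [NormedAddCommGroup F] [NormedSpace ℝ F]
    (k : ℕ) (Γ : Set E3) (f : E3 → F) (y : E3) (g : E3 → F) : Prop :=
  ContDiffAt ℝ k g y ∧ g =ᶠ[𝓝[Γ] y] f

/-- `f` is of class `C^k` on the relatively open subset `Γ ∩ O` of `Γ`. -/
def IsCkOn {F : Type*} [NormedAddCommGroup F] [NormedSpace ℝ F]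
    (k : ℕ) (Γ O : Set E3) (f : E3 → F) : Prop :=
  ∀ y ∈ Γ ∩ O, ∃ g, IsLocalExt k Γ f y g

/-- `f ∈ C^k(Γ)`. -/
abbrev IsCk {F : Type*} [NormedAddCommGroup F] [NormedSpace ℝ F]
    (k : ℕ) (Γ : Set E3) (f : E3 → F) : Prop :=
  IsCkOn k Γ Set.univ f

/-- The projection `P = I - n ⊗ n` onto the tangent plane. -/
def P (n : E3 → E3) (y : E3) : Matrix (Fin 3) (Fin 3) ℝ :=
  1 - Matrix.vecMulVec (n y) (n y)

/-- The tangential derivative `D_i η (y) = ∑ j, P_ij(y) ∂_j η̃(y)`, where `η̃` is a `C¹` extension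
of `η` (the value does not depend on the extension). -/
def tanDeriv (Γ : Set E3) (n : E3 → E3) (i : Fin 3) (η : E3 → ℝ) (y : E3) : ℝ :=
  ∑ j, P n y i j *
    fderiv ℝ (Classical.epsilon (IsLocalExt 1 Γ η y)) y (EuclideanSpace.single j 1)

/-- The Laplace–Beltrami operator `Δ_Γ η = ∑ i, D_i D_i η`. -/
def laplaceBeltrami (Γ : Set E3) (n : E3 → E3) (η : E3 → ℝ) (y : E3) : ℝ :=
  ∑ i, tanDeriv Γ n i (tanDeriv Γ n i η) y

/-- The Laplace–Beltrami operator applied to each component of a vector field. -/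
def vecLaplacian (Γ : Set E3) (n : E3 → E3) (v : E3 → E3) (y : E3) : E3 :=
  WithLp.toLp 2 fun k => laplaceBeltrami Γ n (fun z => v z k) y

/-- The tangential gradient matrix `(∇_Γ v)_ij = D_i v_j`. -/
def tanGradMat (Γ : Set E3) (n : E3 → E3) (v : E3 → E3) (y : E3) : Matrix (Fin 3) (Fin 3) ℝ :=
  Matrix.of fun i j => tanDeriv Γ n i (fun z => v z j) y

/-! ### Extrinsic curvatures -/

/-- The Weingarten map `W = -∇_Γ n`. -/
def W (Γ : Set E3) (n : E3 → E3) (y : E3) : Matrix (Fin 3) (Fin 3) ℝ :=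
  -tanGradMat Γ n n y

/-- (Twice) the mean curvature `H = tr W`. -/
def H (Γ : Set E3) (n : E3 → E3) (y : E3) : ℝ :=
  (W Γ n y).trace

/-- The principal curvatures `κ₁, κ₂`, with multiplicity: the eigenvalues of the symmetric matrix
`W` other than the eigenvalue zero belonging to the eigenvector `n`. -/
def principalCurvatures (Γ : Set E3) (n : E3 → E3) (y : E3) : Multiset ℝ :=
  (W Γ n y).charpoly.roots.erase 0

/-- The Gaussian curvature `K = κ₁ κ₂`. -/
def K (Γ : Set E3) (n : E3 → E3) (y : E3) : ℝ :=
  (principalCurvatures Γ n y).prod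

/-! ### Tangential fields and the Levi-Civita connection -/

/-- `X ∈ C^k(Γ, TΓ)`. -/
def IsTangentField (k : ℕ) (Γ : Set E3) (n : E3 → E3) (X : E3 → E3) : Prop :=
  IsCk k Γ X ∧ ∀ y ∈ Γ, ⟪X y, n y⟫ = 0

/-- The map `v ↦ P (v · ∇_Γ) X = P (∇_Γ X)ᵀ v` at `y`. -/
def covMap (Γ : Set E3) (n : E3 → E3) (X : E3 → E3) (y : E3) : E3 →ₗ[ℝ] E3 :=
  Matrix.toEuclideanLin (P n y * (tanGradMat Γ n X y).transpose)

/-- The covariant derivative of `X` along `Y`. -/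
def covDeriv (Γ : Set E3) (n : E3 → E3) (Y X : E3 → E3) (y : E3) : E3 :=
  covMap Γ n X y (Y y)

/-- The curvature tensor `R(X,Y)Z = ∇_X ∇_Y Z - ∇_Y ∇_X Z - ∇_{∇_X Y - ∇_Y X} Z`. -/
def curvature (Γ : Set E3) (n : E3 → E3) (X Y Z : E3 → E3) (y : E3) : E3 :=
  covDeriv Γ n X (covDeriv Γ n Y Z) y - covDeriv Γ n Y (covDeriv Γ n X Z) y
    - covDeriv Γ n (fun z => covDeriv Γ n X Y z - covDeriv Γ n Y X z) Z y

/-- `τ 0, τ 1` is a `C²` local orthonormal frame for `TΓ` on `Γ ∩ O`. -/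
structure IsLocalFrame (Γ : Set E3) (n : E3 → E3) (O : Set E3) (τ : Fin 2 → E3 → E3) : Prop where
  isOpen : IsOpen O
  isCkOn : ∀ i, IsCkOn 2 Γ O (τ i)
  tangent : ∀ i, ∀ y ∈ Γ ∩ O, ⟪τ i y, n y⟫ = 0
  orthonormal : ∀ y ∈ Γ ∩ O, Orthonormal ℝ fun i => τ i y

/-- `V = Ric(X)`: `V` is a continuous tangential field with `V = ∑ i, R(X, τ_i) τ_i` for every local
orthonormal frame. -/
def IsRicci (Γ : Set E3) (n : E3 → E3) (X V : E3 → E3) : Prop :=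
  IsTangentField 0 Γ n V ∧
  ∀ (O : Set E3) (τ : Fin 2 → E3 → E3), IsLocalFrame Γ n O τ →
    ∀ y ∈ Γ ∩ O, V y = ∑ i, curvature Γ n X (τ i) (τ i) y

/-- The vector field `Ric(X)`. -/
def ricci (Γ : Set E3) (n : E3 → E3) (X : E3 → E3) : E3 → E3 :=
  Classical.epsilon (IsRicci Γ n X)

/-! ### Forms and tensors on `Γ` and their inner products -/

/-- A field of linear forms (representing a 1-form on `Γ`). -/
abbrev Form1 := E3 → E3 →ₗ[ℝ] ℝ

/-- A field of bilinear forms (representing a (0,2)-tensor on `Γ`). -/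
abbrev Tensor2 := E3 → E3 →ₗ[ℝ] E3 →ₗ[ℝ] ℝ

/-- The tangent plane at `y`. -/
abbrev tangentPlane (n : E3 → E3) (y : E3) : Submodule ℝ E3 :=
  (Submodule.span ℝ {n y})ᗮ

/-- An orthonormal basis of the tangent plane at `y`; it has two elements when `n y ≠ 0`. -/
def τ (n : E3 → E3) (y : E3) (i : Fin (Module.finrank ℝ (tangentPlane n y))) : E3 :=
  stdOrthonormalBasis ℝ (tangentPlane n y) i

/-- The inner product of 1-forms at `y`. -/
def inner1 (n : E3 → E3) (y : E3) (ω ζ : E3 →ₗ[ℝ] ℝ) : ℝ :=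
  ∑ i, ω (τ n y i) * ζ (τ n y i)

/-- The inner product of (0,2)-tensors at `y`. -/
def innerTensor (n : E3 → E3) (y : E3) (S T : E3 →ₗ[ℝ] E3 →ₗ[ℝ] ℝ) : ℝ :=
  ∑ i, ∑ j, S (τ n y i) (τ n y j) * T (τ n y i) (τ n y j)

/-- The inner product `S(τ₁,τ₂) T(τ₁,τ₂)` of 2-forms at `y`. -/
def inner2 (n : E3 → E3) (y : E3) (S T : E3 →ₗ[ℝ] E3 →ₗ[ℝ] ℝ) : ℝ :=
  ∑ i, ∑ j, if i < j then S (τ n y i) (τ n y j) * T (τ n y i) (τ n y j) else 0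

/-- Integration over `Γ` with respect to the two-dimensional Hausdorff measure. -/
def surfInt (Γ : Set E3) (f : E3 → ℝ) : ℝ :=
  ∫ y in Γ, f y ∂(μHE[2] : MeasureTheory.Measure E3)

/-- `ω ∈ C^k(Γ, T*Γ)`. -/
def IsForm1 (k : ℕ) (Γ : Set E3) (n : E3 → E3) (ω : Form1) : Prop :=
  ∀ X, IsTangentField k Γ n X → IsCk k Γ fun y => ω y (X y)

/-- `S ∈ C^k(Γ, T*Γ ⊗ T*Γ)`. -/
def IsTensor2 (k : ℕ) (Γ : Set E3) (n : E3 → E3) (S : Tensor2) : Prop :=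
  ∀ X Y, IsTangentField k Γ n X → IsTangentField k Γ n Y → IsCk k Γ fun y => S y (X y) (Y y)

/-- `S ∈ C^k(Γ, Λ²T*Γ)`. -/
def IsForm2 (k : ℕ) (Γ : Set E3) (n : E3 → E3) (S : Tensor2) : Prop :=
  IsTensor2 k Γ n S ∧
  ∀ y ∈ Γ, ∀ v ∈ tangentPlane n y, ∀ w ∈ tangentPlane n y, S y v w = -S y w v

/-- The 1-form `Θ(X) = X · (-)` dual to a vector field. -/
def flat (X : E3 → E3) : Form1 := fun y => innerₗ E3 (X y)

/-- The tangent vector `Θ⁻¹(ω) = ∑ i, ω(τ_i) τ_i` at `y`. -/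
def sharp (n : E3 → E3) (y : E3) (ω : E3 →ₗ[ℝ] ℝ) : E3 :=
  ∑ i, ω (τ n y i) • τ n y i

/-! ### Exterior derivative, codifferential and Hodge Laplacian -/

/-- `α = d_Γ η` for a function `η`: in every local parametrization,
`α = ∑ i, ∂(η ∘ μ)/∂sⁱ dsⁱ`. -/
def IsExtDeriv0 (Γ : Set E3) (η : E3 → ℝ) (α : Form1) : Prop :=
  ∀ (U : Set E2) (μ : E2 → E3), IsLocalParam Γ U μ → ∀ s ∈ U, ∀ i,
    α (μ s) (coordVec μ s i) = fderiv ℝ (fun t => η (μ t)) s (EuclideanSpace.single i 1)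

/-- `β = d_Γ ω` for a 1-form `ω`: in every local parametrization, with
`ω_i(s) = ω_{μ(s)}(∂μ/∂sⁱ(s))`, one has `β = (∂ω₂/∂s¹ - ∂ω₁/∂s²) ds¹ ∧ ds²`. -/
def IsExtDeriv1 (Γ : Set E3) (ω : Form1) (β : Tensor2) : Prop :=
  ∀ (U : Set E2) (μ : E2 → E3), IsLocalParam Γ U μ → ∀ s ∈ U, ∀ i j,
    β (μ s) (coordVec μ s i) (coordVec μ s j) =
      fderiv ℝ (fun t => ω (μ t) (coordVec μ t j)) s (EuclideanSpace.single i 1) -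
      fderiv ℝ (fun t => ω (μ t) (coordVec μ t i)) s (EuclideanSpace.single j 1)

/-- `f = d_Γ^* ω` for a 1-form `ω`: `f ∈ C(Γ)` and `⟨f, η⟩₀ = ⟨ω, d_Γ η⟩₁` for all `η ∈ C¹(Γ)`. -/
def IsCodiff1 (Γ : Set E3) (n : E3 → E3) (ω : Form1) (f : E3 → ℝ) : Prop :=
  IsCk 0 Γ f ∧
  ∀ (η : E3 → ℝ) (α : Form1), IsCk 1 Γ η → IsExtDeriv0 Γ η α →
    surfInt Γ (fun y => f y * η y) = surfInt Γ fun y => inner1 n y (ω y) (α y)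

/-- `γ = d_Γ^* β` for a 2-form `β`: `γ ∈ C(Γ, T*Γ)` and `⟨γ, η⟩₁ = ⟨β, d_Γ η⟩₂` for all
`η ∈ C¹(Γ, T*Γ)`. -/
def IsCodiff2 (Γ : Set E3) (n : E3 → E3) (β : Tensor2) (γ : Form1) : Prop :=
  IsForm1 0 Γ n γ ∧
  ∀ (η : Form1) (δ : Tensor2), IsForm1 1 Γ n η → IsExtDeriv1 Γ η δ →
    surfInt Γ (fun y => inner1 n y (γ y) (η y)) = surfInt Γ fun y => inner2 n y (β y) (δ y)

/-- `V = Δ_H X` where `Δ_H = -Θ⁻¹ (d_Γ d_Γ^* + d_Γ^* d_Γ) Θ`: here `f = d_Γ^* Θ(X)`, `α = d_Γ f`,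
`β = d_Γ Θ(X)`, `γ = d_Γ^* β`. -/
def IsHodgeLaplacian (Γ : Set E3) (n : E3 → E3) (X V : E3 → E3) : Prop :=
  IsTangentField 0 Γ n V ∧
  ∃ (f : E3 → ℝ) (α : Form1) (β : Tensor2) (γ : Form1),
    IsCodiff1 Γ n (flat X) f ∧ IsCk 1 Γ f ∧ IsExtDeriv0 Γ f α ∧
    IsExtDeriv1 Γ (flat X) β ∧ IsForm2 1 Γ n β ∧ IsCodiff2 Γ n β γ ∧
    ∀ y ∈ Γ, V y = sharp n y (-(α y + γ y))

/-- The Hodge Laplacian `Δ_H X`. -/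
def hodgeLaplacian (Γ : Set E3) (n : E3 → E3) (X : E3 → E3) : E3 → E3 :=
  Classical.epsilon (IsHodgeLaplacian Γ n X)

/-! ### Bochner Laplacian -/

/-- The tensor `(∇X)(Y,Z) = ∇_Z X · Y`. -/
def covTensor (Γ : Set E3) (n : E3 → E3) (X : E3 → E3) : Tensor2 := fun y =>
  LinearMap.mk₂ ℝ (fun Y Z => ⟪covMap Γ n X y Z, Y⟫)
    (fun _ _ _ => inner_add_right _ _ _) (fun _ _ _ => real_inner_smul_right _ _ _)
    (fun _ _ _ => by rw [map_add, inner_add_left])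
    (fun _ _ _ => by rw [map_smul, real_inner_smul_left, smul_eq_mul])

/-- `V = ∇^* S` for a (0,2)-tensor `S`: `V ∈ C(Γ, TΓ)` and `∫ V · Y = ∫ θ(S, ∇Y)` for all
`Y ∈ C¹(Γ, TΓ)`. -/
def IsConnAdjoint (Γ : Set E3) (n : E3 → E3) (S : Tensor2) (V : E3 → E3) : Prop :=
  IsTangentField 0 Γ n V ∧
  ∀ Y, IsTangentField 1 Γ n Y →
    surfInt Γ (fun y => ⟪V y, Y y⟫) =
      surfInt Γ fun y => innerTensor n y (S y) (covTensor Γ n Y y)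

/-- `V = Δ_B X` where `Δ_B = -∇^* ∇`. -/
def IsBochnerLaplacian (Γ : Set E3) (n : E3 → E3) (X V : E3 → E3) : Prop :=
  IsTensor2 1 Γ n (covTensor Γ n X) ∧ IsConnAdjoint Γ n (covTensor Γ n X) fun y => -V y

/-- The Bochner Laplacian `Δ_B X`. -/
def bochnerLaplacian (Γ : Set E3) (n : E3 → E3) (X : E3 → E3) : E3 → E3 :=
  Classical.epsilon (IsBochnerLaplacian Γ n X)

end SurfaceCalculus

end

open SurfaceCalculus

open MeasureTheory Set Filter
open scoped NNReal ENNReal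

noncomputable section

namespace SurfaceCalculus

section

/-! ### The area formula for immersed parametrized surfaces -/

/-! All operators are computed through tangential derivatives D_i. On tangent vectors the
differential of an extension depends only on the function on Γ, so the extension chosen in
`tanDeriv` is immaterial and D_i obeys the usual rules. The geometry enters through four facts: Σ
n_i D_i = 0; W is symmetric with W n = 0; a tangential field satisfies n · D_i X = (W X)_i; and the
commutator D_i D_j - D_j D_i is a first order operator with factors n_i and n_j
(`tanDeriv_tanDeriv_sub`).

The adjoints in Δ_B and Δ_H are defined weakly. By the fundamental lemma of the calculus of
variations they have at most one continuous value, so it suffices to exhibit fields satisfying the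
integral identities. These come from the divergence theorem for tangential C¹ fields
(`surfInt_surfDiv_eq_zero`), which rests on the area formula for the Hausdorff measure, a coordinate
formula for the divergence and a partition of unity.

For Δ_B, the divergence of Σ_j (D_i X_j) Y_j is Δ_Γ X · Y + ∇X : ∇Y. Splitting the derivatives into
tangential and normal parts gives ∇X : ∇Y = ⟨∇̄X, ∇̄Y⟩ + W X · W Y, hence P Δ_Γ X + W² X.

For Δ_H, d* Θ(X) = -div X, while d Θ(X) is the tangential projection of D_k X_l - D_l X_k. Its
divergence, expanded with the commutator, is Δ_Γ X - ∇ div X + 2 W² X - H W X up to a normal term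
(`divCurl_apply`). The part d d* cancels ∇ div X.

For Ric, the projected second derivatives are symmetric in the two directions, so the curvature
retains only the products of second fundamental forms (`curvature_eq`). Their trace is H W X - W² X,
which is K X by Cayley-Hamilton on the tangent plane; it is also the difference of the two
Laplacians. -/

/-- The cross product on `ℝ³`. -/
def cross (a b : E3) : E3 :=
  WithLp.toLp 2 ![a 1 * b 2 - a 2 * b 1, a 2 * b 0 - a 0 * b 2, a 0 * b 1 - a 1 * b 0]

theorem inner_eq_sum (a b : E3) : ⟪a, b⟫ = a 0 * b 0 + a 1 * b 1 + a 2 * b 2 := by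
  simp [PiLp.inner_apply, Fin.sum_univ_three]
  ring

theorem norm_cross_sq (a b : E3) : ‖cross a b‖ ^ 2 = ‖a‖ ^ 2 * ‖b‖ ^ 2 - ⟪a, b⟫ ^ 2 := by
  simp only [← real_inner_self_eq_norm_sq, inner_eq_sum]
  simp [cross]; ring

/-- The area density of a parametrized surface. -/
def areaDensity (μ : E2 → E3) (s : E2) : ℝ :=
  ‖cross (coordVec μ s 0) (coordVec μ s 1)‖

/-- The square of `normDet` is the Gram determinant of the columns, which Lagrange's identity
`norm_cross_sq` identifies with the squared norm of their cross product. -/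
theorem normDet_eq_norm_cross (L : E2 →ₗ[ℝ] E3) :
    L.normDet = ‖cross (L (EuclideanSpace.single 0 1)) (L (EuclideanSpace.single 1 1))‖ := by
  rw [← sq_eq_sq₀ L.normDet_nonneg (norm_nonneg _), norm_cross_sq]
  have := L.normDet_sq_eq_det_gram (EuclideanSpace.basisFun (Fin 2) ℝ)
  simp only [RCLike.ofReal_real_eq_id, id] at this
  rw [this, Matrix.det_fin_two]
  simp [Matrix.gram, real_inner_comm]
  ring

theorem normDet_fderiv (μ : E2 → E3) (s : E2) :
    (fderiv ℝ μ s : E2 →ₗ[ℝ] E3).normDet = areaDensity μ s :=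
  normDet_eq_norm_cross _

theorem areaDensity_pos {μ : E2 → E3} {s : E2} (h : Function.Injective (fderiv ℝ μ s)) :
    0 < areaDensity μ s := by
  rw [← normDet_fderiv]
  refine lt_of_le_of_ne (LinearMap.normDet_nonneg _) (Ne.symm ?_)
  exact ((LinearMap.normDet_ne_zero_tfae (fderiv ℝ μ s : E2 →ₗ[ℝ] E3)).out 0 4).2 h

theorem contDiff_cross : ContDiff ℝ ⊤ fun p : E3 × E3 => cross p.1 p.2 := by
  rw [contDiff_euclidean]
  intro i
  fin_cases i <;> simp [cross] <;> fun_prop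

theorem continuousAt_areaDensity {μ : E2 → E3} {s : E2} (h : ContDiffAt ℝ 1 μ s) :
    ContinuousAt (areaDensity μ) s := by
  have h1 : ContinuousAt (fderiv ℝ μ) s := h.continuousAt_fderiv (by simp)
  have := (contDiff_cross.continuous.continuousAt (x := (coordVec μ s 0, coordVec μ s 1))).comp
    (f := fun s => (coordVec μ s 0, coordVec μ s 1)) (x := s)
    (by unfold coordVec; fun_prop)
  exact this.norm

/-- The map f ∘ g⁻¹ is κ-Lipschitz on g(A). Injectivity of g is not needed, since the hypothesis
forces f to be constant on the fibres of g in A. -/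
theorem hausdorff_image_le_of_dist_le {α : Type*} (f g : α → E3) (A : Set α) (κ : ℝ≥0)
    (h : ∀ s ∈ A, ∀ t ∈ A, dist (f s) (f t) ≤ κ * dist (g s) (g t)) :
    (μHE[2] : Measure E3) (f '' A) ≤ κ ^ 2 * (μHE[2] : Measure E3) (g '' A) := by
  rcases A.eq_empty_or_nonempty with rfl | ⟨a, ha⟩
  · simp
  have : Nonempty α := ⟨a⟩
  have hL : LipschitzOnWith κ (f ∘ Function.invFunOn g A) (g '' A) := by
    apply LipschitzOnWith.of_dist_le_mul
    intro x hx y hy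
    have := h _ (Function.invFunOn_mem hx) _ (Function.invFunOn_mem hy)
    rwa [Function.invFunOn_eq hx, Function.invFunOn_eq hy] at this
  have himg : f '' A ⊆ (f ∘ Function.invFunOn g A) '' (g '' A) := by
    rintro _ ⟨s, hs, rfl⟩
    refine ⟨g s, ⟨s, hs, rfl⟩, ?_⟩
    have hx : g s ∈ g '' A := ⟨s, hs, rfl⟩
    have := h _ (Function.invFunOn_mem hx) _ hs
    rw [Function.invFunOn_eq hx, dist_self, mul_zero] at this
    exact dist_le_zero.1 this
  rw [Measure.euclideanHausdorffMeasure_def, Measure.smul_apply, Measure.smul_apply]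
  have h2 := (measure_mono himg).trans (hL.hausdorffMeasure_image_le (d := (2 : ℕ)) (by simp))
  rw [ENNReal.rpow_natCast] at h2
  simp only [ENNReal.smul_def, smul_eq_mul]
  rw [mul_left_comm]
  gcongr

/-- Near s₀ the distances between values of φ agree, up to a factor κ, with those of its
differential L, and for a linear map the measure of an image is known exactly. -/
theorem exists_nhds_hausdorff_image_comparable {φ : E2 → E3} {s₀ : E2} (hφ : ContDiffAt ℝ 1 φ s₀)
    (hinj : Function.Injective (fderiv ℝ φ s₀)) {κ : ℝ≥0} (hκ : 1 < κ) :
    ∃ N ∈ 𝓝 s₀, ∀ A ⊆ N,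
      (μHE[2] : Measure E3) (φ '' A) ≤
        κ ^ 2 * (ENNReal.ofReal (areaDensity φ s₀) * volume A) ∧
      ENNReal.ofReal (areaDensity φ s₀) * volume A ≤
        κ ^ 2 * (μHE[2] : Measure E3) (φ '' A) := by
  set L := fderiv ℝ φ s₀ with hL
  obtain ⟨K, hK, hanti⟩ := (L : E2 →ₗ[ℝ] E3).exists_antilipschitzWith (LinearMap.ker_eq_bot.2 hinj)
  have hκ' : (1 : ℝ) < κ := by exact_mod_cast hκ
  have hKr : (0 : ℝ) < K := by exact_mod_cast hK
  -- This ε satisfies both requirements of the two-sided comparison: 1 + ε ≤ κ and κ (1 - ε) = 1.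
  obtain ⟨ε, hε⟩ : ∃ ε : ℝ, ε = 1 - 1 / (κ : ℝ) := ⟨_, rfl⟩
  have hε0 : 0 < ε := by
    rw [hε, sub_pos, div_lt_one (by linarith)]; exact hκ'
  have hε1 : 1 + ε ≤ κ := by
    have : (κ : ℝ) * (1 / κ) = 1 := by field_simp
    rw [hε]; nlinarith [sq_nonneg ((κ : ℝ) - 1), one_div_pos.2 (zero_lt_one.trans hκ')]
  have hε2 : κ * (1 - ε) = 1 := by rw [hε]; field_simp; ring
  -- With K the antilipschitz constant of L, an error (ε / K) ‖s - t‖ is at most ε ‖L s - L t‖.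
  obtain ⟨N, hN, happ⟩ := (hφ.hasStrictFDerivAt (by simp)).approximates_deriv_on_nhds
    (c := (ε / K).toNNReal) (Or.inr (Real.toNNReal_pos.2 (div_pos hε0 hKr)))
  have key : ∀ s ∈ N, ∀ t ∈ N, ‖φ s - φ t - (L s - L t)‖ ≤ ε * ‖L s - L t‖ := by
    intro s hs t ht
    have h1 := happ s hs t ht
    have h2 := hanti.le_mul_dist s t
    rw [dist_eq_norm, dist_eq_norm] at h2
    rw [map_sub] at h1
    rw [Real.coe_toNNReal _ (by positivity)] at h1
    refine h1.trans ?_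
    calc ε / K * ‖s - t‖ ≤ ε / K * (K * ‖L s - L t‖) := by
            gcongr; exact h2
      _ = _ := by field_simp
  have hvol : ∀ A : Set E2, (μHE[2] : Measure E3) (L '' A) =
      ENNReal.ofReal (areaDensity φ s₀) * volume A := by
    intro A
    have := (L : E2 →ₗ[ℝ] E3).euclideanHausdorffMeasure_image_eq_normDet_mul_volume A
    rw [normDet_fderiv] at this
    simpa using this
  refine ⟨N, hN, fun A hA => ?_⟩
  rw [← hvol]
  constructor
  · refine hausdorff_image_le_of_dist_le φ L A κ fun s hs t ht => ?_
    rw [dist_eq_norm, dist_eq_norm]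
    have h1 := key s (hA hs) t (hA ht)
    have h2 := norm_add_le (φ s - φ t - (L s - L t)) (L s - L t)
    rw [sub_add_cancel] at h2
    nlinarith [norm_nonneg (L s - L t)]
  · refine hausdorff_image_le_of_dist_le L φ A κ fun s hs t ht => ?_
    rw [dist_eq_norm, dist_eq_norm]
    have h1 := key s (hA hs) t (hA ht)
    have h2 := norm_sub_norm_le (L s - L t) (φ s - φ t)
    rw [norm_sub_rev (L s - L t)] at h2
    have h3 : (1 - ε) * ‖L s - L t‖ ≤ ‖φ s - φ t‖ := by linarith
    calc ‖L s - L t‖ = κ * ((1 - ε) * ‖L s - L t‖) := by rw [← mul_assoc, hε2, one_mul]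
      _ ≤ _ := by gcongr

/-- By the Lindelöf property countably many of the neighbourhoods cover; making them disjoint
reduces the claim to countable additivity. -/
theorem measure_le_of_forall_exists_nhds {α : Type*} [TopologicalSpace α]
    [SecondCountableTopology α] [MeasurableSpace α] [OpensMeasurableSpace α]
    {ν ρ : Measure α} (h : ∀ x, ∃ N ∈ 𝓝 x, ∀ A ⊆ N, MeasurableSet A → ν A ≤ ρ A) : ν ≤ ρ := by
  choose N hN hle using h
  obtain ⟨t, htc, ht⟩ := TopologicalSpace.countable_cover_nhds
    (f := fun x => interior (N x)) fun x => interior_mem_nhds.2 (hN x)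
  rw [Measure.le_iff]
  intro A hA
  rcases t.eq_empty_or_nonempty with rfl | hne
  · have : A = ∅ := by
      rw [← Set.subset_empty_iff]
      exact (Set.subset_univ A).trans (ht.symm.subset.trans (by simp))
    simp [this]
  obtain ⟨f, hf⟩ := htc.exists_eq_range hne
  set g : ℕ → Set α := disjointed fun k => interior (N (f k)) with hg
  have hgm : ∀ k, MeasurableSet (g k) := fun k =>
    MeasurableSet.disjointed (fun _ => isOpen_interior.measurableSet) k
  have hcov : ⋃ k, g k = univ := by
    rw [hg, iUnion_disjointed, ← ht, hf, biUnion_range]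
  have hdisj : Pairwise (Function.onFun Disjoint fun k => A ∩ g k) := fun i j hij =>
    ((disjoint_disjointed _) hij).mono inter_subset_right inter_subset_right
  have hAg : A = ⋃ k, A ∩ g k := by rw [← inter_iUnion, hcov, inter_univ]
  rw [hAg, measure_iUnion hdisj fun k => hA.inter (hgm k),
    measure_iUnion hdisj fun k => hA.inter (hgm k)]
  refine ENNReal.tsum_le_tsum fun k => hle (f k) _ ?_ (hA.inter (hgm k))
  exact inter_subset_right.trans ((disjointed_subset _ k).trans interior_subset)

/-- Let κ tend to 1. Of the three factors κ, two come from comparing two-dimensional Hausdorff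
measures and one from the oscillation of the area density. -/
theorem le_of_forall_one_lt_le_mul {a b : ℝ≥0∞} (h : ∀ κ : ℝ≥0, 1 < κ → a ≤ κ ^ 3 * b) :
    a ≤ b := by
  have h1 : Tendsto (fun κ : ℝ≥0 => (κ : ℝ≥0∞) ^ 3 * b) (𝓝[>] 1)
      (𝓝 (((1 : ℝ≥0) : ℝ≥0∞) ^ 3 * b)) := by
    refine ENNReal.Tendsto.mul_const ?_ (Or.inl (by simp))
    have : Continuous fun κ : ℝ≥0 => (κ : ℝ≥0∞) ^ 3 := by fun_prop
    exact (this.tendsto 1).mono_left nhdsWithin_le_nhds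
  simp only [ENNReal.coe_one, one_pow, one_mul] at h1
  exact ge_of_tendsto h1 (eventually_mem_nhdsWithin.mono fun κ hκ => h κ hκ)

section AreaFormula

variable {φ : E2 → E3} {U : Set E2}

theorem measurableEmbedding_restrict (hU : IsOpen U) (hφ : ∀ s ∈ U, ContinuousAt φ s)
    (hinj : InjOn φ U) : MeasurableEmbedding (U.domRestrict φ) := by
  have hc : ContinuousOn φ U := fun s hs => (hφ s hs).continuousWithinAt
  exact hc.measurableEmbedding hU.measurableSet hinj

/-- The area formula: the Hausdorff measure, pulled back by a parametrization, has the area density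
as its density. -/
theorem comap_hausdorff_eq_withDensity (hU : IsOpen U) (hφ : ∀ s ∈ U, ContDiffAt ℝ 1 φ s)
    (hinj : InjOn φ U) (himm : ∀ s ∈ U, Function.Injective (fderiv ℝ φ s)) :
    Measure.comap (U.domRestrict φ) (μHE[2] : Measure E3) =
      (Measure.comap ((↑) : U → E2) volume).withDensity
        fun s => ENNReal.ofReal (areaDensity φ s) := by
  have hme := measurableEmbedding_restrict hU (fun s hs => (hφ s hs).continuousAt) hinj
  have hmv : MeasurableEmbedding ((↑) : U → E2) := MeasurableEmbedding.subtype_coe hU.measurableSet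
  set ν := Measure.comap (U.domRestrict φ) (μHE[2] : Measure E3)
  set ρ := (Measure.comap ((↑) : U → E2) volume).withDensity
        fun s => ENNReal.ofReal (areaDensity φ s)
  have hloc : ∀ κ : ℝ≥0, 1 < κ → ∀ x : U, ∃ N ∈ 𝓝 x, ∀ A ⊆ N, MeasurableSet A →
      ν A ≤ κ ^ 3 * ρ A ∧ ρ A ≤ κ ^ 3 * ν A := by
    intro κ hκ x
    obtain ⟨N, hN, hcomp⟩ :=
      exists_nhds_hausdorff_image_comparable (hφ x x.2) (himm x x.2) hκ
    have hJ := areaDensity_pos (himm x x.2)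
    have hJc := continuousAt_areaDensity (hφ x x.2)
    have hκ' : (1 : ℝ) < κ := by exact_mod_cast hκ
    -- By continuity the density stays within a factor κ of its value at x, in both directions.
    have h1 : ∀ᶠ s in 𝓝 (x : E2), areaDensity φ s < κ * areaDensity φ x :=
      hJc.eventually (Iio_mem_nhds (by nlinarith))
    have h2 : ∀ᶠ s in 𝓝 (x : E2), areaDensity φ x < κ * areaDensity φ s := by
      have : ContinuousAt (fun s => κ * areaDensity φ s) (x : E2) := hJc.const_mul _
      exact this.eventually (Ioi_mem_nhds (by nlinarith))
    refine ⟨((↑) : U → E2) ⁻¹' (N ∩ {s | areaDensity φ s < κ * areaDensity φ x ∧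
      areaDensity φ x < κ * areaDensity φ s}),
      continuous_subtype_val.continuousAt.preimage_mem_nhds (inter_mem hN (h1.and h2)), ?_⟩
    intro A hA hAm
    have hνA : ν A = (μHE[2] : Measure E3) (φ '' (((↑) : U → E2) '' A)) := by
      rw [hme.comap_apply, image_image]; rfl
    have hvol : volume (((↑) : U → E2) '' A) = Measure.comap ((↑) : U → E2) volume A :=
      (hmv.comap_apply _ _).symm
    have hρA : ρ A = ∫⁻ s in A, ENNReal.ofReal (areaDensity φ s)
        ∂(Measure.comap ((↑) : U → E2) volume) := withDensity_apply _ hAm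
    obtain ⟨hc1, hc2⟩ := hcomp (((↑) : U → E2) '' A)
      (by rintro _ ⟨s, hs, rfl⟩; exact (hA hs).1)
    rw [← hνA, hvol] at hc1 hc2
    have hub : ρ A ≤ κ * (ENNReal.ofReal (areaDensity φ x) *
        Measure.comap ((↑) : U → E2) volume A) := by
      rw [hρA, ← mul_assoc]
      refine (setLIntegral_mono' (g := fun _ => κ * ENNReal.ofReal (areaDensity φ x)) hAm
        fun s hs => ?_).trans_eq (setLIntegral_const _ _)
      rw [← ENNReal.ofReal_coe_nnreal, ← ENNReal.ofReal_mul κ.coe_nonneg]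
      exact ENNReal.ofReal_le_ofReal (hA hs).2.1.le
    have hlb : ENNReal.ofReal (areaDensity φ x) *
        Measure.comap ((↑) : U → E2) volume A ≤ κ * ρ A := by
      rw [hρA, ← lintegral_const_mul' _ _ (by simp)]
      refine (setLIntegral_const _ _).symm.trans_le (setLIntegral_mono' hAm fun s hs => ?_)
      rw [← ENNReal.ofReal_coe_nnreal, ← ENNReal.ofReal_mul κ.coe_nonneg]
      exact ENNReal.ofReal_le_ofReal (hA hs).2.2.le
    constructor
    · calc ν A ≤ κ ^ 2 * (κ * ρ A) := hc1.trans (by gcongr)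
        _ = κ ^ 3 * ρ A := by ring
    · calc ρ A ≤ κ * (κ ^ 2 * ν A) := hub.trans (by gcongr)
        _ = κ ^ 3 * ν A := by ring
  have glob : ∀ κ : ℝ≥0, 1 < κ → ν ≤ ((κ : ℝ≥0∞) ^ 3) • ρ ∧ ρ ≤ ((κ : ℝ≥0∞) ^ 3) • ν := by
    intro κ hκ
    constructor <;> refine measure_le_of_forall_exists_nhds fun x => ?_ <;>
      obtain ⟨N, hN, h⟩ := hloc κ hκ x
    · exact ⟨N, hN, fun A hA hm => (h A hA hm).1⟩
    · exact ⟨N, hN, fun A hA hm => (h A hA hm).2⟩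
  refine le_antisymm ?_ ?_
  · exact Measure.le_iff'.2 fun A => le_of_forall_one_lt_le_mul fun κ hκ => (glob κ hκ).1 A
  · exact Measure.le_iff'.2 fun A => le_of_forall_one_lt_le_mul fun κ hκ => (glob κ hκ).2 A

theorem hausdorff_image_eq_lintegral (hU : IsOpen U) (hφ : ∀ s ∈ U, ContDiffAt ℝ 1 φ s)
    (hinj : InjOn φ U) (himm : ∀ s ∈ U, Function.Injective (fderiv ℝ φ s))
    {A : Set E2} (hA : A ⊆ U) (hAm : MeasurableSet A) :
    (μHE[2] : Measure E3) (φ '' A) = ∫⁻ s in A, ENNReal.ofReal (areaDensity φ s) := by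
  have hme := measurableEmbedding_restrict hU (fun s hs => (hφ s hs).continuousAt) hinj
  have hmv : MeasurableEmbedding ((↑) : U → E2) := MeasurableEmbedding.subtype_coe hU.measurableSet
  have h := congrArg (fun m => m (((↑) : U → E2) ⁻¹' A))
    (comap_hausdorff_eq_withDensity hU hφ hinj himm)
  simp only at h
  rw [hme.comap_apply, withDensity_apply _ (hAm.preimage measurable_subtype_coe)] at h
  have h1 : U.domRestrict φ '' (((↑) : U → E2) ⁻¹' A) = φ '' A := by
    rw [show U.domRestrict φ = φ ∘ ((↑) : U → E2) from rfl, image_comp,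
      Subtype.image_preimage_coe, inter_eq_right.2 hA]
  rw [h1] at h
  rw [h, ← hmv.lintegral_map (fun s => ENNReal.ofReal (areaDensity φ s)),
    ← hmv.restrict_map, hmv.map_comap, Subtype.range_coe,
    Measure.restrict_restrict hAm, inter_eq_left.2 hA]

/-- The integrand may be arbitrary: transport along a measurable embedding and removal of a
measurable density need no measurability of f. -/
theorem setIntegral_image_eq (hU : IsOpen U) (hφ : ∀ s ∈ U, ContDiffAt ℝ 1 φ s)
    (hinj : InjOn φ U) (himm : ∀ s ∈ U, Function.Injective (fderiv ℝ φ s)) (f : E3 → ℝ) :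
    ∫ y in φ '' U, f y ∂(μHE[2] : Measure E3) = ∫ s in U, areaDensity φ s * f (φ s) := by
  have hme := measurableEmbedding_restrict hU (fun s hs => (hφ s hs).continuousAt) hinj
  have hmv : MeasurableEmbedding ((↑) : U → E2) := MeasurableEmbedding.subtype_coe hU.measurableSet
  have hr : range (U.domRestrict φ) = φ '' U := by
    rw [range_domRestrict]
  have hJc : Continuous fun s : U => areaDensity φ s := by
    rw [continuous_iff_continuousAt]
    intro s
    exact (continuousAt_areaDensity (hφ s s.2)).comp continuous_subtype_val.continuousAt
  rw [← hr, ← hme.map_comap, hme.integral_map, comap_hausdorff_eq_withDensity hU hφ hinj himm]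
  have hm : Measurable fun s : U => (areaDensity φ s).toNNReal :=
    hJc.measurable.real_toNNReal
  have := integral_withDensity_eq_integral_smul (μ := Measure.comap ((↑) : U → E2) volume) hm
    (fun s : U => f (φ s))
  simp only [ENNReal.ofReal, domRestrict_apply]
  have h3 := hmv.integral_map (μ := Measure.comap ((↑) : U → E2) volume)
    fun s => areaDensity φ s * f (φ s)
  rw [hmv.map_comap, Subtype.range_coe] at h3
  rw [this, h3]
  refine integral_congr_ae (Eventually.of_forall fun s => ?_)
  simp only [NNReal.smul_def, smul_eq_mul]
  rw [Real.coe_toNNReal (areaDensity φ s) (norm_nonneg _)]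

end AreaFormula

end

section

/-! ### Local parametrizations and extensions -/

variable {Γ : Set E3} {U : Set E2} {μ : E2 → E3} {n : E3 → E3} {s : E2} {y : E3} {k : ℕ}

/-- `f` is of class `C^k` on `Γ` near `y`. -/
def ExtAt {F : Type*} [NormedAddCommGroup F] [NormedSpace ℝ F]
    (k : ℕ) (Γ : Set E3) (f : E3 → F) (y : E3) : Prop :=
  ∃ g, IsLocalExt k Γ f y g

theorem IsLocalParam.contDiffAt (h : IsLocalParam Γ U μ) (hs : s ∈ U) : ContDiffAt ℝ 3 μ s :=
  h.contDiffOn.contDiffAt (h.isOpen.mem_nhds hs)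

theorem IsLocalParam.differentiableAt (h : IsLocalParam Γ U μ) (hs : s ∈ U) :
    DifferentiableAt ℝ μ s :=
  (h.contDiffAt hs).differentiableAt (by simp)

theorem IsLocalParam.injOn (h : IsLocalParam Γ U μ) : InjOn μ U :=
  injOn_iff_injective.2 h.isEmbedding.injective

theorem IsLocalParam.mem (h : IsLocalParam Γ U μ) (hs : s ∈ U) : μ s ∈ Γ := by
  obtain ⟨V, -, hV⟩ := h.image_eq
  exact (hV.subset ⟨s, hs, rfl⟩).1

/-- The embedding makes parameters close when their images are, and `image_eq` makes the image of U
a neighbourhood of μ s in Γ. Together they carry statements near s over to Γ near μ s. -/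
theorem IsLocalParam.eventually_nhdsWithin (h : IsLocalParam Γ U μ) (hs : s ∈ U) {p : E2 → Prop}
    (hp : ∀ᶠ t in 𝓝 s, p t) : ∀ᶠ z in 𝓝[Γ] μ s, ∃ t ∈ U, p t ∧ μ t = z := by
  obtain ⟨V, hVo, hV⟩ := h.image_eq
  have h1 : ∀ᶠ t : U in 𝓝 (⟨s, hs⟩ : U), p t :=
    continuous_subtype_val.continuousAt.eventually hp
  rw [h.isEmbedding.nhds_eq_comap, eventually_comap] at h1
  have h2 : ∀ᶠ z in 𝓝[Γ] μ s, z ∈ Γ ∩ V :=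
    inter_mem self_mem_nhdsWithin
      (mem_nhdsWithin_of_mem_nhds (hVo.mem_nhds (hV.subset ⟨s, hs, rfl⟩).2))
  filter_upwards [h2, mem_nhdsWithin_of_mem_nhds h1] with z hz hz'
  obtain ⟨t, ht, rfl⟩ := hV.symm.subset hz
  exact ⟨t, ht, hz' ⟨t, ht⟩ rfl, rfl⟩

theorem IsLocalParam.tendsto (h : IsLocalParam Γ U μ) (hs : s ∈ U) :
    Tendsto μ (𝓝 s) (𝓝[Γ] μ s) :=
  tendsto_nhdsWithin_iff.2 ⟨(h.contDiffAt hs).continuousAt,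
    (h.isOpen.eventually_mem hs).mono fun _ ht => h.mem ht⟩

/-- A parametrization has a local inverse that is the restriction of a `C³` map. -/
theorem IsLocalParam.exists_localInverse (h : IsLocalParam Γ U μ) (hs : s ∈ U) :
    ∃ r : E3 → E2, ContDiffAt ℝ 3 r (μ s) ∧ r (μ s) = s ∧ ∀ᶠ z in 𝓝[Γ] μ s, μ (r z) = z := by
  set L := fderiv ℝ μ s
  -- With ℓ a linear left inverse of the differential L, the map ℓ ∘ μ of the plane has derivative
  -- the identity at s. The inverse function theorem gives r = (ℓ ∘ μ)⁻¹ ∘ ℓ.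
  obtain ⟨l, hl⟩ := (L : E2 →ₗ[ℝ] E3).exists_leftInverse_of_injective
    (LinearMap.ker_eq_bot.2 (h.injective_fderiv s hs))
  set ℓ : E3 →L[ℝ] E2 := l.toContinuousLinearMap
  have hℓ : ∀ v, ℓ (L v) = v := fun v => LinearMap.congr_fun hl v
  have hc : ContDiffAt ℝ 3 (fun t => ℓ (μ t)) s := ℓ.contDiff.contDiffAt.comp s (h.contDiffAt hs)
  have hd : HasFDerivAt (fun t => ℓ (μ t))
      ((ContinuousLinearEquiv.refl ℝ E2 : E2 ≃L[ℝ] E2) : E2 →L[ℝ] E2) s := by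
    have := ℓ.hasFDerivAt.comp s (h.differentiableAt hs).hasFDerivAt
    have h2 : ℓ.comp (fderiv ℝ μ s) =
        ((ContinuousLinearEquiv.refl ℝ E2 : E2 ≃L[ℝ] E2) : E2 →L[ℝ] E2) := by
      ext v : 1
      exact hℓ v
    rw [h2] at this
    exact this
  have hst := hc.hasStrictFDerivAt' hd (by simp)
  have hinv : ∀ᶠ t in 𝓝 s, hc.localInverse hd (by simp) (ℓ (μ t)) = t :=
    hst.eventually_left_inverse
  refine ⟨fun z => hc.localInverse hd (by simp) (ℓ z), ?_, hinv.self_of_nhds, ?_⟩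
  · exact (hc.to_localInverse hd (by simp)).comp (μ s) ℓ.contDiff.contDiffAt
  · filter_upwards [h.eventually_nhdsWithin hs hinv] with z hz
    obtain ⟨t, -, ht, rfl⟩ := hz
    rw [ht]

/-! ### Functions of class C^k near a point of Γ -/

section

variable {F : Type*} [NormedAddCommGroup F] [NormedSpace ℝ F] {f g : E3 → F}

theorem IsLocalExt.comp_param (hg : IsLocalExt k Γ f (μ s) g) (h : IsLocalParam Γ U μ)
    (hs : s ∈ U) : (fun t => g (μ t)) =ᶠ[𝓝 s] fun t => f (μ t) :=
  (h.tendsto hs).eventually hg.2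

theorem ExtAt.comp_param (hf : ExtAt k Γ f (μ s)) (hk : k ≤ 3) (h : IsLocalParam Γ U μ)
    (hs : s ∈ U) : ContDiffAt ℝ k (fun t => f (μ t)) s := by
  obtain ⟨g, hg⟩ := hf
  have hk' : (k : WithTop ℕ∞) ≤ 3 := by exact_mod_cast hk
  exact (hg.1.comp s ((h.contDiffAt hs).of_le hk')).congr_of_eventuallyEq
    (hg.comp_param h hs).symm

/-- The extension is f ∘ μ ∘ r with r the local inverse. The bound k ≤ 3 reflects the regularity of
μ and r. Regularity on Γ is thus regularity in coordinates. -/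
theorem ExtAt.of_comp_param (hk : k ≤ 3) (h : IsLocalParam Γ U μ)
    (hs : s ∈ U) (hf : ContDiffAt ℝ k (fun t => f (μ t)) s) : ExtAt k Γ f (μ s) := by
  obtain ⟨r, hr, hrs, hμr⟩ := h.exists_localInverse hs
  have hk' : (k : WithTop ℕ∞) ≤ 3 := by exact_mod_cast hk
  refine ⟨fun z => f (μ (r z)), ?_, hμr.mono fun z hz => congrArg f hz⟩
  have hf' : ContDiffAt ℝ k (fun t => f (μ t)) (r (μ s)) := by rwa [hrs]
  exact hf'.comp (μ s) (hr.of_le hk')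

theorem ExtAt.mono {l : ℕ} (hf : ExtAt k Γ f y) (hl : l ≤ k) : ExtAt l Γ f y := by
  obtain ⟨g, hg, hg'⟩ := hf
  exact ⟨g, hg.of_le (by exact_mod_cast hl), hg'⟩

theorem ContDiffAt.extAt (hf : ContDiffAt ℝ k f y) : ExtAt k Γ f y :=
  ⟨f, hf, EventuallyEq.rfl⟩

theorem IsLocalExt.eventually (hg : IsLocalExt k Γ f y g) :
    ∀ᶠ z in 𝓝[Γ] y, IsLocalExt k Γ f z g := by
  filter_upwards [mem_nhdsWithin_of_mem_nhds (hg.1.eventually (by simp)),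
    eventually_eventually_nhdsWithin.2 hg.2] with z h1 h2
  exact ⟨h1, h2⟩

theorem ExtAt.eventually (hf : ExtAt k Γ f y) : ∀ᶠ z in 𝓝[Γ] y, ExtAt k Γ f z := by
  obtain ⟨g, hg⟩ := hf
  exact hg.eventually.mono fun z hz => ⟨g, hz⟩

theorem extAt_pi_iff {X : E3 → E3} : ExtAt k Γ X y ↔ ∀ i, ExtAt k Γ (fun z => X z i) y := by
  constructor
  · rintro ⟨g, hg, hg'⟩ i
    exact ⟨fun z => g z i, contDiffAt_euclidean.1 hg i, hg'.mono fun z hz => congrArg (· i) hz⟩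
  · intro h
    choose g hg using h
    refine ⟨fun z => WithLp.toLp 2 fun i => g i z, contDiffAt_euclidean.2 fun i => (hg i).1, ?_⟩
    filter_upwards [eventually_all.2 fun i => (hg i).2] with z hz
    ext i
    exact hz i

theorem ExtAt.continuousWithinAt (hf : ExtAt k Γ f y) (hy : y ∈ Γ) : ContinuousWithinAt f Γ y := by
  obtain ⟨g, hg, hg'⟩ := hf
  exact hg.continuousAt.continuousWithinAt.congr_of_eventuallyEq hg'.symm
    (hg'.self_of_nhdsWithin hy).symm

theorem IsCk.continuousOn (hf : IsCk k Γ f) : ContinuousOn f Γ := fun y hy =>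
  ExtAt.continuousWithinAt (hf y ⟨hy, mem_univ _⟩) hy

end

/-! ### Algebra of scalar functions of class C^k -/

section Scalar

variable {f g : E3 → ℝ}

theorem ExtAt.const (c : ℝ) : ExtAt k Γ (fun _ => c) y := contDiffAt_const.extAt

theorem ExtAt.add (hf : ExtAt k Γ f y) (hg : ExtAt k Γ g y) : ExtAt k Γ (fun z => f z + g z) y := by
  obtain ⟨f', hf⟩ := hf
  obtain ⟨g', hg⟩ := hg
  exact ⟨fun z => f' z + g' z, hf.1.add hg.1, hf.2.add hg.2⟩

theorem ExtAt.mul (hf : ExtAt k Γ f y) (hg : ExtAt k Γ g y) : ExtAt k Γ (fun z => f z * g z) y := by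
  obtain ⟨f', hf⟩ := hf
  obtain ⟨g', hg⟩ := hg
  exact ⟨fun z => f' z * g' z, hf.1.mul hg.1, hf.2.mul hg.2⟩

theorem ExtAt.neg (hf : ExtAt k Γ f y) : ExtAt k Γ (fun z => -f z) y := by
  obtain ⟨f', hf⟩ := hf
  exact ⟨fun z => -f' z, hf.1.neg, hf.2.neg⟩

theorem ExtAt.sub (hf : ExtAt k Γ f y) (hg : ExtAt k Γ g y) : ExtAt k Γ (fun z => f z - g z) y := by
  obtain ⟨f', hf⟩ := hf
  obtain ⟨g', hg⟩ := hg
  exact ⟨fun z => f' z - g' z, hf.1.sub hg.1, hf.2.sub hg.2⟩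

theorem ExtAt.inv (hf : ExtAt k Γ f y) (h0 : f y ≠ 0) (hy : y ∈ Γ) :
    ExtAt k Γ (fun z => (f z)⁻¹) y := by
  obtain ⟨f', hf⟩ := hf
  refine ⟨fun z => (f' z)⁻¹, hf.1.inv ?_, hf.2.inv⟩
  rwa [hf.2.self_of_nhdsWithin hy]

theorem ExtAt.sqrt (hf : ExtAt k Γ f y) (h0 : f y ≠ 0) (hy : y ∈ Γ) :
    ExtAt k Γ (fun z => √(f z)) y := by
  obtain ⟨f', hf⟩ := hf
  refine ⟨fun z => √(f' z), hf.1.sqrt ?_, hf.2.fun_comp _⟩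
  rwa [hf.2.self_of_nhdsWithin hy]

theorem ExtAt.sum {ι : Type*} {F : ι → E3 → ℝ} (A : Finset ι) (h : ∀ i ∈ A, ExtAt k Γ (F i) y) :
    ExtAt k Γ (fun z => ∑ i ∈ A, F i z) y := by
  classical
  induction A using Finset.induction_on with
  | empty => simpa using ExtAt.const 0
  | insert a A ha ih =>
    simp only [Finset.sum_insert ha]
    exact (h a (by simp)).add (ih fun i hi => h i (by simp [hi]))

end Scalar

/-! ### The unit normal is of class `C²` -/

/-- With c = a × b, the difference of the two sides is c × (v × c), and v × c = (v · b) a - (v · a)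
b = 0. -/
theorem norm_cross_sq_smul (a b v : E3) (ha : ⟪a, v⟫ = 0) (hb : ⟪b, v⟫ = 0) :
    ‖cross a b‖ ^ 2 • v = ⟪cross a b, v⟫ • cross a b := by
  rw [← real_inner_self_eq_norm_sq]
  simp only [inner_eq_sum] at *
  ext i
  fin_cases i <;> simp [cross]
  · linear_combination -((a 2 * b 0 - a 0 * b 2) * b 2 - (a 0 * b 1 - a 1 * b 0) * b 1) * ha
      + ((a 2 * b 0 - a 0 * b 2) * a 2 - (a 0 * b 1 - a 1 * b 0) * a 1) * hb
  · linear_combination -((a 0 * b 1 - a 1 * b 0) * b 0 - (a 1 * b 2 - a 2 * b 1) * b 2) * ha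
      + ((a 0 * b 1 - a 1 * b 0) * a 0 - (a 1 * b 2 - a 2 * b 1) * a 2) * hb
  · linear_combination -((a 1 * b 2 - a 2 * b 1) * b 1 - (a 2 * b 0 - a 0 * b 2) * b 0) * ha
      + ((a 1 * b 2 - a 2 * b 1) * a 1 - (a 2 * b 0 - a 0 * b 2) * a 0) * hb

/-- The unit normal given by a parametrization. -/
def paramNormal (μ : E2 → E3) (s : E2) : E3 :=
  (areaDensity μ s)⁻¹ • cross (coordVec μ s 0) (coordVec μ s 1)

theorem IsLocalParam.contDiffAt_coordVec (h : IsLocalParam Γ U μ) (hs : s ∈ U) (i : Fin 2) :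
    ContDiffAt ℝ 2 (fun t => coordVec μ t i) s :=
  ((h.contDiffAt hs).fderiv_right (m := 2) (by norm_num)).clm_apply contDiffAt_const

theorem IsLocalParam.areaDensity_pos (h : IsLocalParam Γ U μ) (hs : s ∈ U) : 0 < areaDensity μ s :=
  SurfaceCalculus.areaDensity_pos (h.injective_fderiv s hs)

theorem IsLocalParam.contDiffAt_cross (h : IsLocalParam Γ U μ) (hs : s ∈ U) :
    ContDiffAt ℝ 2 (fun t => cross (coordVec μ t 0) (coordVec μ t 1)) s :=
  (contDiff_cross.contDiffAt.of_le le_top).comp s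
    ((h.contDiffAt_coordVec hs 0).prodMk (h.contDiffAt_coordVec hs 1))

theorem IsLocalParam.contDiffAt_areaDensity (h : IsLocalParam Γ U μ) (hs : s ∈ U) :
    ContDiffAt ℝ 2 (areaDensity μ) s :=
  (h.contDiffAt_cross hs).norm ℝ (norm_pos_iff.1 (h.areaDensity_pos hs))

theorem IsLocalParam.contDiffAt_paramNormal (h : IsLocalParam Γ U μ) (hs : s ∈ U) :
    ContDiffAt ℝ 2 (paramNormal μ) s :=
  ((h.contDiffAt_areaDensity hs).inv (h.areaDensity_pos hs).ne').smul (h.contDiffAt_cross hs)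

theorem IsLocalParam.norm_paramNormal (h : IsLocalParam Γ U μ) (hs : s ∈ U) :
    ‖paramNormal μ s‖ = 1 := by
  have := h.areaDensity_pos hs
  rw [paramNormal, norm_smul, norm_inv, Real.norm_eq_abs, abs_of_pos this]
  exact inv_mul_cancel₀ this.ne'

theorem IsLocalParam.normal_eq (h : IsLocalParam Γ U μ) (hn : IsUnitNormal Γ n) (hs : s ∈ U) :
    n (μ s) = ⟪paramNormal μ s, n (μ s)⟫ • paramNormal μ s := by
  have hJ := h.areaDensity_pos hs
  have := norm_cross_sq_smul _ _ _ (hn.inner_eq_zero U μ h s hs 0) (hn.inner_eq_zero U μ h s hs 1)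
  rw [show ‖cross (coordVec μ s 0) (coordVec μ s 1)‖ = areaDensity μ s from rfl] at this
  simp only [paramNormal, real_inner_smul_left, smul_smul]
  have h2 := congrArg (fun v => ((areaDensity μ s) ^ 2)⁻¹ • v) this
  simp only [smul_smul] at h2
  rw [inv_mul_cancel₀ (by positivity), one_smul] at h2
  conv_lhs => rw [h2]
  congr 1
  field_simp

/-- The coefficient of n along `paramNormal` is continuous and squares to one, hence is locally
constant. Here the continuity of n is turned into class C². -/
theorem IsLocalParam.eventually_normal_eq (h : IsLocalParam Γ U μ) (hn : IsUnitNormal Γ n)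
    (hs : s ∈ U) : ∃ ε : ℝ, ε ^ 2 = 1 ∧ ∀ᶠ t in 𝓝 s, n (μ t) = ε • paramNormal μ t := by
  set σ : E2 → ℝ := fun t => ⟪paramNormal μ t, n (μ t)⟫
  have hσ : ∀ t ∈ U, σ t ^ 2 = 1 := by
    intro t ht
    have h1 := congrArg norm (h.normal_eq hn ht)
    rw [norm_smul, hn.norm_eq_one _ (h.mem ht), h.norm_paramNormal ht, mul_one] at h1
    rw [← sq_abs, ← Real.norm_eq_abs, ← h1, one_pow]
  have hc : ContinuousAt σ s := by
    refine (h.contDiffAt_paramNormal hs).continuousAt.inner ?_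
    exact (hn.continuousOn (μ s) (h.mem hs)).tendsto.comp (h.tendsto hs)
  refine ⟨σ s, hσ s hs, ?_⟩
  have h1 : ∀ᶠ t in 𝓝 s, dist (σ t) (σ s) < 1 := hc.eventually (Metric.ball_mem_nhds _ one_pos)
  filter_upwards [h1, h.isOpen.mem_nhds hs] with t ht htU
  have : σ t = σ s := by
    have e1 := hσ t htU
    have e2 := hσ s hs
    rw [Real.dist_eq] at ht
    rcases eq_or_eq_neg_of_sq_eq_sq _ _ (e1.trans (one_pow 2).symm) with a | a <;>
      rcases eq_or_eq_neg_of_sq_eq_sq _ _ (e2.trans (one_pow 2).symm) with b | b <;>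
      rw [a, b] at ht ⊢ <;> norm_num at ht
  rw [← this]
  exact h.normal_eq hn htU

theorem IsUnitNormal.extAt (hΓ : IsClosedSurface Γ) (hn : IsUnitNormal Γ n) (hy : y ∈ Γ) :
    ExtAt 2 Γ n y := by
  obtain ⟨U, μ, h, s, hs, rfl⟩ := hΓ.exists_param y hy
  obtain ⟨ε, -, hε⟩ := h.eventually_normal_eq hn hs
  refine ExtAt.of_comp_param (by norm_num) h hs ?_
  exact ((h.contDiffAt_paramNormal hs).const_smul ε).congr_of_eventuallyEq hε

theorem IsUnitNormal.sum_sq (hn : IsUnitNormal Γ n) (hy : y ∈ Γ) : ∑ i, n y i * n y i = 1 := by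
  have h : ⟪n y, n y⟫ = 1 := by rw [real_inner_self_eq_norm_sq, hn.norm_eq_one y hy, one_pow]
  rw [← h, PiLp.inner_apply]
  rfl

/-! ### Tangent vectors -/

theorem IsLocalParam.inner_fderiv (h : IsLocalParam Γ U μ) (hn : IsUnitNormal Γ n) (hs : s ∈ U)
    (w : E2) : ⟪fderiv ℝ μ s w, n (μ s)⟫ = 0 := by
  have hw : w = w 0 • EuclideanSpace.single 0 1 + w 1 • EuclideanSpace.single 1 1 := by
    ext i; fin_cases i <;> simp
  rw [hw, map_add, map_smul, map_smul, inner_add_left, real_inner_smul_left, real_inner_smul_left]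
  have h0 := hn.inner_eq_zero U μ h s hs 0
  have h1 := hn.inner_eq_zero U μ h s hs 1
  rw [coordVec] at h0 h1
  rw [h0, h1]; simp

/-- The range of the differential lies in the orthogonal complement of n, and both have dimension
two. -/
theorem IsLocalParam.exists_fderiv_eq (h : IsLocalParam Γ U μ) (hn : IsUnitNormal Γ n) (hs : s ∈ U)
    {v : E3} (hv : ⟪v, n (μ s)⟫ = 0) : ∃ w, fderiv ℝ μ s w = v := by
  have hne : n (μ s) ≠ 0 := by
    rw [← norm_ne_zero_iff, hn.norm_eq_one _ (h.mem hs)]; exact one_ne_zero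
  have h1 : LinearMap.range (fderiv ℝ μ s : E2 →ₗ[ℝ] E3) ≤ (Submodule.span ℝ {n (μ s)})ᗮ := by
    rintro _ ⟨w, rfl⟩
    rw [Submodule.mem_orthogonal_singleton_iff_inner_left]
    exact h.inner_fderiv hn hs w
  have h2 : Module.finrank ℝ (LinearMap.range (fderiv ℝ μ s : E2 →ₗ[ℝ] E3)) = 2 := by
    rw [LinearMap.finrank_range_of_inj (h.injective_fderiv s hs)]; simp
  have : Fact (Module.finrank ℝ E3 = 2 + 1) := ⟨by simp⟩
  have h3 : Module.finrank ℝ (Submodule.span ℝ {n (μ s)})ᗮ = 2 :=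
    Submodule.finrank_orthogonal_span_singleton hne
  have h4 := Submodule.eq_of_le_of_finrank_eq h1 (h2.trans h3.symm)
  have : v ∈ (Submodule.span ℝ {n (μ s)})ᗮ := by
    rwa [Submodule.mem_orthogonal_singleton_iff_inner_left]
  rw [← h4] at this
  exact this

/-! ### Tangential derivatives -/

/-- The projection of the `i`-th standard basis vector to the tangent plane. -/
def projE (n : E3 → E3) (i : Fin 3) (y : E3) : E3 :=
  EuclideanSpace.single i 1 - n y i • n y

theorem projE_apply (i j : Fin 3) : projE n i y j = P n y i j := by
  simp [projE, P, Matrix.one_apply, Matrix.vecMulVec_apply, eq_comm]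

theorem IsUnitNormal.inner_projE (hn : IsUnitNormal Γ n) (hy : y ∈ Γ) (i : Fin 3) :
    ⟪projE n i y, n y⟫ = 0 := by
  rw [projE, inner_sub_left, real_inner_smul_left, real_inner_self_eq_norm_sq,
    hn.norm_eq_one y hy]
  simp [EuclideanSpace.inner_single_left]

theorem sum_smul_projE (v : E3) (hv : ⟪v, n y⟫ = 0) : ∑ i, v i • projE n i y = v := by
  have h1 : ∑ i, v i * n y i = 0 := by
    rw [← hv]; simp [PiLp.inner_apply, mul_comm]
  simp only [projE, smul_sub, Finset.sum_sub_distrib, smul_smul, ← Finset.sum_smul]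
  rw [h1, zero_smul, sub_zero]
  ext j
  simp [Finset.sum_apply, Pi.single_apply]

/-- A tangent vector is the image of some w under the differential of μ, and the derivative of an
extension along it is that of f ∘ μ along w, which does not involve the extension. -/
theorem IsLocalExt.fderiv_eq {f g g' : E3 → ℝ} (hΓ : IsClosedSurface Γ) (hn : IsUnitNormal Γ n)
    (hy : y ∈ Γ) (hg : IsLocalExt 1 Γ f y g) (hg' : IsLocalExt 1 Γ f y g') {v : E3}
    (hv : ⟪v, n y⟫ = 0) : fderiv ℝ g y v = fderiv ℝ g' y v := by
  obtain ⟨U, μ, h, s, hs, rfl⟩ := hΓ.exists_param y hy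
  obtain ⟨w, rfl⟩ := h.exists_fderiv_eq hn hs hv
  have key : ∀ g, IsLocalExt 1 Γ f (μ s) g →
      fderiv ℝ g (μ s) (fderiv ℝ μ s w) = fderiv ℝ (fun t => f (μ t)) s w := by
    intro g hg
    rw [← (hg.comp_param h hs).fderiv_eq]
    have := fderiv_comp s (hg.1.differentiableAt (by simp)) (h.differentiableAt hs)
    rw [show (fun t => g (μ t)) = g ∘ μ from rfl, this]; rfl
  rw [key g hg, key g' hg']

/-- Row i of P is the tangent vector `projE n i y`, so the extension chosen by `Classical.epsilon`
may be exchanged for any other. -/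
theorem IsLocalExt.tanDeriv_eq {f g : E3 → ℝ} (hΓ : IsClosedSurface Γ) (hn : IsUnitNormal Γ n)
    (hy : y ∈ Γ) (hg : IsLocalExt 1 Γ f y g) (i : Fin 3) :
    tanDeriv Γ n i f y = fderiv ℝ g y (projE n i y) := by
  have he : IsLocalExt 1 Γ f y (Classical.epsilon (IsLocalExt 1 Γ f y)) :=
    Classical.epsilon_spec (p := IsLocalExt 1 Γ f y) ⟨g, hg⟩
  rw [hg.fderiv_eq hΓ hn hy he (hn.inner_projE hy i), tanDeriv]
  have : projE n i y = ∑ j, P n y i j • EuclideanSpace.single j (1 : ℝ) := by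
    ext j
    rw [projE_apply]
    simp [Finset.sum_apply, Pi.single_apply]
  rw [this, map_sum]
  simp

theorem IsLocalExt.fderiv_tangent {f g : E3 → ℝ} (hΓ : IsClosedSurface Γ) (hn : IsUnitNormal Γ n)
    (hy : y ∈ Γ) (hg : IsLocalExt 1 Γ f y g) {v : E3} (hv : ⟪v, n y⟫ = 0) :
    fderiv ℝ g y v = ∑ i, tanDeriv Γ n i f y * v i := by
  conv_lhs => rw [← sum_smul_projE v hv]
  rw [map_sum]
  refine Finset.sum_congr rfl fun i _ => ?_
  rw [map_smul, hg.tanDeriv_eq hΓ hn hy, smul_eq_mul, mul_comm]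

theorem IsLocalParam.fderiv_comp {f : E3 → ℝ} (h : IsLocalParam Γ U μ) (hΓ : IsClosedSurface Γ)
    (hn : IsUnitNormal Γ n) (hs : s ∈ U) (hf : ExtAt 1 Γ f (μ s)) (w : E2) :
    fderiv ℝ (fun t => f (μ t)) s w = ∑ i, tanDeriv Γ n i f (μ s) * fderiv ℝ μ s w i := by
  obtain ⟨g, hg⟩ := hf
  rw [← hg.fderiv_tangent hΓ hn (h.mem hs) (h.inner_fderiv hn hs w),
    ← (hg.comp_param h hs).fderiv_eq]
  have := _root_.fderiv_comp s (hg.1.differentiableAt (by simp)) (h.differentiableAt hs)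
  rw [show (fun t => g (μ t)) = g ∘ μ from rfl, this]; rfl

/-- An explicit extension of D_i f, with N extending n. It allows tangential derivatives to be
iterated, at the cost of one derivative of f. -/
theorem IsLocalExt.tanDeriv {f g : E3 → ℝ} {N : E3 → E3} (hΓ : IsClosedSurface Γ)
    (hn : IsUnitNormal Γ n) (hg : IsLocalExt (k + 1) Γ f y g) (hN : IsLocalExt k Γ n y N)
    (i : Fin 3) :
    IsLocalExt k Γ (tanDeriv Γ n i f) y
      fun z => fderiv ℝ g z (EuclideanSpace.single i 1 - N z i • N z) := by
  refine ⟨?_, ?_⟩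
  · have h1 : ContDiffAt ℝ k (fderiv ℝ g) y := hg.1.fderiv_right (by norm_cast)
    exact h1.clm_apply (contDiffAt_const.sub ((contDiffAt_euclidean.1 hN.1 i).smul hN.1))
  · filter_upwards [hg.eventually, hN.2, self_mem_nhdsWithin] with z hz hNz hzΓ
    have hz1 : IsLocalExt 1 Γ f z g := ⟨hz.1.of_le (by norm_cast; omega), hz.2⟩
    rw [hz1.tanDeriv_eq hΓ hn hzΓ, hNz, projE]

theorem ExtAt.tanDeriv {f : E3 → ℝ} (hΓ : IsClosedSurface Γ) (hn : IsUnitNormal Γ n)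
    (hy : y ∈ Γ) (hf : ExtAt (k + 1) Γ f y) (hk : k ≤ 2) (i : Fin 3) :
    ExtAt k Γ (tanDeriv Γ n i f) y := by
  obtain ⟨g, hg⟩ := hf
  obtain ⟨N, hN⟩ := (hn.extAt hΓ hy).mono hk
  exact ⟨_, hg.tanDeriv hΓ hn hN i⟩

/-- The two functions have the same extensions, so the choice operator returns the same one;
differentiability plays no role. -/
theorem tanDeriv_congr {f g : E3 → ℝ} {i : Fin 3} (h : f =ᶠ[𝓝[Γ] y] g) :
    tanDeriv Γ n i f y = tanDeriv Γ n i g y := by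
  have : IsLocalExt 1 Γ f y = IsLocalExt 1 Γ g y := by
    ext e
    exact and_congr_right fun _ => ⟨fun he => he.trans h, fun he => he.trans h.symm⟩
  rw [SurfaceCalculus.tanDeriv, this, SurfaceCalculus.tanDeriv]

end

section

/-! ### Calculus of tangential derivatives -/

theorem fderiv_coord {E : Type*} [NormedAddCommGroup E] [NormedSpace ℝ E] {Y : E → E3} {x : E}
    (hY : DifferentiableAt ℝ Y x) (v : E) (j : Fin 3) :
    fderiv ℝ (fun z => Y z j) x v = fderiv ℝ Y x v j := by
  have := ((PiLp.proj 2 (𝕜 := ℝ) (fun _ : Fin 3 => ℝ) j).hasFDerivAt.comp x hY.hasFDerivAt).fderiv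
  exact congrArg (fun L => L v) this

/-- A closed surface together with a continuous unit normal field. -/
structure IsOrientedSurface (Γ : Set E3) (n : E3 → E3) : Prop where
  surface : IsClosedSurface Γ
  normal : IsUnitNormal Γ n

namespace IsOrientedSurface

variable {Γ : Set E3} {n : E3 → E3} {y : E3} {k : ℕ} {f g : E3 → ℝ}

theorem extAt_normal (S : IsOrientedSurface Γ n) (hy : y ∈ Γ) :
    ExtAt 2 Γ n y := S.normal.extAt S.surface hy

theorem extAt_normal_apply (S : IsOrientedSurface Γ n) (hy : y ∈ Γ) (hk : k ≤ 2) (i : Fin 3) :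
    ExtAt k Γ (fun z => n z i) y :=
  (extAt_pi_iff.1 (S.extAt_normal hy) i).mono hk

theorem extAt_tanDeriv (S : IsOrientedSurface Γ n) (hy : y ∈ Γ) (hf : ExtAt (k + 1) Γ f y)
    (hk : k ≤ 2) (i : Fin 3) :
    ExtAt k Γ (tanDeriv Γ n i f) y :=
  hf.tanDeriv S.surface S.normal hy hk i

theorem tanDeriv_eq_fderiv (S : IsOrientedSurface Γ n) (hy : y ∈ Γ) (hg : IsLocalExt 1 Γ f y g)
    (i : Fin 3) :
    tanDeriv Γ n i f y = fderiv ℝ g y (projE n i y) :=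
  hg.tanDeriv_eq S.surface S.normal hy i

theorem tanDeriv_const (S : IsOrientedSurface Γ n) (hy : y ∈ Γ) (c : ℝ) (i : Fin 3) :
    tanDeriv Γ n i (fun _ => c) y = 0 := by
  rw [S.tanDeriv_eq_fderiv hy ⟨contDiffAt_const, EventuallyEq.rfl⟩]
  simp

theorem tanDeriv_add (S : IsOrientedSurface Γ n) (hy : y ∈ Γ) (hf : ExtAt 1 Γ f y)
    (hg : ExtAt 1 Γ g y) (i : Fin 3) :
    tanDeriv Γ n i (fun z => f z + g z) y = tanDeriv Γ n i f y + tanDeriv Γ n i g y := by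
  obtain ⟨f', hf⟩ := hf
  obtain ⟨g', hg⟩ := hg
  have h : IsLocalExt 1 Γ (fun z => f z + g z) y fun z => f' z + g' z :=
    ⟨hf.1.add hg.1, hf.2.add hg.2⟩
  rw [S.tanDeriv_eq_fderiv hy hf, S.tanDeriv_eq_fderiv hy hg,
    S.tanDeriv_eq_fderiv hy h,
    fderiv_fun_add (hf.1.differentiableAt (by simp)) (hg.1.differentiableAt (by simp))]
  rfl

theorem tanDeriv_mul (S : IsOrientedSurface Γ n) (hy : y ∈ Γ) (hf : ExtAt 1 Γ f y)
    (hg : ExtAt 1 Γ g y) (i : Fin 3) :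
    tanDeriv Γ n i (fun z => f z * g z) y =
      f y * tanDeriv Γ n i g y + g y * tanDeriv Γ n i f y := by
  obtain ⟨f', hf⟩ := hf
  obtain ⟨g', hg⟩ := hg
  have h : IsLocalExt 1 Γ (fun z => f z * g z) y fun z => f' z * g' z :=
    ⟨hf.1.mul hg.1, hf.2.mul hg.2⟩
  rw [S.tanDeriv_eq_fderiv hy hf, S.tanDeriv_eq_fderiv hy hg,
    S.tanDeriv_eq_fderiv hy h,
    fderiv_fun_mul (hf.1.differentiableAt (by simp)) (hg.1.differentiableAt (by simp)),
    ← hf.2.self_of_nhdsWithin hy, ← hg.2.self_of_nhdsWithin hy]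
  rfl

theorem tanDeriv_neg (S : IsOrientedSurface Γ n) (hy : y ∈ Γ) (hf : ExtAt 1 Γ f y) (i : Fin 3) :
    tanDeriv Γ n i (fun z => -f z) y = -tanDeriv Γ n i f y := by
  obtain ⟨f', hf⟩ := hf
  have h : IsLocalExt 1 Γ (fun z => -f z) y fun z => -f' z := ⟨hf.1.neg, hf.2.neg⟩
  rw [S.tanDeriv_eq_fderiv hy hf,
    S.tanDeriv_eq_fderiv hy h, fderiv_fun_neg]
  rfl

theorem tanDeriv_sub (S : IsOrientedSurface Γ n) (hy : y ∈ Γ) (hf : ExtAt 1 Γ f y)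
    (hg : ExtAt 1 Γ g y) (i : Fin 3) :
    tanDeriv Γ n i (fun z => f z - g z) y = tanDeriv Γ n i f y - tanDeriv Γ n i g y := by
  simp only [sub_eq_add_neg]
  rw [S.tanDeriv_add hy hf hg.neg, S.tanDeriv_neg hy hg]

theorem tanDeriv_sum (S : IsOrientedSurface Γ n) (hy : y ∈ Γ) {ι : Type*} {F : ι → E3 → ℝ}
    (A : Finset ι) (h : ∀ a ∈ A, ExtAt 1 Γ (F a) y)
    (i : Fin 3) :
    tanDeriv Γ n i (fun z => ∑ a ∈ A, F a z) y = ∑ a ∈ A, tanDeriv Γ n i (F a) y := by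
  classical
  induction A using Finset.induction_on with
  | empty => simpa using S.tanDeriv_const hy 0 i
  | insert a A ha ih =>
    simp only [Finset.sum_insert ha]
    rw [S.tanDeriv_add hy (h a (by simp)) (ExtAt.sum A fun b hb => h b (by simp [hb])),
      ih fun b hb => h b (by simp [hb])]

theorem tanDeriv_eq_zero_of_eqOn (S : IsOrientedSurface Γ n) (hy : y ∈ Γ) (c : ℝ)
    (h : ∀ z ∈ Γ, f z = c) (i : Fin 3) :
    tanDeriv Γ n i f y = 0 := by
  rw [tanDeriv_congr (g := fun _ => c) (eventually_mem_nhdsWithin.mono h), S.tanDeriv_const hy]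

/-- True for arbitrary f, differentiable or not, because P n = 0 is built into the definition of
D_i. -/
theorem sum_normal_mul_tanDeriv (S : IsOrientedSurface Γ n) (hy : y ∈ Γ) (f : E3 → ℝ) :
    ∑ i, n y i * tanDeriv Γ n i f y = 0 := by
  have h := S.normal.sum_sq hy
  rw [Fin.sum_univ_three] at h
  simp only [tanDeriv, Fin.sum_univ_three, P, Matrix.sub_apply, Matrix.vecMulVec_apply,
    Matrix.one_apply]
  simp
  linear_combination
    (-(n y 0 * fderiv ℝ (Classical.epsilon (IsLocalExt 1 Γ f y)) y (EuclideanSpace.single 0 1) +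
    n y 1 * fderiv ℝ (Classical.epsilon (IsLocalExt 1 Γ f y)) y (EuclideanSpace.single 1 1) +
    n y 2 * fderiv ℝ (Classical.epsilon (IsLocalExt 1 Γ f y)) y (EuclideanSpace.single 2 1))) * h

theorem sum_normal_mul_tanDeriv_normal (S : IsOrientedSurface Γ n) (hy : y ∈ Γ) (i : Fin 3) :
    ∑ j, n y j * tanDeriv Γ n i (fun z => n z j) y = 0 := by
  have h := S.tanDeriv_eq_zero_of_eqOn hy 1 (f := fun z => ∑ j, n z j * n z j)
    (fun z hz => S.normal.sum_sq hz) i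
  have he : ∀ j, ExtAt 1 Γ (fun z => n z j) y := S.extAt_normal_apply hy (by norm_num)
  rw [S.tanDeriv_sum hy _ fun j _ => (he j).mul (he j)] at h
  simp only [S.tanDeriv_mul hy (he _) (he _)] at h
  rw [Finset.sum_add_distrib] at h
  linarith

/-- Differentiating n · dμ(b) = 0 in the direction a expresses the second fundamental form as -n ·
D²μ(a, b), which is symmetric. -/
theorem sum_tanDeriv_normal_mul_symm (S : IsOrientedSurface Γ n) (hy : y ∈ Γ) {v w : E3}
    (hv : ⟪v, n y⟫ = 0) (hw : ⟪w, n y⟫ = 0) :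
    ∑ i, ∑ j, tanDeriv Γ n i (fun z => n z j) y * v i * w j =
      ∑ i, ∑ j, tanDeriv Γ n i (fun z => n z j) y * w i * v j := by
  obtain ⟨U, μ, h, s, hs, rfl⟩ := S.surface.exists_param y hy
  obtain ⟨a, rfl⟩ := h.exists_fderiv_eq S.normal hs hv
  obtain ⟨b, rfl⟩ := h.exists_fderiv_eq S.normal hs hw
  have he : ∀ j, ExtAt 1 Γ (fun z => n z j) (μ s) := S.extAt_normal_apply hy (by norm_num)
  have hnd : DifferentiableAt ℝ (fun t => n (μ t)) s :=
    ((S.extAt_normal hy).comp_param (by norm_num) h hs).differentiableAt (by simp)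
  have hdd : DifferentiableAt ℝ (fderiv ℝ μ) s :=
    ((h.contDiffAt hs).fderiv_right (m := 1) (by norm_num)).differentiableAt (by simp)
  have key : ∀ a b : E2, ∑ i, ∑ j, tanDeriv Γ n i (fun z => n z j) (μ s) * fderiv ℝ μ s a i *
      fderiv ℝ μ s b j = -⟪n (μ s), fderiv ℝ (fderiv ℝ μ) s a b⟫ := by
    intro a b
    have h0 : (fun t => ⟪n (μ t), fderiv ℝ μ t b⟫) =ᶠ[𝓝 s] fun _ => 0 := by
      filter_upwards [h.isOpen.mem_nhds hs] with t ht
      rw [real_inner_comm]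
      exact h.inner_fderiv S.normal ht b
    have h1 := congrArg (fun L => L a) (h0.fderiv_eq (𝕜 := ℝ))
    simp only [fderiv_fun_const, Pi.zero_apply, zero_apply] at h1
    rw [fderiv_inner_apply ℝ hnd (hdd.clm_apply (differentiableAt_const b))] at h1
    have h2 : fderiv ℝ (fun t => fderiv ℝ μ t b) s a = fderiv ℝ (fderiv ℝ μ) s a b := by
      rw [fderiv_clm_apply hdd (differentiableAt_const b)]
      simp
    have h3 : ∀ j, fderiv ℝ (fun t => n (μ t)) s a j =
        ∑ i, tanDeriv Γ n i (fun z => n z j) (μ s) * fderiv ℝ μ s a i := by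
      intro j
      rw [← h.fderiv_comp S.surface S.normal hs (he j)]
      exact (fderiv_coord hnd a j).symm
    rw [h2] at h1
    rw [eq_neg_iff_add_eq_zero, add_comm, ← h1]
    congr 1
    rw [PiLp.inner_apply, Finset.sum_comm]
    refine Finset.sum_congr rfl fun j _ => ?_
    rw [h3, ← Finset.sum_mul]
    simp [mul_comm]
  rw [key, key, ((h.contDiffAt hs).isSymmSndFDerivAt (by simp; norm_num)).eq]

theorem tanDeriv_normal_symm (S : IsOrientedSurface Γ n) (hy : y ∈ Γ) (i j : Fin 3) :
    tanDeriv Γ n i (fun z => n z j) y = tanDeriv Γ n j (fun z => n z i) y := by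
  -- Projecting both indices to the tangent plane changes nothing: the normal contractions vanish on
  -- either side. Symmetry on tangent vectors therefore gives symmetry of the full matrix.
  have key : ∀ i j, ∑ a, ∑ b, tanDeriv Γ n a (fun z => n z b) y * projE n i y a * projE n j y b =
      tanDeriv Γ n i (fun z => n z j) y := by
    intro i j
    have h1 : ∀ a, ∑ b, tanDeriv Γ n a (fun z => n z b) y * projE n i y a * projE n j y b =
        tanDeriv Γ n a (fun z => n z j) y * projE n i y a := by
      intro a
      have := S.sum_normal_mul_tanDeriv_normal hy a
      have h2 : ∀ b, tanDeriv Γ n a (fun z => n z b) y * projE n i y a * projE n j y b =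
          (if b = j then tanDeriv Γ n a (fun z => n z b) y * projE n i y a else 0) -
          projE n i y a * n y j * (n y b * tanDeriv Γ n a (fun z => n z b) y) := by
        intro b
        simp only [projE, PiLp.sub_apply, PiLp.smul_apply, PiLp.single_apply, smul_eq_mul]
        split_ifs <;> ring
      simp only [h2, Finset.sum_sub_distrib, ← Finset.mul_sum, this]
      simp
    simp only [h1]
    have := S.sum_normal_mul_tanDeriv hy (fun z => n z j)
    have h2 : ∀ a, tanDeriv Γ n a (fun z => n z j) y * projE n i y a =
        (if a = i then tanDeriv Γ n a (fun z => n z j) y else 0) -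
        n y i * (n y a * tanDeriv Γ n a (fun z => n z j) y) := by
      intro a
      simp only [projE, PiLp.sub_apply, PiLp.smul_apply, PiLp.single_apply, smul_eq_mul]
      split_ifs <;> ring
    simp only [h2, Finset.sum_sub_distrib, ← Finset.mul_sum, this]
    simp
  rw [← key i j, ← key j i,
    S.sum_tanDeriv_normal_mul_symm hy (S.normal.inner_projE hy i) (S.normal.inner_projE hy j)]

/-- The commutator of tangential derivatives. -/
theorem tanDeriv_tanDeriv_sub (S : IsOrientedSurface Γ n) (hy : y ∈ Γ) (hf : ExtAt 2 Γ f y)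
    (i j : Fin 3) :
    tanDeriv Γ n i (tanDeriv Γ n j f) y - tanDeriv Γ n j (tanDeriv Γ n i f) y =
      n y i * ∑ l, tanDeriv Γ n j (fun z => n z l) y * tanDeriv Γ n l f y -
      n y j * ∑ l, tanDeriv Γ n i (fun z => n z l) y * tanDeriv Γ n l f y := by
  obtain ⟨g, hg⟩ := hf
  obtain ⟨N, hN⟩ := (S.extAt_normal hy).mono one_le_two
  have hNy : N y = n y := hN.2.self_of_nhdsWithin hy
  have hNd : DifferentiableAt ℝ N y := hN.1.differentiableAt (by simp)
  have hgd : DifferentiableAt ℝ (fderiv ℝ g) y :=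
    (hg.1.fderiv_right (m := 1) (by norm_num)).differentiableAt (by simp)
  have hg1 : IsLocalExt 1 Γ f y g := ⟨hg.1.of_le (by norm_num), hg.2⟩
  have hNe : ∀ l, IsLocalExt 1 Γ (fun z => n z l) y fun z => N z l := fun l =>
    ⟨contDiffAt_euclidean.1 hN.1 l, hN.2.mono fun z hz => congrArg (· l) hz⟩
  have hNl : ∀ i l, fderiv ℝ N y (projE n i y) l = tanDeriv Γ n i (fun z => n z l) y := by
    intro i l
    rw [S.tanDeriv_eq_fderiv hy (hNe l)]
    exact (fderiv_coord hNd _ l).symm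
  -- In this formula for D_i D_j f the Hessian term and the term with D_i n_j are symmetric in i and
  -- j, so the commutator comes from the last term alone.
  have key : ∀ i j, tanDeriv Γ n i (tanDeriv Γ n j f) y =
      fderiv ℝ (fderiv ℝ g) y (projE n i y) (projE n j y)
      - tanDeriv Γ n i (fun z => n z j) y * fderiv ℝ g y (n y)
      - n y j * ∑ l, tanDeriv Γ n i (fun z => n z l) y * tanDeriv Γ n l f y := by
    intro i j
    rw [S.tanDeriv_eq_fderiv hy (hg.tanDeriv S.surface S.normal hN j)]
    have hNj : DifferentiableAt ℝ (fun z => N z j) y := (hNe j).1.differentiableAt (by simp)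
    have hv : DifferentiableAt ℝ
        (fun z => EuclideanSpace.single j (1 : ℝ) - N z j • N z) y :=
      (differentiableAt_const _).sub (hNj.smul hNd)
    rw [fderiv_clm_apply hgd hv, fderiv_const_sub, fderiv_fun_smul hNj hNd]
    have hNi : ⟪fderiv ℝ N y (projE n i y), n y⟫ = 0 := by
      rw [← S.sum_normal_mul_tanDeriv_normal hy i, PiLp.inner_apply]
      simp [hNl]
    have hgt := hg1.fderiv_tangent S.surface S.normal hy hNi
    simp only [hNl] at hgt
    have hj : fderiv ℝ (fun z => N z j) y (projE n i y) = tanDeriv Γ n i (fun z => n z j) y :=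
      (S.tanDeriv_eq_fderiv hy (hNe j) i).symm
    simp only [add_apply, ContinuousLinearMap.comp_apply,
      neg_apply, smul_apply, hNy, map_neg, map_add,
      map_smul, ContinuousLinearMap.smulRight_apply, ContinuousLinearMap.flip_apply, hj, hgt,
      smul_eq_mul]
    simp only [mul_comm (tanDeriv Γ n _ f y), projE]
    ring
  rw [key i j, key j i, S.tanDeriv_normal_symm hy i j,
    (hg.1.isSymmSndFDerivAt (by simp)).eq (projE n i y) (projE n j y)]
  ring

end IsOrientedSurface

end

section

/-! ### The surface measure -/

section SurfaceMeasure

variable {Γ : Set E3} {U : Set E2} {μ : E2 → E3} {s : E2} {y : E3}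

theorem IsClosedSurface.measurableSet (hΓ : IsClosedSurface Γ) : MeasurableSet Γ :=
  hΓ.isCompact.isClosed.measurableSet

theorem IsLocalParam.hausdorff_image (h : IsLocalParam Γ U μ) {A : Set E2} (hA : A ⊆ U)
    (hAm : MeasurableSet A) :
    (μHE[2] : Measure E3) (μ '' A) = ∫⁻ s in A, ENNReal.ofReal (areaDensity μ s) :=
  hausdorff_image_eq_lintegral h.isOpen (fun _ hs => (h.contDiffAt hs).of_le (by norm_num))
    h.injOn h.injective_fderiv hA hAm

theorem IsClosedSurface.hausdorff_lt_top (hΓ : IsClosedSurface Γ) :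
    (μHE[2] : Measure E3) Γ < ∞ := by
  refine hΓ.isCompact.measure_lt_top_of_nhdsWithin fun y hy => ?_
  obtain ⟨U, μ, h, s, hs, rfl⟩ := hΓ.exists_param y hy
  have hJ : ∀ᶠ t in 𝓝 s, t ∈ U ∧ areaDensity μ t < areaDensity μ s + 1 :=
    (h.isOpen.eventually_mem hs).and
      ((h.contDiffAt_areaDensity hs).continuousAt.eventually (Iio_mem_nhds (by linarith)))
  obtain ⟨r, hr, hB⟩ := Metric.eventually_nhds_iff_ball.1 hJ
  refine ⟨μ '' Metric.ball s r, ?_, ?_⟩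
  · filter_upwards [h.eventually_nhdsWithin hs (Metric.ball_mem_nhds s hr)] with z hz
    obtain ⟨t, -, ht, rfl⟩ := hz
    exact ⟨t, ht, rfl⟩
  · rw [h.hausdorff_image (fun t ht => (hB t ht).1) Metric.isOpen_ball.measurableSet]
    calc _ ≤ ∫⁻ _ in Metric.ball s r, ENNReal.ofReal (areaDensity μ s + 1) :=
          setLIntegral_mono' Metric.isOpen_ball.measurableSet fun t ht =>
            ENNReal.ofReal_le_ofReal (hB t ht).2.le
      _ < ∞ := by
        rw [setLIntegral_const]
        exact ENNReal.mul_lt_top (by simp) measure_ball_lt_top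

theorem IsClosedSurface.hausdorff_pos (hΓ : IsClosedSurface Γ) (hy : y ∈ Γ) {O : Set E3}
    (hO : O ∈ 𝓝[Γ] y) : 0 < (μHE[2] : Measure E3) O := by
  obtain ⟨U, μ, h, s, hs, rfl⟩ := hΓ.exists_param y hy
  have hJs := h.areaDensity_pos hs
  have hJ : ∀ᶠ t in 𝓝 s, t ∈ U ∧ areaDensity μ s / 2 < areaDensity μ t ∧ μ t ∈ O :=
    (h.isOpen.eventually_mem hs).and
      (((h.contDiffAt_areaDensity hs).continuousAt.eventually (Ioi_mem_nhds (by linarith))).and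
        (h.tendsto hs hO))
  obtain ⟨r, hr, hB⟩ := Metric.eventually_nhds_iff_ball.1 hJ
  refine lt_of_lt_of_le ?_ (measure_mono (s := μ '' Metric.ball s r) ?_)
  · rw [h.hausdorff_image (fun t ht => (hB t ht).1) Metric.isOpen_ball.measurableSet]
    calc 0 < ∫⁻ _ in Metric.ball s r, ENNReal.ofReal (areaDensity μ s / 2) := by
          rw [setLIntegral_const]
          exact ENNReal.mul_pos (by simpa using hJs) (Metric.measure_ball_pos _ _ hr).ne'
      _ ≤ _ := setLIntegral_mono' Metric.isOpen_ball.measurableSet fun t ht =>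
            ENNReal.ofReal_le_ofReal (hB t ht).2.1.le
  · rintro _ ⟨t, ht, rfl⟩
    exact (hB t ht).2.2

theorem IsClosedSurface.integrableOn (hΓ : IsClosedSurface Γ) {f : E3 → ℝ}
    (hf : ContinuousOn f Γ) : IntegrableOn f Γ (μHE[2] : Measure E3) := by
  obtain ⟨C, hC⟩ := hΓ.isCompact.exists_bound_of_continuousOn hf
  have : IsFiniteMeasure ((μHE[2] : Measure E3).restrict Γ) :=
    ⟨by simpa using hΓ.hausdorff_lt_top⟩
  exact Integrable.of_bound (hf.aestronglyMeasurable hΓ.measurableSet) C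
    ((ae_restrict_iff' hΓ.measurableSet).2 (Eventually.of_forall hC))

theorem surfInt_congr (hΓ : IsClosedSurface Γ) {f g : E3 → ℝ} (h : ∀ z ∈ Γ, f z = g z) :
    surfInt Γ f = surfInt Γ g :=
  setIntegral_congr_fun hΓ.measurableSet h

theorem surfInt_add (hΓ : IsClosedSurface Γ) {f g : E3 → ℝ} (hf : ContinuousOn f Γ)
    (hg : ContinuousOn g Γ) : surfInt Γ (fun z => f z + g z) = surfInt Γ f + surfInt Γ g :=
  integral_add (hΓ.integrableOn hf) (hΓ.integrableOn hg)

theorem surfInt_sub (hΓ : IsClosedSurface Γ) {f g : E3 → ℝ} (hf : ContinuousOn f Γ)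
    (hg : ContinuousOn g Γ) : surfInt Γ (fun z => f z - g z) = surfInt Γ f - surfInt Γ g :=
  integral_sub (hΓ.integrableOn hf) (hΓ.integrableOn hg)

/-- The fundamental lemma of the calculus of variations on `Γ`. -/
theorem IsClosedSurface.eq_zero_of_forall_surfInt_mul (hΓ : IsClosedSurface Γ) {f : E3 → ℝ}
    (hf : ContinuousOn f Γ)
    (h : ∀ φ : E3 → ℝ, ContDiff ℝ 1 φ → surfInt Γ (fun z => f z * φ z) = 0) (hy : y ∈ Γ) :
    f y = 0 := by
  have key : ∀ f : E3 → ℝ, ContinuousOn f Γ →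
      (∀ φ : E3 → ℝ, ContDiff ℝ 1 φ → surfInt Γ (fun z => f z * φ z) = 0) → ¬0 < f y := by
    intro f hf h hpos
    have h1 : ∀ᶠ z in 𝓝[Γ] y, 0 < f z := (hf y hy).eventually (Ioi_mem_nhds hpos)
    rw [eventually_nhdsWithin_iff, Metric.eventually_nhds_iff_ball] at h1
    obtain ⟨r, hr, hB⟩ := h1
    -- A bump supported in the ball where f is positive makes the integral of f φ strictly positive.
    let φ : ContDiffBump y := ⟨r / 2, r, by positivity, by linarith⟩
    have hsupp : Function.support φ = Metric.ball y r := φ.support_eq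
    have hcont : ContinuousOn (fun z => f z * φ z) Γ := hf.mul φ.continuous.continuousOn
    have hnn : ∀ z ∈ Γ, 0 ≤ f z * φ z := by
      intro z hz
      by_cases hzr : z ∈ Metric.ball y r
      · exact mul_nonneg (hB z hzr hz).le φ.nonneg
      · have : φ z = 0 := by
          rw [← Function.notMem_support, hsupp]; exact hzr
        simp [this]
    have h2 := (setIntegral_pos_iff_support_of_nonneg_ae (μ := (μHE[2] : Measure E3)) (s := Γ)
      (f := fun z => f z * φ z) ((ae_restrict_iff' hΓ.measurableSet).2 (Eventually.of_forall hnn))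
      (hΓ.integrableOn hcont)).2 ?_
    · exact h2.ne' (h φ φ.contDiff)
    · refine hΓ.hausdorff_pos hy (inter_mem ?_ self_mem_nhdsWithin)
      filter_upwards [mem_nhdsWithin_of_mem_nhds (Metric.ball_mem_nhds y hr),
        self_mem_nhdsWithin] with z hz hzΓ
      exact mul_ne_zero (hB z hz hzΓ).ne' (by rwa [← Function.mem_support, hsupp])
  refine le_antisymm (not_lt.1 (key f hf h)) ?_
  have := key (fun z => -f z) hf.neg fun φ hφ => by
    have h0 := h φ hφ
    simp only [surfInt, neg_mul, integral_neg] at h0 ⊢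
    rw [h0, neg_zero]
  linarith [not_lt.1 this]

end SurfaceMeasure

/-! ### The divergence theorem on a closed surface -/

/-- The tangential divergence of a vector field. -/
def surfDiv (Γ : Set E3) (n : E3 → E3) (Y : E3 → E3) (y : E3) : ℝ :=
  ∑ i, tanDeriv Γ n i (fun z => Y z i) y

theorem fderiv_cross {u v : E2 → E3} {s : E2} (hu : DifferentiableAt ℝ u s)
    (hv : DifferentiableAt ℝ v s) (w : E2) :
    fderiv ℝ (fun t => cross (u t) (v t)) s w =
      cross (fderiv ℝ u s w) (v s) + cross (u s) (fderiv ℝ v s w) := by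
  have hd : DifferentiableAt ℝ (fun t => cross (u t) (v t)) s :=
    ((contDiff_cross.differentiable (by simp)).differentiableAt.comp s (hu.prodMk hv))
  have hu' : ∀ i, DifferentiableAt ℝ (fun t => u t i) s := differentiableAt_euclidean.1 hu
  have hv' : ∀ i, DifferentiableAt ℝ (fun t => v t i) s := differentiableAt_euclidean.1 hv
  have key : ∀ i j, fderiv ℝ (fun t => u t i * v t j - u t j * v t i) s w =
      u s i * fderiv ℝ v s w j + v s j * fderiv ℝ u s w i -
        (u s j * fderiv ℝ v s w i + v s i * fderiv ℝ u s w j) := by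
    intro i j
    rw [fderiv_fun_sub ((hu' i).fun_mul (hv' j)) ((hu' j).fun_mul (hv' i)),
      fderiv_fun_mul (hu' i) (hv' j), fderiv_fun_mul (hu' j) (hv' i)]
    simp [fderiv_coord hu, fderiv_coord hv]
  ext j
  rw [← fderiv_coord hd]
  fin_cases j <;> simp [cross] <;> rw [key] <;> ring

/-- Three vectors in a plane have zero triple product. The proof uses Cramer's identity det(a,b,c) N
= (a·N) b×c + (b·N) c×a + (c·N) a×b. -/
theorem inner_cross_eq_zero {a b c N : E3} (hN : ‖N‖ = 1) (ha : ⟪a, N⟫ = 0) (hb : ⟪b, N⟫ = 0)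
    (hc : ⟪c, N⟫ = 0) : ⟪a, cross b c⟫ = 0 := by
  have h1 : ⟪N, N⟫ = 1 := by rw [real_inner_self_eq_norm_sq, hN, one_pow]
  simp only [inner_eq_sum] at *
  have e : ∀ i, (a 0 * cross b c 0 + a 1 * cross b c 1 + a 2 * cross b c 2) * N i = 0 := by
    intro i
    fin_cases i <;> simp [cross, -mul_eq_zero]
    · linear_combination (b 1 * c 2 - b 2 * c 1) * ha + (c 1 * a 2 - c 2 * a 1) * hb +
        (a 1 * b 2 - a 2 * b 1) * hc
    · linear_combination (b 2 * c 0 - b 0 * c 2) * ha + (c 2 * a 0 - c 0 * a 2) * hb +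
        (a 2 * b 0 - a 0 * b 2) * hc
    · linear_combination (b 0 * c 1 - b 1 * c 0) * ha + (c 0 * a 1 - c 1 * a 0) * hb +
        (a 0 * b 1 - a 1 * b 0) * hc
  linear_combination N 0 * e 0 + N 1 * e 1 + N 2 * e 2 -
    (a 0 * cross b c 0 + a 1 * cross b c 1 + a 2 * cross b c 2) * h1

/-- The derivative of the determinant: applying a matrix to one of three vectors at a time
multiplies their determinant by the trace, in total. -/
theorem sum_mul_cross (M : Fin 3 → Fin 3 → ℝ) (a b N : E3) :
    ∑ j, (∑ i, M i j * a i) * cross b N j + ∑ j, (∑ i, M i j * b i) * cross N a j +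
      ∑ j, (∑ i, M i j * N i) * cross a b j = ⟪N, cross a b⟫ * ∑ i, M i i := by
  simp [Fin.sum_univ_three, inner_eq_sum, cross]
  ring

/-- Extended by zero outside U, the function is C¹ with compact support on the whole plane;
integrate by parts against the constant 1. -/
theorem integral_fderiv_eq_zero_of_compact {A : E2 → ℝ} {U K : Set E2} (hU : IsOpen U)
    (hK : IsCompact K) (hKU : K ⊆ U) (hA : ∀ s ∈ U, ContDiffAt ℝ 1 A s)
    (h0 : ∀ s ∈ U, s ∉ K → A s = 0) (v : E2) :
    IntegrableOn (fun s => fderiv ℝ A s v) U ∧ ∫ s in U, fderiv ℝ A s v = 0 := by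
  set F : E2 → ℝ := U.indicator A with hF
  have hFA : ∀ s ∈ U, F =ᶠ[𝓝 s] A := fun s hs =>
    (hU.eventually_mem hs).mono fun t ht => indicator_of_mem ht A
  have hF0 : ∀ s, s ∉ K → F s = 0 := by
    intro s hs
    by_cases hsU : s ∈ U
    · rw [hF, indicator_of_mem hsU]; exact h0 s hsU hs
    · exact indicator_of_notMem hsU A
  have hFc : ContDiff ℝ 1 F := by
    rw [contDiff_iff_contDiffAt]
    intro s
    by_cases hs : s ∈ U
    · exact (hA s hs).congr_of_eventuallyEq (hFA s hs)
    · have : F =ᶠ[𝓝 s] fun _ => 0 :=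
        (hK.isClosed.isOpen_compl.eventually_mem fun hsK => hs (hKU hsK)).mono hF0
      exact contDiffAt_const.congr_of_eventuallyEq this
  have hsupp : HasCompactSupport F := HasCompactSupport.intro hK hF0
  have hfd0 : ∀ s, s ∉ U → fderiv ℝ F s v = 0 := by
    intro s hs
    have : F =ᶠ[𝓝 s] fun _ => 0 :=
      (hK.isClosed.isOpen_compl.eventually_mem fun hsK => hs (hKU hsK)).mono hF0
    rw [this.fderiv_eq]; simp
  have hcont : Continuous fun s => fderiv ℝ F s v :=
    (hFc.continuous_fderiv (by simp)).clm_apply continuous_const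
  have hint : Integrable fun s => fderiv ℝ F s v :=
    hcont.integrable_of_hasCompactSupport (hsupp.fderiv_apply ℝ v)
  have heq : EqOn (fun s => fderiv ℝ A s v) (fun s => fderiv ℝ F s v) U := fun s hs => by
    simp only [(hFA s hs).fderiv_eq]
  refine ⟨hint.integrableOn.congr_fun heq.symm hU.measurableSet, ?_⟩
  rw [setIntegral_congr_fun hU.measurableSet heq,
    setIntegral_eq_integral_of_forall_compl_eq_zero hfd0]
  have := integral_mul_fderiv_eq_neg_fderiv_mul_of_integrable (μ := (volume : Measure E2))
    (f := fun _ => (1 : ℝ)) (g := F) (v := v) (by simp) (by simpa using hint)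
    (by simpa using hFc.continuous.integrable_of_hasCompactSupport hsupp)
    (fun _ _ => differentiableAt_const _) (fun _ _ => hFc.differentiable (by simp) _)
  simpa using this

section Divergence

variable {Γ : Set E3} {n : E3 → E3} {U : Set E2} {μ : E2 → E3} {s : E2} {y : E3} {Y : E3 → E3}

theorem IsTangentField.extAt {k : ℕ} (hY : IsTangentField k Γ n Y) (hy : y ∈ Γ) : ExtAt k Γ Y y :=
  hY.1 y ⟨hy, mem_univ _⟩

theorem IsTangentField.extAt_apply {k : ℕ} (hY : IsTangentField k Γ n Y) (hy : y ∈ Γ) (i : Fin 3) :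
    ExtAt k Γ (fun z => Y z i) y :=
  extAt_pi_iff.1 (hY.extAt hy) i

theorem IsTangentField.continuousOn_surfDiv (S : IsOrientedSurface Γ n)
    (hY : IsTangentField 1 Γ n Y) : ContinuousOn (surfDiv Γ n Y) Γ := fun y hy =>
  (ExtAt.sum Finset.univ fun i _ =>
    S.extAt_tanDeriv hy (k := 0) (hY.extAt_apply hy i) (by norm_num) i).continuousWithinAt hy

/-- The divergence in local coordinates. -/
theorem IsLocalParam.areaDensity_mul_surfDiv (S : IsOrientedSurface Γ n)
    (h : IsLocalParam Γ U μ) (hs : s ∈ U) (hY : IsTangentField 1 Γ n Y) :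
    areaDensity μ s * surfDiv Γ n Y (μ s) =
      fderiv ℝ (fun t => ⟪Y (μ t), cross (coordVec μ t 1) (paramNormal μ t)⟫) s
        (EuclideanSpace.single 0 1) +
      fderiv ℝ (fun t => ⟪Y (μ t), cross (paramNormal μ t) (coordVec μ t 0)⟫) s
        (EuclideanSpace.single 1 1) := by
  have hYe := hY.extAt (h.mem hs)
  have hm : DifferentiableAt ℝ (fun t => Y (μ t)) s :=
    (hYe.comp_param (by norm_num) h hs).differentiableAt (by simp)
  have hN : DifferentiableAt ℝ (paramNormal μ) s :=
    (h.contDiffAt_paramNormal hs).differentiableAt (by simp)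
  have hc : ∀ i, DifferentiableAt ℝ (fun t => coordVec μ t i) s := fun i =>
    (h.contDiffAt_coordVec hs i).differentiableAt (by simp)
  have hcr : ∀ {u v : E2 → E3}, DifferentiableAt ℝ u s → DifferentiableAt ℝ v s →
      DifferentiableAt ℝ (fun t => cross (u t) (v t)) s := fun hu hv =>
    (contDiff_cross.differentiable (by simp)).differentiableAt.comp s (hu.prodMk hv)
  rw [fderiv_inner_apply ℝ hm (hcr (hc 1) hN), fderiv_inner_apply ℝ hm (hcr hN (hc 0)),
    fderiv_cross (hc 1) hN, fderiv_cross hN (hc 0)]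
  have hdd : DifferentiableAt ℝ (fderiv ℝ μ) s :=
    ((h.contDiffAt hs).fderiv_right (m := 1) (by norm_num)).differentiableAt (by simp)
  have hdc : ∀ i w, fderiv ℝ (fun t => coordVec μ t i) s w =
      fderiv ℝ (fderiv ℝ μ) s w (EuclideanSpace.single i 1) := by
    intro i w
    simp only [coordVec]
    rw [fderiv_clm_apply hdd (differentiableAt_const _)]
    simp
  rw [hdc, hdc, ((h.contDiffAt hs).isSymmSndFDerivAt (by simp; norm_num)).eq
    (EuclideanSpace.single 1 1)]
  -- By symmetry of second derivatives the same q occurs in both terms, as q × N + N × q, which is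
  -- zero.
  set q := fderiv ℝ (fderiv ℝ μ) s (EuclideanSpace.single 0 1) (EuclideanSpace.single 1 1)
  set N := paramNormal μ s with hNdef
  have hNn : ‖N‖ = 1 := h.norm_paramNormal hs
  have hdN : ∀ w, ⟪fderiv ℝ (paramNormal μ) s w, N⟫ = 0 := by
    intro w
    have h0 : (fun t => ⟪paramNormal μ t, paramNormal μ t⟫) =ᶠ[𝓝 s] fun _ => (1 : ℝ) := by
      filter_upwards [h.isOpen.mem_nhds hs] with t ht
      rw [real_inner_self_eq_norm_sq, h.norm_paramNormal ht, one_pow]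
    have h1 := congrArg (fun L => L w) (h0.fderiv_eq (𝕜 := ℝ))
    simp only [fderiv_fun_const, Pi.zero_apply, zero_apply] at h1
    rw [fderiv_inner_apply ℝ hN hN, real_inner_comm] at h1
    linarith
  obtain ⟨ε, hε, hnε⟩ : ∃ ε : ℝ, ε ≠ 0 ∧ n (μ s) = ε • N := by
    refine ⟨_, ?_, h.normal_eq S.normal hs⟩
    intro h0
    have h1 := h.normal_eq S.normal hs
    rw [h0, zero_smul] at h1
    have h2 := S.normal.norm_eq_one _ (h.mem hs)
    rw [h1, norm_zero] at h2
    exact zero_ne_one h2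
  have hperp : ∀ v, ⟪v, n (μ s)⟫ = 0 → ⟪v, N⟫ = 0 := by
    intro v hv
    rw [hnε, real_inner_smul_right] at hv
    exact (mul_eq_zero.1 hv).resolve_left hε
  have hYN := hperp _ (hY.2 _ (h.mem hs))
  have haN : ∀ i, ⟪coordVec μ s i, N⟫ = 0 := fun i => hperp _ (S.normal.inner_eq_zero U μ h s hs i)
  have hq : cross q N + cross N q = 0 := by
    ext i; fin_cases i <;> simp [cross] <;> ring
  -- The derivatives of N are tangential because N has length one, so these triple products have
  -- three tangential entries.
  have e1 := inner_cross_eq_zero hNn hYN (haN 1) (hdN (EuclideanSpace.single 0 1))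
  have e2 := inner_cross_eq_zero hNn hYN (hdN (EuclideanSpace.single 1 1)) (haN 0)
  have e3 : ⟪Y (μ s), cross q N⟫ + ⟪Y (μ s), cross N q⟫ = 0 := by
    rw [← inner_add_right, hq, inner_zero_right]
  have hdY : ∀ i j, fderiv ℝ (fun t => Y (μ t)) s (EuclideanSpace.single i 1) j =
      ∑ a, tanDeriv Γ n a (fun z => Y z j) (μ s) * coordVec μ s i a := by
    intro i j
    rw [← fderiv_coord hm]
    exact h.fderiv_comp S.surface S.normal hs (f := fun z => Y z j) (hY.extAt_apply (h.mem hs) j) _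
  -- The trace identity for the matrix D_i Y_j: its normal slot vanishes since Σ N_i D_i = 0, and
  -- the determinant of the two coordinate vectors and N is the area density.
  have hsum := sum_mul_cross (fun i j => tanDeriv Γ n i (fun z => Y z j) (μ s))
    (coordVec μ s 0) (coordVec μ s 1) N
  have hNc : ⟪N, cross (coordVec μ s 0) (coordVec μ s 1)⟫ = areaDensity μ s := by
    have hJ := h.areaDensity_pos hs
    rw [hNdef, paramNormal, real_inner_smul_left, real_inner_self_eq_norm_sq]
    change _ * areaDensity μ s ^ 2 = _
    field_simp
  have hNM : ∀ j, ∑ i, tanDeriv Γ n i (fun z => Y z j) (μ s) * N i = 0 := by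
    intro j
    have := S.sum_normal_mul_tanDeriv (h.mem hs) (fun z => Y z j)
    rw [hnε] at this
    have h2 : ε * ∑ i, tanDeriv Γ n i (fun z => Y z j) (μ s) * N i = 0 := by
      rw [← this, Finset.mul_sum]
      refine Finset.sum_congr rfl fun i _ => ?_
      simp only [PiLp.smul_apply, smul_eq_mul]
      ring
    exact (mul_eq_zero.1 h2).resolve_left hε
  simp only [hNM, hNc, zero_mul, Finset.sum_const_zero, add_zero] at hsum
  have hi : ∀ i c, ⟪fderiv ℝ (fun t => Y (μ t)) s (EuclideanSpace.single i 1), c⟫ =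
      ∑ j, (∑ a, tanDeriv Γ n a (fun z => Y z j) (μ s) * coordVec μ s i a) * c j := by
    intro i c
    rw [PiLp.inner_apply]
    exact Finset.sum_congr rfl fun j _ => by rw [hdY]; exact mul_comm _ _
  rw [inner_add_right, inner_add_right, hi, hi, surfDiv]
  linear_combination -hsum - e1 - e2 - e3

theorem surfDiv_congr {Z : E3 → E3} (h : Y =ᶠ[𝓝[Γ] y] Z) : surfDiv Γ n Y y = surfDiv Γ n Z y :=
  Finset.sum_congr rfl fun i _ => tanDeriv_congr (h.mono fun _ hz => congrArg (· i) hz)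

/-- When Y is supported in one chart, the weighted divergence is a sum of two partial derivatives of
compactly supported functions. -/
theorem surfInt_surfDiv_eq_zero_of_param (S : IsOrientedSurface Γ n) (h : IsLocalParam Γ U μ)
    (hY : IsTangentField 1 Γ n Y) {K : Set E2} (hK : IsCompact K) (hKU : K ⊆ U)
    (h0 : ∀ z ∈ Γ, z ∉ μ '' K → Y z = 0) : surfInt Γ (surfDiv Γ n Y) = 0 := by
  have hμc : ContinuousOn μ U := h.contDiffOn.continuousOn
  have hsub : μ '' U ⊆ Γ := by rintro _ ⟨s, hs, rfl⟩; exact h.mem hs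
  have hd0 : ∀ z ∈ Γ, z ∉ μ '' K → surfDiv Γ n Y z = 0 := by
    intro z hz hzK
    have hKc : IsClosed (μ '' K) := (hK.image_of_continuousOn (hμc.mono hKU)).isClosed
    have : Y =ᶠ[𝓝[Γ] z] fun _ => 0 := by
      filter_upwards [self_mem_nhdsWithin,
        mem_nhdsWithin_of_mem_nhds (hKc.isOpen_compl.mem_nhds hzK)] with w hw hwK
      exact h0 w hw hwK
    rw [surfDiv_congr this, surfDiv]
    exact Finset.sum_eq_zero fun i _ => S.tanDeriv_const hz 0 i
  have hinj := h.injOn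
  rw [surfInt, setIntegral_eq_of_subset_of_forall_sdiff_eq_zero S.surface.measurableSet hsub
    (fun z hz => hd0 z hz.1 fun hzK => hz.2 (image_mono hKU hzK)),
    setIntegral_image_eq h.isOpen (fun _ hs => (h.contDiffAt hs).of_le (by norm_num)) hinj
      h.injective_fderiv, setIntegral_congr_fun h.isOpen.measurableSet
      fun s hs => h.areaDensity_mul_surfDiv S hs hY]
  have hYc : ∀ s ∈ U, ContDiffAt ℝ 1 (fun t => Y (μ t)) s := fun s hs =>
    (hY.extAt (h.mem hs)).comp_param (by norm_num) h hs
  have hNc : ∀ s ∈ U, ContDiffAt ℝ 1 (paramNormal μ) s := fun s hs =>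
    (h.contDiffAt_paramNormal hs).of_le (by norm_num)
  have hcc : ∀ i, ∀ s ∈ U, ContDiffAt ℝ 1 (fun t => coordVec μ t i) s := fun i s hs =>
    (h.contDiffAt_coordVec hs i).of_le (by norm_num)
  have hY0 : ∀ s ∈ U, s ∉ K → Y (μ s) = 0 := fun s hs hsK =>
    h0 _ (h.mem hs) fun ⟨t, ht, hts⟩ => hsK (hinj (hKU ht) hs hts ▸ ht)
  have hcr : ∀ {u v : E2 → E3} {s}, ContDiffAt ℝ 1 u s → ContDiffAt ℝ 1 v s →
      ContDiffAt ℝ 1 (fun t => cross (u t) (v t)) s := fun {_ _ s} hu hv =>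
    (contDiff_cross.contDiffAt.of_le le_top).comp s (hu.prodMk hv)
  obtain ⟨i1, z1⟩ := integral_fderiv_eq_zero_of_compact
    (A := fun t => ⟪Y (μ t), cross (coordVec μ t 1) (paramNormal μ t)⟫) h.isOpen hK hKU
    (fun s hs => (hYc s hs).inner ℝ (hcr (hcc 1 s hs) (hNc s hs)))
    (fun s hs hsK => by simp only [hY0 s hs hsK, inner_zero_left]) (EuclideanSpace.single 0 1)
  obtain ⟨i2, z2⟩ := integral_fderiv_eq_zero_of_compact
    (A := fun t => ⟪Y (μ t), cross (paramNormal μ t) (coordVec μ t 0)⟫) h.isOpen hK hKU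
    (fun s hs => (hYc s hs).inner ℝ (hcr (hNc s hs) (hcc 0 s hs)))
    (fun s hs hsK => by simp only [hY0 s hs hsK, inner_zero_left]) (EuclideanSpace.single 1 1)
  rw [integral_add i1 i2, z1, z2, add_zero]

theorem IsTangentField.smul {k : ℕ} {f : E3 → ℝ} (hf : ∀ y ∈ Γ, ExtAt k Γ f y)
    (hY : IsTangentField k Γ n Y) : IsTangentField k Γ n fun z => f z • Y z := by
  refine ⟨fun y hy => extAt_pi_iff.2 fun i => ?_, fun y hy => ?_⟩
  · exact (hf y hy.1).mul (hY.extAt_apply hy.1 i)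
  · rw [real_inner_smul_left, hY.2 y hy, mul_zero]

theorem IsLocalParam.isCompact_preimage (h : IsLocalParam Γ U μ) {C : Set E3} (hC : IsCompact C)
    (hCU : C ⊆ μ '' U) : IsCompact (U ∩ μ ⁻¹' C) := by
  have h1 : IsCompact (U.domRestrict μ ⁻¹' C) :=
    (h.isEmbedding.isInducing.isCompact_preimage_iff (by rwa [range_domRestrict])).2 hC
  have h2 := h1.image continuous_subtype_val
  convert h2 using 1
  ext s
  simp [and_comm]

/-- The divergence theorem for tangential vector fields on a closed surface. -/
theorem surfInt_surfDiv_eq_zero (S : IsOrientedSurface Γ n) (hY : IsTangentField 1 Γ n Y) :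
    surfInt Γ (surfDiv Γ n Y) = 0 := by
  -- Each point has a closed ball whose trace on Γ is compact and lies in a single chart.
  have hloc : ∀ y ∈ Γ, ∃ r : ℝ, 0 < r ∧ ∀ Z : E3 → E3, IsTangentField 1 Γ n Z →
      (∀ z ∈ Γ, z ∉ Metric.closedBall y r → Z z = 0) → surfInt Γ (surfDiv Γ n Z) = 0 := by
    intro y hy
    obtain ⟨U, μ, h, s, hs, rfl⟩ := S.surface.exists_param y hy
    obtain ⟨V, hVo, hV⟩ := h.image_eq
    obtain ⟨r, hr, hrV⟩ := Metric.nhds_basis_closedBall.mem_iff.1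
      (hVo.mem_nhds (hV.subset ⟨s, hs, rfl⟩).2)
    refine ⟨r, hr, fun Z hZ hZ0 => ?_⟩
    have hCU : Γ ∩ Metric.closedBall (μ s) r ⊆ μ '' U := by
      rw [hV]; exact inter_subset_inter_right _ hrV
    refine surfInt_surfDiv_eq_zero_of_param S h hZ (h.isCompact_preimage
      (S.surface.isCompact.inter_right Metric.isClosed_closedBall) hCU) inter_subset_left ?_
    intro z hz hzK
    refine hZ0 z hz fun hzB => hzK ?_
    obtain ⟨t, ht, rfl⟩ := hCU ⟨hz, hzB⟩
    exact ⟨t, ⟨ht, hz, hzB⟩, rfl⟩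
  choose! r hr hloc using hloc
  obtain ⟨t, htΓ, htc⟩ := S.surface.isCompact.elim_nhds_subcover
    (fun y => Metric.ball y (r y / 2)) fun y hy => Metric.ball_mem_nhds y (half_pos (hr y hy))
  have hb : ∀ y : E3, ∃ φ : E3 → ℝ, ContDiff ℝ 1 φ ∧ (∀ z, 0 ≤ φ z) ∧ (y ∈ Γ →
      (∀ z ∈ Metric.ball y (r y / 2), 0 < φ z) ∧ ∀ z, z ∉ Metric.closedBall y (r y) → φ z = 0) := by
    intro y
    by_cases hy : y ∈ Γ
    · let φ : ContDiffBump y := ⟨r y / 2, r y, half_pos (hr y hy), half_lt_self (hr y hy)⟩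
      refine ⟨φ, φ.contDiff, fun z => φ.nonneg, fun _ => ⟨fun z hz => ?_, fun z hz => ?_⟩⟩
      · exact φ.pos_of_mem_ball (Metric.ball_subset_ball (half_le_self (hr y hy).le) hz)
      · refine φ.zero_of_le_dist ?_
        rw [Metric.mem_closedBall, not_le] at hz
        exact hz.le
    · exact ⟨fun _ => 0, contDiff_const, fun _ => le_rfl, fun h => absurd h hy⟩
  choose φ hφc hφ0 hφ using hb
  -- The sum σ is positive on Γ, so the quotients φ y / σ form a C¹ partition of unity subordinate
  -- to the charts.
  set σ : E3 → ℝ := fun z => ∑ y ∈ t, φ y z with hσ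
  have hσpos : ∀ z ∈ Γ, 0 < σ z := by
    intro z hz
    obtain ⟨y, hyt, hzy⟩ := mem_iUnion₂.1 (htc hz)
    exact Finset.sum_pos' (fun y _ => hφ0 y z) ⟨y, hyt, (hφ y (htΓ y hyt)).1 z hzy⟩
  have hφe : ∀ y, ∀ z ∈ Γ, ExtAt 1 Γ (φ y) z := fun y z _ => (hφc y).contDiffAt.extAt
  have hσe : ∀ z ∈ Γ, ExtAt 1 Γ σ z := fun z hz => ExtAt.sum t fun y _ => hφe y z hz
  have hZ := hY.smul fun z hz => (hσe z hz).inv (hσpos z hz).ne' hz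
  have hsum : ∀ z ∈ Γ, surfDiv Γ n Y z =
      ∑ y ∈ t, surfDiv Γ n (fun w => φ y w • (σ w)⁻¹ • Y w) z := by
    intro z hz
    have h1 : Y =ᶠ[𝓝[Γ] z] fun w => ∑ y ∈ t, φ y w • (σ w)⁻¹ • Y w := by
      filter_upwards [self_mem_nhdsWithin] with w hw
      rw [← Finset.sum_smul, smul_smul, mul_inv_cancel₀ (hσpos w hw).ne', one_smul]
    rw [surfDiv_congr h1]
    simp only [surfDiv]
    rw [Finset.sum_comm]
    refine Finset.sum_congr rfl fun i _ => ?_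
    rw [← S.tanDeriv_sum hz t fun y _ => ((hZ.smul (hφe y)).extAt_apply hz i)]
    refine congrArg (fun f => tanDeriv Γ n i f z) ?_
    ext w
    simp [Finset.sum_apply]
  rw [surfInt_congr S.surface hsum, surfInt,
    integral_finsetSum t fun y _ => S.surface.integrableOn
      ((hZ.smul (hφe y)).continuousOn_surfDiv S)]
  refine Finset.sum_eq_zero fun y hy => ?_
  refine hloc y (htΓ y hy) _ (hZ.smul (hφe y)) fun z _ hzB => ?_
  rw [(hφ y (htΓ y hy)).2 z hzB, zero_smul]

end Divergence

end

section

variable {Γ : Set E3} {n : E3 → E3} {y : E3} {k : ℕ}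

/-! ### Tangent planes -/

theorem inner_eq_sum_mul (a b : E3) : ⟪a, b⟫ = ∑ i, a i * b i := by
  rw [PiLp.inner_apply]
  exact Finset.sum_congr rfl fun i _ => mul_comm _ _

theorem toEuclideanLin_apply_coord (M : Matrix (Fin 3) (Fin 3) ℝ) (v : E3) (i : Fin 3) :
    Matrix.toEuclideanLin M v i = ∑ j, M i j * v j := rfl

theorem toEuclideanLin_P (v : E3) :
    Matrix.toEuclideanLin (P n y) v = v - ⟪n y, v⟫ • n y := by
  ext i
  rw [toEuclideanLin_apply_coord]
  simp [P, inner_eq_sum_mul, sub_mul, Finset.sum_sub_distrib, Matrix.vecMulVec_apply,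
    Matrix.one_apply, Finset.sum_mul]
  exact Finset.sum_congr rfl fun j _ => by ring

/-- `t` is an orthonormal basis of the tangent plane at `y`. -/
structure IsTangentBasis {ι : Type*} [Fintype ι] (n : E3 → E3) (y : E3) (t : ι → E3) : Prop where
  orthonormal : Orthonormal ℝ t
  tangent : ∀ i, ⟪t i, n y⟫ = 0
  sum_eq : ∀ v, ⟪v, n y⟫ = 0 → ∑ i, ⟪t i, v⟫ • t i = v

theorem mem_tangentPlane_iff {v : E3} : v ∈ tangentPlane n y ↔ ⟪v, n y⟫ = 0 :=
  Submodule.mem_orthogonal_singleton_iff_inner_left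

theorem isTangentBasis_of_orthonormalBasis {ι : Type*} [Fintype ι]
    (b : OrthonormalBasis ι ℝ (tangentPlane n y)) : IsTangentBasis n y fun i => (b i : E3) where
  orthonormal := b.orthonormal.comp_linearIsometry (tangentPlane n y).subtypeₗᵢ
  tangent i := mem_tangentPlane_iff.1 (b i).2
  sum_eq v hv := by
    have h := b.sum_repr' ⟨v, mem_tangentPlane_iff.2 hv⟩
    have h2 := congrArg (tangentPlane n y).subtype h
    rw [map_sum] at h2
    simpa using h2

theorem isTangentBasis_τ (n : E3 → E3) (y : E3) : IsTangentBasis n y (τ n y) :=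
  isTangentBasis_of_orthonormalBasis _

theorem IsUnitNormal.ne_zero (hn : IsUnitNormal Γ n) (hy : y ∈ Γ) : n y ≠ 0 := by
  rw [← norm_ne_zero_iff, hn.norm_eq_one y hy]; exact one_ne_zero

theorem IsUnitNormal.isTangentBasis (hn : IsUnitNormal Γ n) (hy : y ∈ Γ) {t : Fin 2 → E3}
    (ho : Orthonormal ℝ t) (ht : ∀ i, ⟪t i, n y⟫ = 0) : IsTangentBasis n y t := by
  have : Fact (Module.finrank ℝ E3 = 2 + 1) := ⟨by simp⟩
  have h3 : Module.finrank ℝ (tangentPlane n y) = 2 :=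
    Submodule.finrank_orthogonal_span_singleton (hn.ne_zero hy)
  set t' : Fin 2 → tangentPlane n y := fun i => ⟨t i, mem_tangentPlane_iff.2 (ht i)⟩
  have ho' : Orthonormal ℝ t' := by
    rw [← (tangentPlane n y).subtypeₗᵢ.orthonormal_comp_iff]; exact ho
  obtain ⟨b, hb⟩ := Orthonormal.exists_orthonormalBasis_extension_of_card_eq (ι := Fin 2)
    (by simpa using h3) (v := t') (s := univ)
    (ho'.comp _ Subtype.val_injective)
  have := isTangentBasis_of_orthonormalBasis b
  convert this using 2 with i
  rw [hb i (mem_univ i)]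

/-- A trace over the tangent plane does not depend on the orthonormal basis and can be taken over
the three vectors P e_k, since P e_k = Σ_i (t_i)_k t_i. Sums over the pointwise chosen basis `τ`
thereby become sums over Cartesian indices. -/
theorem IsTangentBasis.sum_bilin {ι F : Type*} [Fintype ι] [AddCommGroup F] [Module ℝ F]
    {t : ι → E3} (ht : IsTangentBasis n y t) (hN : ∑ i, n y i * n y i = 1)
    (B : E3 →ₗ[ℝ] E3 →ₗ[ℝ] F) :
    ∑ i, B (t i) (t i) = ∑ k, B (projE n k y) (projE n k y) := by
  classical
  have hp : ∀ k, projE n k y = ∑ i, t i k • t i := by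
    intro k
    have h0 : ⟪projE n k y, n y⟫ = 0 := by
      rw [projE, inner_sub_left, real_inner_smul_left, inner_eq_sum_mul (n y), hN]
      simp [EuclideanSpace.inner_single_left]
    rw [← ht.sum_eq _ h0]
    refine Finset.sum_congr rfl fun i _ => ?_
    rw [projE, inner_sub_right, real_inner_smul_right, ht.tangent i]
    simp [EuclideanSpace.inner_single_right]
  have h1 : ∀ k, B (projE n k y) (projE n k y) =
      ∑ i, ∑ j, (t i k * t j k) • B (t i) (t j) := by
    intro k
    rw [hp k]
    simp only [map_sum, LinearMap.sum_apply, map_smul, LinearMap.smul_apply, smul_smul,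
      Finset.smul_sum]
    rw [Finset.sum_comm]
    exact Finset.sum_congr rfl fun i _ => Finset.sum_congr rfl fun j _ => by rw [mul_comm]
  simp only [h1]
  rw [Finset.sum_comm]
  refine Finset.sum_congr rfl fun i _ => ?_
  rw [Finset.sum_comm]
  have h2 : ∀ j, ∑ k, (t i k * t j k) • B (t i) (t j) = if i = j then B (t i) (t j) else 0 := by
    intro j
    rw [← Finset.sum_smul, ← inner_eq_sum_mul, orthonormal_iff_ite.1 ht.orthonormal i j]
    split_ifs <;> simp
  simp [h2]

theorem IsTangentBasis.sum_mul {ι : Type*} [Fintype ι]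
    {t : ι → E3} (ht : IsTangentBasis n y t) (hN : ∑ i, n y i * n y i = 1) (f g : E3 →ₗ[ℝ] ℝ) :
    ∑ i, f (t i) * g (t i) = ∑ k, f (projE n k y) * g (projE n k y) :=
  ht.sum_bilin hN ((LinearMap.mul ℝ ℝ).compl₁₂ f g)

theorem inner1_eq {ω ζ : E3 →ₗ[ℝ] ℝ} {A : E3} (hA : ⟪A, n y⟫ = 0)
    (h : ∀ v, ⟪v, n y⟫ = 0 → ω v = ⟪A, v⟫) : inner1 n y ω ζ = ζ A := by
  have ht := isTangentBasis_τ n y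
  conv_rhs => rw [← ht.sum_eq A hA, map_sum]
  refine Finset.sum_congr rfl fun i _ => ?_
  rw [h _ (ht.tangent i), map_smul, smul_eq_mul, real_inner_comm]

theorem inner1_comm (ω ζ : E3 →ₗ[ℝ] ℝ) : inner1 n y ω ζ = inner1 n y ζ ω :=
  Finset.sum_congr rfl fun _ _ => mul_comm _ _

theorem sharp_eq {ω : E3 →ₗ[ℝ] ℝ} {A : E3} (hA : ⟪A, n y⟫ = 0)
    (h : ∀ v, ⟪v, n y⟫ = 0 → ω v = ⟪A, v⟫) : sharp n y ω = A := by
  have ht := isTangentBasis_τ n y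
  conv_rhs => rw [← ht.sum_eq A hA]
  refine Finset.sum_congr rfl fun i _ => ?_
  rw [h _ (ht.tangent i), real_inner_comm]

theorem innerTensor_eq (hN : ∑ i, n y i * n y i = 1) (S T : E3 →ₗ[ℝ] E3 →ₗ[ℝ] ℝ) :
    innerTensor n y S T =
      ∑ k, ∑ l, S (projE n k y) (projE n l y) * T (projE n k y) (projE n l y) := by
  have ht := isTangentBasis_τ n y
  have h1 : ∀ i, ∑ j, S (τ n y i) (τ n y j) * T (τ n y i) (τ n y j) =
      ∑ l, S.flip (projE n l y) (τ n y i) * T.flip (projE n l y) (τ n y i) :=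
    fun i => ht.sum_mul hN _ _
  rw [innerTensor]
  simp only [h1]
  rw [Finset.sum_comm]
  exact (Finset.sum_congr rfl fun l _ => ht.sum_mul hN _ _).trans Finset.sum_comm

/-- Antisymmetry kills the diagonal and makes the two triangles contribute equally. The ordered sum
is thus expressed by a basis independent one. -/
theorem two_mul_inner2_eq {S T : E3 →ₗ[ℝ] E3 →ₗ[ℝ] ℝ}
    (hS : ∀ v w, ⟪v, n y⟫ = 0 → ⟪w, n y⟫ = 0 → S v w = -S w v)
    (hT : ∀ v w, ⟪v, n y⟫ = 0 → ⟪w, n y⟫ = 0 → T v w = -T w v) :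
    2 * inner2 n y S T = innerTensor n y S T := by
  have ht := (isTangentBasis_τ n y).tangent
  have h1 : ∀ i j, S (τ n y i) (τ n y j) * T (τ n y i) (τ n y j) =
      (if i < j then S (τ n y i) (τ n y j) * T (τ n y i) (τ n y j) else 0) +
      (if j < i then S (τ n y j) (τ n y i) * T (τ n y j) (τ n y i) else 0) := by
    intro i j
    rcases lt_trichotomy i j with h | h | h
    · simp [h, h.not_gt]
    · subst h
      have := hS _ _ (ht i) (ht i)
      have : S (τ n y i) (τ n y i) = 0 := by linarith
      simp [this]
    · rw [if_neg h.not_gt, if_pos h, hS _ _ (ht i) (ht j), hT _ _ (ht i) (ht j)]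
      ring
  rw [innerTensor, Finset.sum_congr rfl fun i _ => Finset.sum_congr rfl fun j _ => h1 i j]
  simp_rw [Finset.sum_add_distrib]
  rw [two_mul, inner2]
  congr 1
  rw [Finset.sum_comm]

theorem inner2_congr {S S' T T' : E3 →ₗ[ℝ] E3 →ₗ[ℝ] ℝ}
    (hS : ∀ v w, ⟪v, n y⟫ = 0 → ⟪w, n y⟫ = 0 → S v w = S' v w)
    (hT : ∀ v w, ⟪v, n y⟫ = 0 → ⟪w, n y⟫ = 0 → T v w = T' v w) :
    inner2 n y S T = inner2 n y S' T' := by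
  have ht := (isTangentBasis_τ n y).tangent
  simp only [inner2, hS _ _ (ht _) (ht _), hT _ _ (ht _) (ht _)]

/-! ### Functions and fields on an oriented surface -/

theorem ExtAt.inner {X Y : E3 → E3} (hX : ExtAt k Γ X y) (hY : ExtAt k Γ Y y) :
    ExtAt k Γ (fun z => ⟪X z, Y z⟫) y := by
  simp only [inner_eq_sum_mul]
  exact ExtAt.sum _ fun i _ => (extAt_pi_iff.1 hX i).mul (extAt_pi_iff.1 hY i)

theorem isCk_iff {F : Type*} [NormedAddCommGroup F] [NormedSpace ℝ F] {f : E3 → F} :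
    IsCk k Γ f ↔ ∀ y ∈ Γ, ExtAt k Γ f y :=
  ⟨fun h y hy => h y ⟨hy, mem_univ _⟩, fun h y hy => h y hy.1⟩

/-- The tangential gradient of a function. -/
def surfGrad (Γ : Set E3) (n : E3 → E3) (f : E3 → ℝ) (y : E3) : E3 :=
  WithLp.toLp 2 fun i => tanDeriv Γ n i f y

/-- The vector `W X`. -/
def shape (Γ : Set E3) (n : E3 → E3) (X : E3 → E3) (y : E3) : E3 :=
  Matrix.toEuclideanLin (W Γ n y) (X y)

theorem surfGrad_apply (f : E3 → ℝ) (i : Fin 3) : surfGrad Γ n f y i = tanDeriv Γ n i f y := rfl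

theorem W_apply (i j : Fin 3) : W Γ n y i j = -tanDeriv Γ n i (fun z => n z j) y := rfl

theorem shape_apply (X : E3 → E3) (i : Fin 3) : shape Γ n X y i = ∑ j, W Γ n y i j * X y j := rfl

theorem H_eq : H Γ n y = ∑ i, W Γ n y i i := rfl

namespace IsOrientedSurface

variable {X Y : E3 → E3} {f g : E3 → ℝ}

theorem W_symm (S : IsOrientedSurface Γ n) (hy : y ∈ Γ) (i j : Fin 3) :
    W Γ n y i j = W Γ n y j i := by
  rw [W_apply, W_apply, S.tanDeriv_normal_symm hy]

theorem sum_W_mul_normal (S : IsOrientedSurface Γ n) (hy : y ∈ Γ) (i : Fin 3) :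
    ∑ j, W Γ n y i j * n y j = 0 := by
  have := S.sum_normal_mul_tanDeriv_normal hy i
  simp only [W_apply, neg_mul, Finset.sum_neg_distrib]
  simp only [mul_comm (n y _)] at this
  rw [this, neg_zero]

theorem extAt_W (S : IsOrientedSurface Γ n) (hy : y ∈ Γ) (hk : k ≤ 1) (i j : Fin 3) :
    ExtAt k Γ (fun z => W Γ n z i j) y := by
  simp only [W_apply]
  exact (S.extAt_tanDeriv hy (S.extAt_normal_apply hy (by omega) j) (by omega) i).neg

theorem extAt_H (S : IsOrientedSurface Γ n) (hy : y ∈ Γ) (hk : k ≤ 1) :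
    ExtAt k Γ (H Γ n) y :=
  ExtAt.sum Finset.univ fun i _ => S.extAt_W hy hk i i

theorem extAt_shape (S : IsOrientedSurface Γ n) (hy : y ∈ Γ) (hk : k ≤ 1) (hX : ExtAt k Γ X y) :
    ExtAt k Γ (shape Γ n X) y :=
  extAt_pi_iff.2 fun i => ExtAt.sum Finset.univ fun j _ =>
    (S.extAt_W hy hk i j).mul (extAt_pi_iff.1 hX j)

theorem inner_shape_comm (S : IsOrientedSurface Γ n) (hy : y ∈ Γ) (X Y : E3 → E3) :
    ⟪shape Γ n X y, Y y⟫ = ⟪X y, shape Γ n Y y⟫ := by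
  simp only [inner_eq_sum_mul, shape_apply, Finset.sum_mul, Finset.mul_sum]
  rw [Finset.sum_comm]
  refine Finset.sum_congr rfl fun i _ => Finset.sum_congr rfl fun j _ => ?_
  rw [S.W_symm hy j i]; ring

theorem shape_tangent (S : IsOrientedSurface Γ n) (hy : y ∈ Γ) (X : E3 → E3) :
    ⟪shape Γ n X y, n y⟫ = 0 := by
  rw [S.inner_shape_comm hy X n]
  have : shape Γ n n y = 0 := by
    ext i; rw [shape_apply, S.sum_W_mul_normal hy]; rfl
  rw [this, inner_zero_right]

theorem isTangentField_shape (S : IsOrientedSurface Γ n) (hk : k ≤ 1)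
    (hX : IsTangentField k Γ n X) : IsTangentField k Γ n (shape Γ n X) :=
  ⟨isCk_iff.2 fun _ hy => S.extAt_shape hy hk (hX.extAt hy), fun _ hy => S.shape_tangent hy X⟩

theorem surfGrad_tangent (S : IsOrientedSurface Γ n) (hy : y ∈ Γ) (f : E3 → ℝ) :
    ⟪surfGrad Γ n f y, n y⟫ = 0 := by
  rw [inner_eq_sum_mul, ← S.sum_normal_mul_tanDeriv hy f]
  exact Finset.sum_congr rfl fun i _ => mul_comm _ _

/-- For a tangential field, the normal part of its derivative is given by the Weingarten map. -/
theorem sum_normal_mul_tanDeriv_field (S : IsOrientedSurface Γ n) (hy : y ∈ Γ)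
    (hX : ∀ᶠ z in 𝓝[Γ] y, ⟪X z, n z⟫ = 0) (hXe : ExtAt 1 Γ X y) (i : Fin 3) :
    ∑ j, n y j * tanDeriv Γ n i (fun z => X z j) y = shape Γ n X y i := by
  have h0 : tanDeriv Γ n i (fun z => ∑ j, X z j * n z j) y = 0 := by
    rw [tanDeriv_congr (g := fun _ => 0) (hX.mono fun z hz => by rw [← inner_eq_sum_mul, hz]),
      S.tanDeriv_const hy]
  have he : ∀ j, ExtAt 1 Γ (fun z => n z j) y := S.extAt_normal_apply hy (by norm_num)
  have hx := extAt_pi_iff.1 hXe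
  rw [S.tanDeriv_sum hy _ fun j _ => (hx j).mul (he j)] at h0
  simp only [S.tanDeriv_mul hy (hx _) (he _), Finset.sum_add_distrib] at h0
  simp only [shape_apply, W_apply, neg_mul, Finset.sum_neg_distrib,
    mul_comm (tanDeriv Γ n i _ y) (X y _)]
  linarith

theorem isTangentField_projE (S : IsOrientedSurface Γ n) (hk : k ≤ 2) (i : Fin 3) :
    IsTangentField k Γ n (projE n i) := by
  refine ⟨isCk_iff.2 fun y hy => extAt_pi_iff.2 fun j => ?_, fun y hy => S.normal.inner_projE hy i⟩
  exact (ExtAt.const _).sub ((S.extAt_normal_apply hy hk i).mul (S.extAt_normal_apply hy hk j))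

theorem inner_projE_eq {V : E3} (hV : ⟪V, n y⟫ = 0) (i : Fin 3) : ⟪V, projE n i y⟫ = V i := by
  rw [projE, inner_sub_right, real_inner_smul_right, hV]
  simp [EuclideanSpace.inner_single_right]

/-- A continuous tangential field is determined by its `L²` products with `C¹` fields. -/
theorem eq_of_forall_surfInt_inner (S : IsOrientedSurface Γ n) {V V' : E3 → E3}
    (hV : IsTangentField 0 Γ n V) (hV' : IsTangentField 0 Γ n V')
    (h : ∀ Y, IsTangentField 1 Γ n Y →
      surfInt Γ (fun z => ⟪V z, Y z⟫) = surfInt Γ fun z => ⟪V' z, Y z⟫) (hy : y ∈ Γ) :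
    V y = V' y := by
  ext i
  rw [← sub_eq_zero]
  have hc : ∀ V : E3 → E3, IsTangentField 0 Γ n V → ContinuousOn (fun z => V z i) Γ :=
    fun V hV z hz => (hV.extAt_apply hz i).continuousWithinAt hz
  refine S.surface.eq_zero_of_forall_surfInt_mul (f := fun z => V z i - V' z i)
    ((hc V hV).sub (hc V' hV')) (fun φ hφ => ?_) hy
  have hY := (S.isTangentField_projE one_le_two i).smul
    fun z _ => (hφ.contDiffAt (x := z)).extAt (Γ := Γ) (k := 1)
  have h1 := h _ hY
  -- Testing with φ P e_i isolates the i-th component of a tangential field.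
  have h2 : ∀ V : E3 → E3, IsTangentField 0 Γ n V →
      surfInt Γ (fun z => ⟪V z, φ z • projE n i z⟫) = surfInt Γ fun z => V z i * φ z := by
    intro V hV
    refine surfInt_congr S.surface fun z hz => ?_
    rw [real_inner_smul_right, inner_projE_eq (hV.2 z hz), mul_comm]
  rw [h2 V hV, h2 V' hV'] at h1
  simp only [sub_mul]
  rw [surfInt_sub (f := fun z => V z i * φ z) (g := fun z => V' z i * φ z) S.surface
    ((hc V hV).mul hφ.continuous.continuousOn) ((hc V' hV').mul hφ.continuous.continuousOn),
    h1, sub_self]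

/-- The field dual to a 1-form. -/
theorem exists_field_of_isForm1 (S : IsOrientedSurface Γ n) (hk : k ≤ 2) {ω : Form1}
    (hω : IsForm1 k Γ n ω) :
    ∃ Y, IsTangentField k Γ n Y ∧ ∀ y ∈ Γ, ∀ v, ⟪v, n y⟫ = 0 → ω y v = ⟪Y y, v⟫ := by
  have key : ∀ y, ∀ v, ⟪v, n y⟫ = 0 → ω y v = ∑ i, ω y (projE n i y) * v i := by
    intro y v hv
    conv_lhs => rw [← sum_smul_projE v hv, map_sum]
    exact Finset.sum_congr rfl fun i _ => by rw [map_smul, smul_eq_mul, mul_comm]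
  refine ⟨fun y => WithLp.toLp 2 fun i => ω y (projE n i y), ⟨isCk_iff.2 fun y hy =>
    extAt_pi_iff.2 fun i => isCk_iff.1 (hω _ (S.isTangentField_projE hk i)) y hy,
    fun y hy => ?_⟩, fun y hy v hv => ?_⟩
  · have h0 : ∑ i, n y i • projE n i y = 0 := by
      ext j
      have := S.normal.sum_sq hy
      simp only [projE, smul_sub, Finset.sum_sub_distrib, smul_smul, ← Finset.sum_smul, this]
      simp [Finset.sum_apply, Pi.single_apply]
    rw [inner_eq_sum_mul, ← (ω y).map_zero, ← h0, map_sum]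
    exact Finset.sum_congr rfl fun i _ => by rw [map_smul, smul_eq_mul, mul_comm]
  · rw [key y v hv, inner_eq_sum_mul]

theorem isForm1_flat (hY : ∀ y ∈ Γ, ExtAt k Γ Y y) : IsForm1 k Γ n (flat Y) := fun _ hX =>
  isCk_iff.2 fun y hy => (hY y hy).inner (hX.extAt hy)

end IsOrientedSurface

/-! ### Exterior derivatives -/

section ExtDeriv

variable {X Y : E3 → E3} {f : E3 → ℝ}

theorem fderiv_eq_sum_coordVec {μ : E2 → E3} {s : E2} (w : E2) :
    fderiv ℝ μ s w = ∑ i, w i • coordVec μ s i := by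
  have hw : w = ∑ i, w i • EuclideanSpace.single i (1 : ℝ) := by
    ext i; fin_cases i <;> simp [Fin.sum_univ_two]
  conv_lhs => rw [hw, map_sum]
  exact Finset.sum_congr rfl fun i _ => by rw [map_smul, coordVec]

/-- The coordinate vectors span the tangent plane, so the chartwise definition amounts to a
pointwise formula on tangent vectors. -/
theorem isExtDeriv0_iff (S : IsOrientedSurface Γ n) (hf : ∀ y ∈ Γ, ExtAt 1 Γ f y) {α : Form1} :
    IsExtDeriv0 Γ f α ↔ ∀ y ∈ Γ, ∀ v, ⟪v, n y⟫ = 0 → α y v = ⟪surfGrad Γ n f y, v⟫ := by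
  have key : ∀ (U : Set E2) (μ : E2 → E3), IsLocalParam Γ U μ → ∀ s ∈ U, ∀ i,
      fderiv ℝ (fun t => f (μ t)) s (EuclideanSpace.single i 1) =
        ⟪surfGrad Γ n f (μ s), coordVec μ s i⟫ := by
    intro U μ h s hs i
    rw [h.fderiv_comp S.surface S.normal hs (hf _ (h.mem hs)), inner_eq_sum_mul]
    rfl
  constructor
  · intro hα y hy v hv
    obtain ⟨U, μ, h, s, hs, rfl⟩ := S.surface.exists_param y hy
    obtain ⟨w, rfl⟩ := h.exists_fderiv_eq S.normal hs hv
    rw [fderiv_eq_sum_coordVec, map_sum, inner_sum]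
    refine Finset.sum_congr rfl fun i _ => ?_
    rw [map_smul, hα U μ h s hs i, key U μ h s hs i, real_inner_smul_right, smul_eq_mul]
  · intro hα U μ h s hs i
    rw [key U μ h s hs i, hα _ (h.mem hs) _ (S.normal.inner_eq_zero U μ h s hs i)]

/-- The bilinear form `(v, w) ↦ ∑ i j, (D_i Y_j - D_j Y_i) v_i w_j`. -/
def curlForm (Γ : Set E3) (n : E3 → E3) (Y : E3 → E3) : Tensor2 := fun y =>
  LinearMap.mk₂ ℝ (fun v w => ∑ i, ∑ j, (tanDeriv Γ n i (fun z => Y z j) y -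
      tanDeriv Γ n j (fun z => Y z i) y) * (v i * w j))
    (fun v v' w => by
      simp only [← Finset.sum_add_distrib]
      exact Finset.sum_congr rfl fun i _ => Finset.sum_congr rfl fun j _ => by
        simp only [PiLp.add_apply]; ring)
    (fun c v w => by
      simp only [Finset.smul_sum]
      exact Finset.sum_congr rfl fun i _ => Finset.sum_congr rfl fun j _ => by
        simp only [PiLp.smul_apply, smul_eq_mul]; ring)
    (fun v w w' => by
      simp only [← Finset.sum_add_distrib]
      exact Finset.sum_congr rfl fun i _ => Finset.sum_congr rfl fun j _ => by
        simp only [PiLp.add_apply]; ring)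
    (fun c v w => by
      simp only [Finset.smul_sum]
      exact Finset.sum_congr rfl fun i _ => Finset.sum_congr rfl fun j _ => by
        simp only [PiLp.smul_apply, smul_eq_mul]; ring)

theorem curlForm_apply (Y : E3 → E3) (v w : E3) : curlForm Γ n Y y v w =
    ∑ i, ∑ j, (tanDeriv Γ n i (fun z => Y z j) y - tanDeriv Γ n j (fun z => Y z i) y) *
      (v i * w j) := rfl

theorem curlForm_antisymm (Y : E3 → E3) (v w : E3) :
    curlForm Γ n Y y v w = -curlForm Γ n Y y w v := by
  rw [curlForm_apply, curlForm_apply, Finset.sum_comm]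
  simp only [← Finset.sum_neg_distrib]
  exact Finset.sum_congr rfl fun i _ => Finset.sum_congr rfl fun j _ => by ring

/-- Differentiating Y · ∂_j μ in the direction i produces Y · ∂_i ∂_j μ, which cancels in the
antisymmetrization; only derivatives of Y remain. -/
theorem isExtDeriv1_iff (S : IsOrientedSurface Γ n) (hY : ∀ y ∈ Γ, ExtAt 1 Γ Y y) {ω : Form1}
    (hω : ∀ y ∈ Γ, ∀ v, ⟪v, n y⟫ = 0 → ω y v = ⟪Y y, v⟫) {δ : Tensor2} :
    IsExtDeriv1 Γ ω δ ↔ ∀ y ∈ Γ, ∀ v w, ⟪v, n y⟫ = 0 → ⟪w, n y⟫ = 0 →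
      δ y v w = curlForm Γ n Y y v w := by
  have key : ∀ (U : Set E2) (μ : E2 → E3), IsLocalParam Γ U μ → ∀ s ∈ U, ∀ i j,
      fderiv ℝ (fun t => ω (μ t) (coordVec μ t j)) s (EuclideanSpace.single i 1) -
      fderiv ℝ (fun t => ω (μ t) (coordVec μ t i)) s (EuclideanSpace.single j 1) =
        curlForm Γ n Y (μ s) (coordVec μ s i) (coordVec μ s j) := by
    intro U μ h s hs i j
    have hm : DifferentiableAt ℝ (fun t => Y (μ t)) s :=
      ((hY _ (h.mem hs)).comp_param (by norm_num) h hs).differentiableAt (by simp)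
    have hdd : DifferentiableAt ℝ (fderiv ℝ μ) s :=
      ((h.contDiffAt hs).fderiv_right (m := 1) (by norm_num)).differentiableAt (by simp)
    have h1 : ∀ i j, fderiv ℝ (fun t => ω (μ t) (coordVec μ t j)) s (EuclideanSpace.single i 1) =
        ⟪Y (μ s), fderiv ℝ (fderiv ℝ μ) s (EuclideanSpace.single i 1)
          (EuclideanSpace.single j 1)⟫ + ∑ l, ∑ m, tanDeriv Γ n l (fun z => Y z m) (μ s) *
            (coordVec μ s i l * coordVec μ s j m) := by
      intro i j
      have he : (fun t => ω (μ t) (coordVec μ t j)) =ᶠ[𝓝 s]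
          fun t => ⟪Y (μ t), coordVec μ t j⟫ := by
        filter_upwards [h.isOpen.mem_nhds hs] with t ht
        exact hω _ (h.mem ht) _ (S.normal.inner_eq_zero U μ h t ht j)
      have hcd : DifferentiableAt ℝ (fun t => coordVec μ t j) s :=
        (h.contDiffAt_coordVec hs j).differentiableAt (by simp)
      rw [he.fderiv_eq, fderiv_inner_apply ℝ hm hcd]
      congr 1
      · simp only [coordVec]
        rw [fderiv_clm_apply hdd (differentiableAt_const _)]
        simp
      · rw [inner_eq_sum_mul, Finset.sum_comm]
        refine Finset.sum_congr rfl fun m _ => ?_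
        rw [← fderiv_coord hm, h.fderiv_comp (f := fun z => Y z m) S.surface S.normal hs
          (extAt_pi_iff.1 (hY _ (h.mem hs)) m), Finset.sum_mul]
        exact Finset.sum_congr rfl fun l _ => by simp only [coordVec]; ring
    rw [h1, h1, ((h.contDiffAt hs).isSymmSndFDerivAt (by simp; norm_num)).eq
      (EuclideanSpace.single i 1), curlForm_apply, add_sub_add_left_eq_sub,
      Finset.sum_comm (f := fun l m => tanDeriv Γ n l (fun z => Y z m) (μ s) *
            (coordVec μ s j l * coordVec μ s i m))]
    simp only [← Finset.sum_sub_distrib]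
    exact Finset.sum_congr rfl fun l _ => Finset.sum_congr rfl fun m _ => by ring
  constructor
  · intro hδ y hy v w hv hw
    obtain ⟨U, μ, h, s, hs, rfl⟩ := S.surface.exists_param y hy
    obtain ⟨a, rfl⟩ := h.exists_fderiv_eq S.normal hs hv
    obtain ⟨b, rfl⟩ := h.exists_fderiv_eq S.normal hs hw
    simp only [fderiv_eq_sum_coordVec, map_sum, map_smul,
      LinearMap.sum_apply, LinearMap.smul_apply, hδ U μ h s hs, key U μ h s hs]
  · intro hδ U μ h s hs i j
    rw [key U μ h s hs, hδ _ (h.mem hs) _ _ (S.normal.inner_eq_zero U μ h s hs i)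
      (S.normal.inner_eq_zero U μ h s hs j)]

end ExtDeriv

end

section

namespace IsOrientedSurface

variable {Γ : Set E3} {n : E3 → E3} {y : E3} {k : ℕ} {X Y : E3 → E3}

/-! ### The Bochner Laplacian -/

theorem _root_.SurfaceCalculus.covMap_apply (X : E3 → E3) (v : E3) (k : Fin 3) :
    covMap Γ n X y v k = ∑ i, (tanDeriv Γ n i (fun z => X z k) y -
      n y k * ∑ m, n y m * tanDeriv Γ n i (fun z => X z m) y) * v i := by
  rw [covMap, toEuclideanLin_apply_coord]
  refine Finset.sum_congr rfl fun i _ => ?_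
  congr 1
  simp only [Matrix.mul_apply, P, Matrix.sub_apply, Matrix.one_apply, Matrix.vecMulVec_apply,
    Matrix.transpose_apply, tanGradMat, Matrix.of_apply, sub_mul, Finset.sum_sub_distrib,
    Finset.mul_sum, mul_assoc]
  simp

theorem sum_tanDeriv_mul_projE (S : IsOrientedSurface Γ n) (hy : y ∈ Γ) (f : E3 → ℝ)
    (l : Fin 3) : ∑ i, tanDeriv Γ n i f y * projE n l y i = tanDeriv Γ n l f y := by
  have h := S.surfGrad_tangent hy f
  have := inner_projE_eq h l
  rwa [inner_eq_sum_mul] at this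

/-- The covariant derivative of a tangential field. -/
theorem covMap_tangentField (S : IsOrientedSurface Γ n) (hy : y ∈ Γ)
    (hX : ∀ᶠ z in 𝓝[Γ] y, ⟪X z, n z⟫ = 0) (hXe : ExtAt 1 Γ X y) (v : E3) (k : Fin 3) :
    covMap Γ n X y v k = ∑ i, (tanDeriv Γ n i (fun z => X z k) y -
      n y k * shape Γ n X y i) * v i := by
  simp only [covMap_apply, S.sum_normal_mul_tanDeriv_field hy hX hXe]

theorem _root_.SurfaceCalculus.IsTangentField.eventually (hX : IsTangentField k Γ n X) :
    ∀ᶠ z in 𝓝[Γ] y, ⟪X z, n z⟫ = 0 :=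
  eventually_mem_nhdsWithin.mono hX.2

theorem _root_.SurfaceCalculus.IsTangentField.mono {l : ℕ} (hX : IsTangentField k Γ n X)
    (h : l ≤ k) : IsTangentField l Γ n X :=
  ⟨isCk_iff.2 fun _ hy => (hX.extAt hy).mono h, hX.2⟩

theorem inner_covMap_projE (S : IsOrientedSurface Γ n) (hy : y ∈ Γ) (hX : IsTangentField 1 Γ n X)
    (k l : Fin 3) : ⟪covMap Γ n X y (projE n l y), projE n k y⟫ =
      tanDeriv Γ n l (fun z => X z k) y - n y k * shape Γ n X y l := by
  have h1 : ∀ k, covMap Γ n X y (projE n l y) k =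
      tanDeriv Γ n l (fun z => X z k) y - n y k * shape Γ n X y l := by
    intro k
    rw [S.covMap_tangentField hy hX.eventually (hX.extAt hy)]
    simp only [sub_mul, Finset.sum_sub_distrib, S.sum_tanDeriv_mul_projE hy]
    congr 1
    simp only [mul_assoc, ← Finset.mul_sum]
    rw [← inner_eq_sum_mul, inner_projE_eq (S.shape_tangent hy X)]
  rw [inner_projE_eq, h1]
  rw [inner_eq_sum_mul]
  simp only [h1, sub_mul, Finset.sum_sub_distrib]
  have h2 : ∑ x, n y x * shape Γ n X y l * n y x = shape Γ n X y l * ∑ x, n y x * n y x := by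
    rw [Finset.mul_sum]; exact Finset.sum_congr rfl fun _ _ => by ring
  rw [h2, S.normal.sum_sq hy, ← S.sum_normal_mul_tanDeriv_field hy hX.eventually (hX.extAt hy)]
  simp only [mul_comm (tanDeriv Γ n l _ y)]
  ring

/-- Each D_i X splits into a tangential part, which is the covariant derivative, and a normal part
of size (W X)_i. The normal parts contribute W X · W Y to the full product. -/
theorem innerTensor_covTensor (S : IsOrientedSurface Γ n) (hy : y ∈ Γ)
    (hX : IsTangentField 1 Γ n X) (hY : IsTangentField 1 Γ n Y) :
    innerTensor n y (covTensor Γ n X y) (covTensor Γ n Y y) =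
      ∑ i, ∑ j, tanDeriv Γ n i (fun z => X z j) y * tanDeriv Γ n i (fun z => Y z j) y -
        ⟪shape Γ n X y, shape Γ n Y y⟫ := by
  rw [innerTensor_eq (S.normal.sum_sq hy), Finset.sum_comm, inner_eq_sum_mul,
    ← Finset.sum_sub_distrib]
  refine Finset.sum_congr rfl fun i _ => ?_
  have h1 := S.sum_normal_mul_tanDeriv_field hy hX.eventually (hX.extAt hy) i
  have h2 := S.sum_normal_mul_tanDeriv_field hy hY.eventually (hY.extAt hy) i
  have hN := S.normal.sum_sq hy
  have e : ∀ j, covTensor Γ n X y (projE n j y) (projE n i y) *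
      covTensor Γ n Y y (projE n j y) (projE n i y) =
      (tanDeriv Γ n i (fun z => X z j) y - n y j * shape Γ n X y i) *
      (tanDeriv Γ n i (fun z => Y z j) y - n y j * shape Γ n Y y i) := by
    intro j
    rw [← S.inner_covMap_projE hy hX, ← S.inner_covMap_projE hy hY]
    rfl
  simp only [e]
  simp only [Fin.sum_univ_three] at *
  linear_combination (-shape Γ n Y y i) * h1 - shape Γ n X y i * h2 +
    shape Γ n X y i * shape Γ n Y y i * hN

theorem extAt_covMap (S : IsOrientedSurface Γ n) (hy : y ∈ Γ) (hk : k ≤ 1)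
    (hX : ExtAt (k + 1) Γ X y) (hY : ExtAt k Γ Y y) :
    ExtAt k Γ (fun z => covMap Γ n X z (Y z)) y := by
  have hx := extAt_pi_iff.1 hX
  have hn := S.extAt_normal_apply hy (show k ≤ 2 by omega)
  refine extAt_pi_iff.2 fun j => ?_
  simp only [covMap_apply]
  refine ExtAt.sum _ fun i _ => ExtAt.mul (ExtAt.sub ?_ (ExtAt.mul (hn j) ?_))
    (extAt_pi_iff.1 hY i)
  · exact S.extAt_tanDeriv hy (hx j) (by omega) i
  · exact ExtAt.sum _ fun m _ => (hn m).mul (S.extAt_tanDeriv hy (hx m) (by omega) i)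

theorem extAt_vecLaplacian (S : IsOrientedSurface Γ n) (hy : y ∈ Γ) (hX : ExtAt 2 Γ X y) :
    ExtAt 0 Γ (vecLaplacian Γ n X) y :=
  extAt_pi_iff.2 fun j => ExtAt.sum Finset.univ fun i _ =>
    S.extAt_tanDeriv hy (S.extAt_tanDeriv hy (k := 1) (extAt_pi_iff.1 hX j) (by norm_num) i)
      (by norm_num) i

theorem extAt_proj (S : IsOrientedSurface Γ n) (hy : y ∈ Γ) (hk : k ≤ 2) (hX : ExtAt k Γ X y) :
    ExtAt k Γ (fun z => Matrix.toEuclideanLin (P n z) (X z)) y := by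
  simp only [toEuclideanLin_P]
  have hn := (S.extAt_normal hy).mono hk
  exact extAt_pi_iff.2 fun j => (extAt_pi_iff.1 hX j).sub ((hn.inner hX).mul (extAt_pi_iff.1 hn j))

theorem proj_tangent (S : IsOrientedSurface Γ n) (hy : y ∈ Γ) (v : E3) :
    ⟪Matrix.toEuclideanLin (P n y) v, n y⟫ = 0 := by
  rw [toEuclideanLin_P, inner_sub_left, real_inner_smul_left, real_inner_self_eq_norm_sq,
    S.normal.norm_eq_one y hy, real_inner_comm]
  ring

theorem inner_proj {v w : E3} (hw : ⟪w, n y⟫ = 0) :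
    ⟪Matrix.toEuclideanLin (P n y) v, w⟫ = ⟪v, w⟫ := by
  rw [toEuclideanLin_P, inner_sub_left, real_inner_smul_left, real_inner_comm w (n y), hw]
  ring

theorem toEuclideanLin_W_sq (X : E3 → E3) :
    Matrix.toEuclideanLin (W Γ n y ^ 2) (X y) = shape Γ n (shape Γ n X) y := by
  ext i
  simp only [shape_apply, toEuclideanLin_apply_coord, pow_two, Matrix.mul_apply, Finset.sum_mul,
    Finset.mul_sum]
  rw [Finset.sum_comm]
  exact Finset.sum_congr rfl fun _ _ => Finset.sum_congr rfl fun _ _ => by ring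

/-- The field `P (Δ_Γ X) + W² X` is continuous and tangential. -/
theorem isTangentField_bochner (S : IsOrientedSurface Γ n) (hX : IsTangentField 2 Γ n X) :
    IsTangentField 0 Γ n fun y => Matrix.toEuclideanLin (P n y) (vecLaplacian Γ n X y) +
      shape Γ n (shape Γ n X) y := by
  refine ⟨isCk_iff.2 fun y hy => extAt_pi_iff.2 fun j => ExtAt.add ?_ ?_, fun y hy => ?_⟩
  · exact extAt_pi_iff.1 (S.extAt_proj hy (by norm_num) (S.extAt_vecLaplacian hy (hX.extAt hy))) j
  · exact (S.isTangentField_shape (by norm_num) (S.isTangentField_shape (by norm_num)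
      (hX.mono (by norm_num)))).extAt_apply hy j
  · rw [inner_add_left, S.proj_tangent hy, S.shape_tangent hy, add_zero]

/-- The field `z ↦ (v ↦ D_v X · Y)` dual to a 1-form. -/
def _root_.SurfaceCalculus.gradDot (Γ : Set E3) (n X Y : E3 → E3) (y : E3) : E3 :=
  WithLp.toLp 2 fun i => ∑ j, tanDeriv Γ n i (fun z => X z j) y * Y y j

theorem isTangentField_gradDot (S : IsOrientedSurface Γ n) (hX : IsTangentField 2 Γ n X)
    (hY : IsTangentField 1 Γ n Y) : IsTangentField 1 Γ n (gradDot Γ n X Y) := by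
  refine ⟨isCk_iff.2 fun y hy => extAt_pi_iff.2 fun i => ExtAt.sum Finset.univ fun j _ =>
    (S.extAt_tanDeriv hy (hX.extAt_apply hy j) (by norm_num) i).mul (hY.extAt_apply hy j),
    fun y hy => ?_⟩
  simp only [inner_eq_sum_mul, gradDot, Finset.sum_mul]
  rw [Finset.sum_comm]
  refine Finset.sum_eq_zero fun j _ => ?_
  have := S.sum_normal_mul_tanDeriv hy fun z => X z j
  rw [← mul_zero (Y y j), ← this, Finset.mul_sum]
  exact Finset.sum_congr rfl fun i _ => by ring

theorem surfDiv_gradDot (S : IsOrientedSurface Γ n) (hy : y ∈ Γ) (hX : IsTangentField 2 Γ n X)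
    (hY : IsTangentField 1 Γ n Y) : surfDiv Γ n (gradDot Γ n X Y) y =
      ⟪vecLaplacian Γ n X y, Y y⟫ +
      ∑ i, ∑ j, tanDeriv Γ n i (fun z => X z j) y * tanDeriv Γ n i (fun z => Y z j) y := by
  have h1 : ∀ i j, ExtAt 1 Γ (tanDeriv Γ n i fun z => X z j) y := fun i j =>
    S.extAt_tanDeriv hy (hX.extAt_apply hy j) (by norm_num) i
  have h2 : ∀ i, tanDeriv Γ n i (fun z => gradDot Γ n X Y z i) y =
      ∑ j, (tanDeriv Γ n i (fun z => X z j) y * tanDeriv Γ n i (fun z => Y z j) y +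
        Y y j * tanDeriv Γ n i (tanDeriv Γ n i fun z => X z j) y) := by
    intro i
    rw [show (fun z => gradDot Γ n X Y z i) =
      fun z => ∑ j, tanDeriv Γ n i (fun z => X z j) z * Y z j from rfl,
      S.tanDeriv_sum hy _ fun j _ => (h1 i j).mul (hY.extAt_apply hy j)]
    exact Finset.sum_congr rfl fun j _ => S.tanDeriv_mul hy (h1 i j) (hY.extAt_apply hy j) i
  simp only [surfDiv, h2, Finset.sum_add_distrib]
  rw [add_comm]
  congr 1
  rw [Finset.sum_comm, inner_eq_sum_mul]
  refine Finset.sum_congr rfl fun j _ => ?_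
  rw [← Finset.mul_sum, mul_comm]
  rfl

/-- Pointwise ⟨∇̄X, ∇̄Y⟩ = div (`gradDot`) - V · Y, where symmetry of W turns W X · W Y into W² X ·
Y. The divergence integrates to zero. -/
theorem isBochnerLaplacian (S : IsOrientedSurface Γ n) (hX : IsTangentField 2 Γ n X) :
    IsBochnerLaplacian Γ n X fun y => Matrix.toEuclideanLin (P n y) (vecLaplacian Γ n X y) +
      shape Γ n (shape Γ n X) y := by
  set V : E3 → E3 := fun y => Matrix.toEuclideanLin (P n y) (vecLaplacian Γ n X y) +
      shape Γ n (shape Γ n X) y with hVdef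
  have hV := S.isTangentField_bochner hX
  have hX1 : IsTangentField 1 Γ n X := hX.mono one_le_two
  refine ⟨fun Y Z hY hZ => isCk_iff.2 fun y hy => ?_, ⟨isCk_iff.2 fun y hy =>
    extAt_pi_iff.2 fun i => (hV.extAt_apply hy i).neg, fun y hy => ?_⟩, fun Y hY => ?_⟩
  · exact (S.extAt_covMap hy le_rfl (hX.extAt hy) (hZ.extAt hy)).inner (hY.extAt hy)
  · rw [inner_neg_left, hV.2 y hy, neg_zero]
  · have hZ := S.isTangentField_gradDot hX hY
    have hVY : ContinuousOn (fun y => ⟪V y, Y y⟫) Γ := fun y hy =>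
      ((hV.extAt hy).inner ((hY.mono zero_le_one).extAt hy)).continuousWithinAt hy
    refine Eq.symm ?_
    rw [surfInt_congr (g := fun y => surfDiv Γ n (gradDot Γ n X Y) y - ⟪V y, Y y⟫) S.surface
      (fun y hy => ?_), surfInt_sub S.surface (hZ.continuousOn_surfDiv S) hVY,
      surfInt_surfDiv_eq_zero S hZ, zero_sub]
    · simp only [inner_neg_left]
      exact (integral_neg _).symm
    · rw [S.innerTensor_covTensor hy hX1 hY, S.surfDiv_gradDot hy hX hY, hVdef, inner_add_left,
        inner_proj (hY.2 y hy),
        S.inner_shape_comm hy (shape Γ n X) Y]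
      ring

theorem isBochnerLaplacian_bochnerLaplacian (S : IsOrientedSurface Γ n)
    (hX : IsTangentField 2 Γ n X) : IsBochnerLaplacian Γ n X (bochnerLaplacian Γ n X) :=
  Classical.epsilon_spec (p := IsBochnerLaplacian Γ n X) ⟨_, S.isBochnerLaplacian hX⟩

theorem bochnerLaplacian_eq (S : IsOrientedSurface Γ n) (hX : IsTangentField 2 Γ n X)
    (hy : y ∈ Γ) : bochnerLaplacian Γ n X y =
      Matrix.toEuclideanLin (P n y) (vecLaplacian Γ n X y) + shape Γ n (shape Γ n X) y := by
  have h1 := (S.isBochnerLaplacian_bochnerLaplacian hX).2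
  have h2 := (S.isBochnerLaplacian hX).2
  exact neg_injective (S.eq_of_forall_surfInt_inner h1.1 h2.1
    (fun Y hY => (h1.2 Y hY).trans (h2.2 Y hY).symm) hy)

end IsOrientedSurface

end

section

/-! ### The Hodge Laplacian -/

variable {Γ : Set E3} {n : E3 → E3} {y : E3} {k : ℕ} {X Y : E3 → E3}

/-- The components of `d_Γ Θ(X)`, projected to the tangent plane. -/
def curlCoeff (Γ : Set E3) (n : E3 → E3) (X : E3 → E3) (k l : Fin 3) (y : E3) : ℝ :=
  tanDeriv Γ n k (fun z => X z l) y - tanDeriv Γ n l (fun z => X z k) y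
    - shape Γ n X y k * n y l + shape Γ n X y l * n y k

/-- The divergence of the projected components of `d_Γ Θ(X)`. -/
def divCurl (Γ : Set E3) (n : E3 → E3) (X : E3 → E3) (y : E3) : E3 :=
  WithLp.toLp 2 fun l => ∑ k, tanDeriv Γ n k (curlCoeff Γ n X k l) y

/-- The contraction of `d_Γ Θ(X)` with the field `Y`. -/
def curlDot (Γ : Set E3) (n X Y : E3 → E3) (y : E3) : E3 :=
  WithLp.toLp 2 fun k => ∑ l, curlCoeff Γ n X k l y * Y y l

theorem curlCoeff_antisymm (X : E3 → E3) (k l : Fin 3) :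
    curlCoeff Γ n X k l y = -curlCoeff Γ n X l k y := by
  simp only [curlCoeff]; ring

namespace IsOrientedSurface

/-- For A_kl = D_k X_l - D_l X_k one has A n = W X, and `curlCoeff` is P A P; hence it annihilates
n. -/
theorem sum_curlCoeff_mul_normal (S : IsOrientedSurface Γ n) (hy : y ∈ Γ)
    (hX : IsTangentField 1 Γ n X) (k : Fin 3) : ∑ l, curlCoeff Γ n X k l y * n y l = 0 := by
  have h1 := S.sum_normal_mul_tanDeriv_field hy hX.eventually (hX.extAt hy) k
  have h2 := S.sum_normal_mul_tanDeriv hy fun z => X z k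
  have h3 := S.normal.sum_sq hy
  have h4 := S.shape_tangent hy X
  rw [inner_eq_sum_mul] at h4
  simp only [curlCoeff, Fin.sum_univ_three] at *
  linear_combination h1 - h2 - shape Γ n X y k * h3 + n y k * h4

theorem curlForm_projE (S : IsOrientedSurface Γ n) (hy : y ∈ Γ)
    (hX : IsTangentField 1 Γ n X) (k l : Fin 3) :
    curlForm Γ n X y (projE n k y) (projE n l y) = curlCoeff Γ n X k l y := by
  have key : ∀ k l, ∑ i, ∑ j, tanDeriv Γ n i (fun z => X z j) y *
      (projE n k y i * projE n l y j) =
      tanDeriv Γ n k (fun z => X z l) y - shape Γ n X y k * n y l := by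
    intro k l
    have h1 : ∀ j, ∑ i, tanDeriv Γ n i (fun z => X z j) y * (projE n k y i * projE n l y j) =
        projE n l y j * tanDeriv Γ n k (fun z => X z j) y := by
      intro j
      rw [← S.sum_tanDeriv_mul_projE hy, Finset.mul_sum]
      exact Finset.sum_congr rfl fun i _ => by ring
    rw [Finset.sum_comm]
    simp only [h1]
    rw [← S.sum_normal_mul_tanDeriv_field hy hX.eventually (hX.extAt hy)]
    simp only [projE, PiLp.sub_apply, PiLp.smul_apply, smul_eq_mul, sub_mul,
      Finset.sum_sub_distrib, PiLp.single_apply, ite_mul, one_mul, zero_mul,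
      Finset.sum_ite_eq', Finset.mem_univ, if_true, Finset.sum_mul]
    congr 1
    exact Finset.sum_congr rfl fun i _ => by ring
  have h2 := key k l
  have h3 := key l k
  rw [Finset.sum_comm] at h3
  rw [curlForm_apply, curlCoeff]
  simp only [sub_mul, Finset.sum_sub_distrib]
  rw [h2, Finset.sum_congr rfl fun i _ => Finset.sum_congr rfl fun j _ => by
    rw [mul_comm (projE n k y i)], h3]
  ring

/-- The normal corrections of Y drop out because `curlCoeff` annihilates n, and antisymmetry merges
the two derivatives of Y into one, ready for integration by parts. -/
theorem inner2_eq (S : IsOrientedSurface Γ n) (hy : y ∈ Γ)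
    (hX : IsTangentField 1 Γ n X) (hY : IsTangentField 1 Γ n Y) :
    inner2 n y (curlForm Γ n X y) (curlForm Γ n Y y) =
      ∑ k, ∑ l, curlCoeff Γ n X k l y * tanDeriv Γ n k (fun z => Y z l) y := by
  have h := two_mul_inner2_eq (n := n) (y := y) (S := curlForm Γ n X y) (T := curlForm Γ n Y y)
    (fun v w _ _ => curlForm_antisymm X v w) (fun v w _ _ => curlForm_antisymm Y v w)
  rw [innerTensor_eq (S.normal.sum_sq hy)] at h
  simp only [S.curlForm_projE hy hX, S.curlForm_projE hy hY] at h
  have h1 : ∑ k, ∑ l, curlCoeff Γ n X k l y * tanDeriv Γ n l (fun z => Y z k) y =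
      -∑ k, ∑ l, curlCoeff Γ n X k l y * tanDeriv Γ n k (fun z => Y z l) y := by
    rw [Finset.sum_comm]
    simp only [← Finset.sum_neg_distrib]
    exact Finset.sum_congr rfl fun k _ => Finset.sum_congr rfl fun l _ => by
      rw [curlCoeff_antisymm]; ring
  have h2 : ∑ k, ∑ l, curlCoeff Γ n X k l y * (shape Γ n Y y k * n y l) = 0 := by
    refine Finset.sum_eq_zero fun k _ => ?_
    rw [← mul_zero (shape Γ n Y y k), ← S.sum_curlCoeff_mul_normal hy hX k, Finset.mul_sum]
    exact Finset.sum_congr rfl fun l _ => by ring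
  have h3 : ∑ k, ∑ l, curlCoeff Γ n X k l y * (shape Γ n Y y l * n y k) = 0 := by
    rw [Finset.sum_comm, ← neg_eq_zero, ← h2]
    simp only [← Finset.sum_neg_distrib]
    exact Finset.sum_congr rfl fun k _ => Finset.sum_congr rfl fun l _ => by
      rw [curlCoeff_antisymm]; ring
  have h4 : ∑ k, ∑ l, curlCoeff Γ n X k l y * curlCoeff Γ n Y k l y =
      ∑ k, ∑ l, curlCoeff Γ n X k l y * tanDeriv Γ n k (fun z => Y z l) y -
      ∑ k, ∑ l, curlCoeff Γ n X k l y * tanDeriv Γ n l (fun z => Y z k) y -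
      ∑ k, ∑ l, curlCoeff Γ n X k l y * (shape Γ n Y y k * n y l) +
      ∑ k, ∑ l, curlCoeff Γ n X k l y * (shape Γ n Y y l * n y k) := by
    simp only [← Finset.sum_sub_distrib, ← Finset.sum_add_distrib]
    exact Finset.sum_congr rfl fun k _ => Finset.sum_congr rfl fun l _ => by
      simp only [curlCoeff]; ring
  rw [h4, h1, h2, h3] at h
  linarith

theorem extAt_curlCoeff (S : IsOrientedSurface Γ n) (hy : y ∈ Γ) (hX : IsTangentField 2 Γ n X)
    (k l : Fin 3) : ExtAt 1 Γ (curlCoeff Γ n X k l) y := by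
  have hn := S.extAt_normal_apply hy one_le_two
  have hu := extAt_pi_iff.1 (S.extAt_shape hy le_rfl ((hX.extAt hy).mono one_le_two))
  exact (((S.extAt_tanDeriv hy (hX.extAt_apply hy l) (by norm_num) k).sub
    (S.extAt_tanDeriv hy (hX.extAt_apply hy k) (by norm_num) l)).sub ((hu k).mul (hn l))).add
    ((hu l).mul (hn k))

theorem isTangentField_curlDot (S : IsOrientedSurface Γ n) (hX : IsTangentField 2 Γ n X)
    (hY : IsTangentField 1 Γ n Y) : IsTangentField 1 Γ n (curlDot Γ n X Y) := by
  refine ⟨isCk_iff.2 fun y hy => extAt_pi_iff.2 fun k => ExtAt.sum Finset.univ fun l _ =>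
    (S.extAt_curlCoeff hy hX k l).mul (hY.extAt_apply hy l), fun y hy => ?_⟩
  simp only [inner_eq_sum_mul, curlDot, Finset.sum_mul]
  rw [Finset.sum_comm]
  refine Finset.sum_eq_zero fun l _ => ?_
  have := S.sum_curlCoeff_mul_normal hy (hX.mono one_le_two) l
  rw [← mul_zero (-Y y l), ← this, Finset.mul_sum]
  exact Finset.sum_congr rfl fun k _ => by rw [curlCoeff_antisymm]; ring

theorem surfDiv_curlDot (S : IsOrientedSurface Γ n) (hy : y ∈ Γ) (hX : IsTangentField 2 Γ n X)
    (hY : IsTangentField 1 Γ n Y) : surfDiv Γ n (curlDot Γ n X Y) y =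
      ∑ k, ∑ l, curlCoeff Γ n X k l y * tanDeriv Γ n k (fun z => Y z l) y +
      ⟪divCurl Γ n X y, Y y⟫ := by
  have h2 : ∀ k, tanDeriv Γ n k (fun z => curlDot Γ n X Y z k) y =
      ∑ l, (curlCoeff Γ n X k l y * tanDeriv Γ n k (fun z => Y z l) y +
        Y y l * tanDeriv Γ n k (curlCoeff Γ n X k l) y) := by
    intro k
    rw [show (fun z => curlDot Γ n X Y z k) =
      fun z => ∑ l, curlCoeff Γ n X k l z * Y z l from rfl,
      S.tanDeriv_sum hy _ fun l _ => (S.extAt_curlCoeff hy hX k l).mul (hY.extAt_apply hy l)]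
    exact Finset.sum_congr rfl fun l _ =>
      S.tanDeriv_mul hy (S.extAt_curlCoeff hy hX k l) (hY.extAt_apply hy l) k
  simp only [surfDiv, h2, Finset.sum_add_distrib]
  congr 1
  rw [Finset.sum_comm, inner_eq_sum_mul]
  refine Finset.sum_congr rfl fun l _ => ?_
  rw [← Finset.mul_sum, mul_comm]
  rfl

theorem extAt_surfDiv (S : IsOrientedSurface Γ n) (hy : y ∈ Γ) (hX : ExtAt (k + 1) Γ X y)
    (hk : k ≤ 2) : ExtAt k Γ (surfDiv Γ n X) y :=
  ExtAt.sum Finset.univ fun i _ => S.extAt_tanDeriv hy (extAt_pi_iff.1 hX i) hk i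

theorem tanDeriv_surfDiv (S : IsOrientedSurface Γ n) (hy : y ∈ Γ) (hX : ExtAt 2 Γ X y)
    (l : Fin 3) : tanDeriv Γ n l (surfDiv Γ n X) y =
      ∑ k, tanDeriv Γ n l (tanDeriv Γ n k fun z => X z k) y :=
  S.tanDeriv_sum hy _ (fun k _ => S.extAt_tanDeriv hy (extAt_pi_iff.1 hX k) (by norm_num) k) l

/-- The tangential part of `divCurl X`. -/
theorem divCurl_apply (S : IsOrientedSurface Γ n) (hy : y ∈ Γ) (hX : IsTangentField 2 Γ n X)
    (l : Fin 3) : divCurl Γ n X y l =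
      vecLaplacian Γ n X y l - surfGrad Γ n (surfDiv Γ n X) y l
        + 2 * shape Γ n (shape Γ n X) y l - H Γ n y * shape Γ n X y l
        + n y l * (∑ k, ∑ m, tanDeriv Γ n k (fun z => n z m) y *
            tanDeriv Γ n m (fun z => X z k) y - surfDiv Γ n (shape Γ n X) y) := by
  have hX1 : IsTangentField 1 Γ n X := hX.mono one_le_two
  have hn := S.extAt_normal_apply hy one_le_two
  have hu := extAt_pi_iff.1 (S.extAt_shape hy le_rfl (hX1.extAt hy))
  have hM : ∀ k l, ExtAt 1 Γ (tanDeriv Γ n k fun z => X z l) y := fun k l =>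
    S.extAt_tanDeriv hy (hX.extAt_apply hy l) (by norm_num) k
  have e1 : ∀ k, tanDeriv Γ n k (curlCoeff Γ n X k l) y =
      tanDeriv Γ n k (tanDeriv Γ n k fun z => X z l) y
      - tanDeriv Γ n k (tanDeriv Γ n l fun z => X z k) y
      - (shape Γ n X y k * tanDeriv Γ n k (fun z => n z l) y +
        n y l * tanDeriv Γ n k (fun z => shape Γ n X z k) y)
      + (shape Γ n X y l * tanDeriv Γ n k (fun z => n z k) y +
        n y k * tanDeriv Γ n k (fun z => shape Γ n X z l) y) := by
    intro k
    rw [show curlCoeff Γ n X k l = fun z => tanDeriv Γ n k (fun z => X z l) z -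
      tanDeriv Γ n l (fun z => X z k) z - shape Γ n X z k * n z l + shape Γ n X z l * n z k from rfl,
      S.tanDeriv_add hy (((hM k l).sub (hM l k)).sub ((hu k).mul (hn l))) ((hu l).mul (hn k)),
      S.tanDeriv_sub hy ((hM k l).sub (hM l k)) ((hu k).mul (hn l)),
      S.tanDeriv_sub hy (hM k l) (hM l k), S.tanDeriv_mul hy (hu k) (hn l),
      S.tanDeriv_mul hy (hu l) (hn k)]
  -- Moving D_l outside turns the sum into the gradient of div X plus commutator terms.
  have e2 : ∑ k, tanDeriv Γ n k (tanDeriv Γ n l fun z => X z k) y =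
      tanDeriv Γ n l (surfDiv Γ n X) y
      + ∑ k, n y k * ∑ m, tanDeriv Γ n l (fun z => n z m) y * tanDeriv Γ n m (fun z => X z k) y
      - n y l * ∑ k, ∑ m, tanDeriv Γ n k (fun z => n z m) y * tanDeriv Γ n m (fun z => X z k) y := by
    rw [S.tanDeriv_surfDiv hy (hX.extAt hy), Finset.mul_sum, add_sub_assoc,
      ← Finset.sum_sub_distrib, Finset.sum_congr rfl fun k _ =>
        (S.tanDeriv_tanDeriv_sub hy (hX.extAt_apply hy k) k l).symm, ← Finset.sum_add_distrib]
    exact Finset.sum_congr rfl fun k _ => by ring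
  -- One W² X comes from the commutator, the second from `e4`; the term -H W X comes from `e5`.
  have e3 : ∑ k, n y k * ∑ m, tanDeriv Γ n l (fun z => n z m) y *
      tanDeriv Γ n m (fun z => X z k) y = -shape Γ n (shape Γ n X) y l := by
    rw [shape_apply]
    simp only [Finset.mul_sum]
    rw [Finset.sum_comm, ← Finset.sum_neg_distrib]
    refine Finset.sum_congr rfl fun m _ => ?_
    rw [← S.sum_normal_mul_tanDeriv_field hy hX1.eventually (hX1.extAt hy) m, W_apply,
      Finset.mul_sum, ← Finset.sum_neg_distrib]
    exact Finset.sum_congr rfl fun k _ => by ring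
  have e4 : ∑ k, shape Γ n X y k * tanDeriv Γ n k (fun z => n z l) y =
      -shape Γ n (shape Γ n X) y l := by
    rw [shape_apply, ← Finset.sum_neg_distrib]
    refine Finset.sum_congr rfl fun k _ => ?_
    rw [S.W_symm hy l k, W_apply]; ring
  have e5 : ∑ k, shape Γ n X y l * tanDeriv Γ n k (fun z => n z k) y =
      -(H Γ n y * shape Γ n X y l) := by
    rw [H_eq, ← Finset.mul_sum, Finset.sum_mul, Finset.mul_sum, ← Finset.sum_neg_distrib]
    exact Finset.sum_congr rfl fun k _ => by rw [W_apply]; ring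
  have e6 := S.sum_normal_mul_tanDeriv hy fun z => shape Γ n X z l
  have e7 : vecLaplacian Γ n X y l = ∑ k, tanDeriv Γ n k (tanDeriv Γ n k fun z => X z l) y := rfl
  have e8 : divCurl Γ n X y l = ∑ k, tanDeriv Γ n k (curlCoeff Γ n X k l) y := rfl
  have e9 : ∑ k, n y l * tanDeriv Γ n k (fun z => shape Γ n X z k) y =
      n y l * surfDiv Γ n (shape Γ n X) y := (Finset.mul_sum _ _ _).symm
  rw [e8]
  simp only [e1, Finset.sum_add_distrib, Finset.sum_sub_distrib]
  rw [e2, e3, e4, e5, e6, e9, e7, surfGrad_apply]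
  ring

theorem surfDiv_smul (S : IsOrientedSurface Γ n) (hy : y ∈ Γ) {f : E3 → ℝ} (hf : ExtAt 1 Γ f y)
    (hX : ExtAt 1 Γ X y) : surfDiv Γ n (fun z => f z • X z) y =
      f y * surfDiv Γ n X y + ⟪surfGrad Γ n f y, X y⟫ := by
  rw [surfDiv, surfDiv, inner_eq_sum_mul, Finset.mul_sum, ← Finset.sum_add_distrib]
  refine Finset.sum_congr rfl fun i _ => ?_
  rw [show (fun z => (f z • X z) i) = fun z => f z * X z i from rfl,
    S.tanDeriv_mul hy hf (extAt_pi_iff.1 hX i), surfGrad_apply]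
  ring

/-- Integrate div (η X) = η div X + ∇η · X. -/
theorem isCodiff1 (S : IsOrientedSurface Γ n) (hX : IsTangentField 1 Γ n X) :
    IsCodiff1 Γ n (flat X) fun y => -surfDiv Γ n X y := by
  refine ⟨isCk_iff.2 fun y hy => (S.extAt_surfDiv hy (hX.extAt hy) (by norm_num)).neg,
    fun η α hη hα => ?_⟩
  have hη' := isCk_iff.1 hη
  rw [isExtDeriv0_iff S hη'] at hα
  have hZ := hX.smul hη'
  have hc : ContinuousOn (fun y => -surfDiv Γ n X y * η y) Γ :=
    (hX.continuousOn_surfDiv S).neg.mul (IsCk.continuousOn hη)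
  rw [surfInt_congr (f := fun y => inner1 n y (flat X y) (α y))
    (g := fun y => surfDiv Γ n (fun z => η z • X z) y + -surfDiv Γ n X y * η y) S.surface
    fun y hy => ?_, surfInt_add S.surface (hZ.continuousOn_surfDiv S) hc,
    surfInt_surfDiv_eq_zero S hZ, zero_add]
  rw [inner1_eq (hX.2 y hy) fun v _ => rfl, hα y hy _ (hX.2 y hy),
    S.surfDiv_smul hy (hη' y hy) (hX.extAt hy)]
  ring

/-- The test form is represented by a field Y, and the divergence of `curlDot` is integrated.
`divCurl` need not be tangential, as its form is only used on tangent vectors. -/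
theorem isCodiff2 (S : IsOrientedSurface Γ n) (hX : IsTangentField 2 Γ n X) :
    IsCodiff2 Γ n (curlForm Γ n X) (flat fun y => -divCurl Γ n X y) := by
  have hX1 : IsTangentField 1 Γ n X := hX.mono one_le_two
  have hG : ∀ y ∈ Γ, ExtAt 0 Γ (divCurl Γ n X) y := fun y hy => extAt_pi_iff.2 fun l =>
    ExtAt.sum Finset.univ fun k _ =>
      S.extAt_tanDeriv hy (S.extAt_curlCoeff hy hX k l) (by norm_num) k
  refine ⟨isForm1_flat fun y hy => extAt_pi_iff.2 fun l => (extAt_pi_iff.1 (hG y hy) l).neg,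
    fun η δ hη hδ => ?_⟩
  obtain ⟨Y, hY, hYη⟩ := S.exists_field_of_isForm1 one_le_two hη
  rw [isExtDeriv1_iff S (fun y hy => hY.extAt hy) hYη] at hδ
  have hZ := S.isTangentField_curlDot hX hY
  have hc : ContinuousOn (fun y => -⟪divCurl Γ n X y, Y y⟫) Γ := fun y hy =>
    ((hG y hy).inner ((hY.mono zero_le_one).extAt hy)).neg.continuousWithinAt hy
  rw [surfInt_congr (f := fun y => inner2 n y (curlForm Γ n X y) (δ y))
    (g := fun y => surfDiv Γ n (curlDot Γ n X Y) y + -⟪divCurl Γ n X y, Y y⟫) S.surface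
    fun y hy => ?_, surfInt_add S.surface (hZ.continuousOn_surfDiv S) hc,
    surfInt_surfDiv_eq_zero S hZ, zero_add]
  · refine surfInt_congr S.surface fun y hy => ?_
    rw [inner1_comm, inner1_eq (hY.2 y hy) (hYη y hy)]
    exact inner_neg_left (𝕜 := ℝ) (divCurl Γ n X y) (Y y)
  · rw [inner2_congr (fun _ _ _ _ => rfl) (hδ y hy), S.inner2_eq hy hX1 hY,
      S.surfDiv_curlDot hy hX hY]
    ring

theorem toEuclideanLin_hodge (X : E3 → E3) :
    Matrix.toEuclideanLin ((2 : ℝ) • W Γ n y ^ 2 - H Γ n y • W Γ n y) (X y) =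
      (2 : ℝ) • shape Γ n (shape Γ n X) y - H Γ n y • shape Γ n X y := by
  rw [map_sub, map_smul, map_smul, LinearMap.sub_apply, LinearMap.smul_apply,
    LinearMap.smul_apply, toEuclideanLin_W_sq]
  rfl

/-- The field `P (Δ_Γ X) + (2 W² - H W) X`. -/
def _root_.SurfaceCalculus.hodgeField (Γ : Set E3) (n X : E3 → E3) (y : E3) : E3 :=
  Matrix.toEuclideanLin (P n y) (vecLaplacian Γ n X y) +
    Matrix.toEuclideanLin ((2 : ℝ) • W Γ n y ^ 2 - H Γ n y • W Γ n y) (X y)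

theorem isTangentField_hodgeField (S : IsOrientedSurface Γ n) (hX : IsTangentField 2 Γ n X) :
    IsTangentField 0 Γ n (hodgeField Γ n X) := by
  refine ⟨isCk_iff.2 fun y hy => extAt_pi_iff.2 fun j => ExtAt.add ?_ ?_, fun y hy => ?_⟩
  · exact extAt_pi_iff.1 (S.extAt_proj hy (by norm_num) (S.extAt_vecLaplacian hy (hX.extAt hy))) j
  · simp only [toEuclideanLin_hodge]
    have h1 := S.isTangentField_shape (by norm_num) (hX.mono (show 0 ≤ 2 by norm_num))
    exact ((ExtAt.const 2).mul ((S.isTangentField_shape (by norm_num) h1).extAt_apply hy j)).sub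
      ((S.extAt_H hy (by norm_num)).mul (h1.extAt_apply hy j))
  · rw [hodgeField, toEuclideanLin_hodge, inner_add_left, S.proj_tangent hy, inner_sub_left,
      real_inner_smul_left, real_inner_smul_left, S.shape_tangent hy, S.shape_tangent hy]
    ring

theorem inner_hodgeField (S : IsOrientedSurface Γ n) (hX : IsTangentField 2 Γ n X)
    (hy : y ∈ Γ) {v : E3} (hv : ⟪v, n y⟫ = 0) : ⟪hodgeField Γ n X y, v⟫ =
      ⟪surfGrad Γ n (surfDiv Γ n X) y, v⟫ + ⟪divCurl Γ n X y, v⟫ := by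
  -- The multiple of n in `divCurl_apply` is irrelevant when paired with a tangent vector.
  obtain ⟨c, hc⟩ : ∃ c : ℝ, divCurl Γ n X y = vecLaplacian Γ n X y -
      surfGrad Γ n (surfDiv Γ n X) y + ((2 : ℝ) • shape Γ n (shape Γ n X) y -
      H Γ n y • shape Γ n X y) + c • n y := by
    refine ⟨∑ k, ∑ m, tanDeriv Γ n k (fun z => n z m) y *
      tanDeriv Γ n m (fun z => X z k) y - surfDiv Γ n (shape Γ n X) y, ?_⟩
    ext l
    rw [S.divCurl_apply hy hX]
    simp only [PiLp.add_apply, PiLp.sub_apply, PiLp.smul_apply, smul_eq_mul]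
    rw [mul_comm (n y l)]
    ring
  rw [hodgeField, toEuclideanLin_hodge, inner_add_left, inner_proj hv, hc]
  simp only [inner_add_left, inner_sub_left, real_inner_smul_left]
  rw [real_inner_comm v (n y), hv]
  ring

theorem isHodgeLaplacian (S : IsOrientedSurface Γ n) (hX : IsTangentField 2 Γ n X) :
    IsHodgeLaplacian Γ n X (hodgeField Γ n X) := by
  have hX1 : IsTangentField 1 Γ n X := hX.mono one_le_two
  have hV := S.isTangentField_hodgeField hX
  have hd : ∀ y ∈ Γ, ExtAt 1 Γ (fun z => -surfDiv Γ n X z) y := fun y hy =>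
    (S.extAt_surfDiv hy (hX.extAt hy) one_le_two).neg
  -- Here α represents -∇ div X and γ represents -`divCurl`, so -(α + γ) is ∇ div X plus `divCurl`
  -- on tangent vectors.
  refine ⟨hV, fun y => -surfDiv Γ n X y, flat (surfGrad Γ n fun y => -surfDiv Γ n X y),
    curlForm Γ n X, flat fun y => -divCurl Γ n X y, S.isCodiff1 hX1, isCk_iff.2 hd,
    (isExtDeriv0_iff S hd).2 fun _ _ _ _ => rfl,
    (isExtDeriv1_iff S (fun y hy => hX1.extAt hy) fun _ _ _ _ => rfl).2 fun _ _ _ _ _ _ => rfl,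
    ⟨fun Y Z hY hZ => isCk_iff.2 fun y hy => ?_, fun y _ v _ w _ => curlForm_antisymm X v w⟩,
    S.isCodiff2 hX, fun y hy => ?_⟩
  · simp only [curlForm_apply]
    exact ExtAt.sum _ fun i _ => ExtAt.sum _ fun j _ =>
      ((S.extAt_tanDeriv hy (hX.extAt_apply hy j) one_le_two i).sub
        (S.extAt_tanDeriv hy (hX.extAt_apply hy i) one_le_two j)).mul
        ((hY.extAt_apply hy i).mul (hZ.extAt_apply hy j))
  · refine (sharp_eq (hV.2 y hy) fun v hv => ?_).symm
    have hg : surfGrad Γ n (fun y => -surfDiv Γ n X y) y = -surfGrad Γ n (surfDiv Γ n X) y := by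
      ext i
      exact S.tanDeriv_neg hy (S.extAt_surfDiv hy (hX.extAt hy) one_le_two) i
    rw [S.inner_hodgeField hX hy hv]
    simp only [LinearMap.neg_apply, LinearMap.add_apply, flat, innerₗ_apply_apply, hg,
      inner_neg_left]
    ring

/-! ### Uniqueness of the codifferentials and of the Hodge Laplacian -/

theorem isCodiff1_unique (S : IsOrientedSurface Γ n) {ω : Form1} {f f' : E3 → ℝ}
    (hf : IsCodiff1 Γ n ω f) (hf' : IsCodiff1 Γ n ω f') (hy : y ∈ Γ) : f y = f' y := by
  have hc := IsCk.continuousOn hf.1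
  have hc' := IsCk.continuousOn hf'.1
  rw [← sub_eq_zero]
  refine S.surface.eq_zero_of_forall_surfInt_mul (f := fun z => f z - f' z) (hc.sub hc')
    (fun φ hφ => ?_) hy
  have hφe : ∀ y ∈ Γ, ExtAt 1 Γ φ y := fun y _ => (hφ.contDiffAt (x := y)).extAt (k := 1)
  have hα := (isExtDeriv0_iff S hφe (α := flat (surfGrad Γ n φ))).2 fun _ _ _ _ => rfl
  have hφc := hφ.continuous.continuousOn (s := Γ)
  simp only [sub_mul]
  rw [surfInt_sub (f := fun z => f z * φ z) (g := fun z => f' z * φ z) S.surface (hc.mul hφc)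
    (hc'.mul hφc), hf.2 φ _ (isCk_iff.2 hφe) hα, hf'.2 φ _ (isCk_iff.2 hφe) hα, sub_self]

theorem isCodiff2_unique (S : IsOrientedSurface Γ n) {β β' : Tensor2} {γ γ' : Form1}
    (hβ : ∀ y ∈ Γ, ∀ v w, ⟪v, n y⟫ = 0 → ⟪w, n y⟫ = 0 → β y v w = β' y v w)
    (hγ : IsCodiff2 Γ n β γ) (hγ' : IsCodiff2 Γ n β' γ') (hy : y ∈ Γ) {v : E3}
    (hv : ⟪v, n y⟫ = 0) : γ y v = γ' y v := by
  obtain ⟨G, hG, hGγ⟩ := S.exists_field_of_isForm1 (by norm_num) hγ.1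
  obtain ⟨G', hG', hGγ'⟩ := S.exists_field_of_isForm1 (by norm_num) hγ'.1
  rw [hGγ y hy v hv, hGγ' y hy v hv, S.eq_of_forall_surfInt_inner hG hG' (fun Y hY => ?_) hy]
  have hδ := (isExtDeriv1_iff S (fun y hy => hY.extAt hy) (ω := flat Y) (δ := curlForm Γ n Y)
    fun _ _ _ _ => rfl).2 fun _ _ _ _ _ _ => rfl
  have hη : IsForm1 1 Γ n (flat Y) := isForm1_flat fun y hy => hY.extAt hy
  have e : ∀ {γ : Form1} {G : E3 → E3}, (∀ y ∈ Γ, ∀ v, ⟪v, n y⟫ = 0 → γ y v = ⟪G y, v⟫) →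
      surfInt Γ (fun z => ⟪G z, Y z⟫) = surfInt Γ fun z => inner1 n z (γ z) (flat Y z) :=
    fun {γ G} h => surfInt_congr S.surface fun z hz => by
      rw [inner1_comm, inner1_eq (hY.2 z hz) fun v _ => rfl, h z hz _ (hY.2 z hz)]
  rw [e hGγ, e hGγ', hγ.2 _ _ hη hδ, hγ'.2 _ _ hη hδ]
  exact surfInt_congr S.surface fun z hz => inner2_congr (hβ z hz) fun _ _ _ _ => rfl

theorem isHodgeLaplacian_hodgeLaplacian (S : IsOrientedSurface Γ n)
    (hX : IsTangentField 2 Γ n X) : IsHodgeLaplacian Γ n X (hodgeLaplacian Γ n X) :=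
  Classical.epsilon_spec (p := IsHodgeLaplacian Γ n X) ⟨_, S.isHodgeLaplacian hX⟩

/-- The intermediate objects are determined only on Γ and on tangent vectors. This suffices, because
`sharp` evaluates forms on a tangent basis. -/
theorem isHodgeLaplacian_unique (S : IsOrientedSurface Γ n) (hX : IsTangentField 1 Γ n X)
    {V V' : E3 → E3} (hV : IsHodgeLaplacian Γ n X V) (hV' : IsHodgeLaplacian Γ n X V')
    (hy : y ∈ Γ) : V y = V' y := by
  obtain ⟨-, f, α, β, γ, hf, hf1, hα, hβ, -, hγ, h⟩ := hV
  obtain ⟨-, f', α', β', γ', hf', hf1', hα', hβ', -, hγ', h'⟩ := hV'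
  have hXe : ∀ y ∈ Γ, ExtAt 1 Γ X y := fun y hy => hX.extAt hy
  rw [isExtDeriv0_iff S (isCk_iff.1 hf1)] at hα
  rw [isExtDeriv0_iff S (isCk_iff.1 hf1')] at hα'
  rw [isExtDeriv1_iff S hXe fun _ _ _ _ => rfl] at hβ hβ'
  have hff : surfGrad Γ n f y = surfGrad Γ n f' y := by
    ext i
    exact tanDeriv_congr (eventually_mem_nhdsWithin.mono fun z hz => S.isCodiff1_unique hf hf' hz)
  rw [h y hy, h' y hy]
  refine Finset.sum_congr rfl fun i _ => ?_
  have ht := (isTangentBasis_τ n y).tangent i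
  simp only [LinearMap.neg_apply, LinearMap.add_apply]
  rw [hα y hy _ ht, hα' y hy _ ht, hff, S.isCodiff2_unique (fun z hz v w hv hw =>
    (hβ z hz v w hv hw).trans (hβ' z hz v w hv hw).symm) hγ hγ' hy ht]

theorem hodgeLaplacian_eq (S : IsOrientedSurface Γ n) (hX : IsTangentField 2 Γ n X)
    (hy : y ∈ Γ) : hodgeLaplacian Γ n X y = hodgeField Γ n X y :=
  S.isHodgeLaplacian_unique (hX.mono one_le_two) (S.isHodgeLaplacian_hodgeLaplacian hX)
    (S.isHodgeLaplacian hX) hy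

end IsOrientedSurface

end

section

/-! ### The Gauss equation -/

section Gauss

variable {Γ : Set E3} {n : E3 → E3} {y : E3} {k : ℕ} {X Y Z : E3 → E3}

/-- The componentwise derivative `v ↦ (v · ∇_Γ) Z`. -/
def dirDeriv (Γ : Set E3) (n : E3 → E3) (Z : E3 → E3) (y : E3) : E3 →ₗ[ℝ] E3 :=
  Matrix.toEuclideanLin (tanGradMat Γ n Z y).transpose

theorem dirDeriv_apply (v : E3) (k : Fin 3) :
    dirDeriv Γ n Z y v k = ∑ i, tanDeriv Γ n i (fun z => Z z k) y * v i := rfl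

theorem covMap_eq (v : E3) :
    covMap Γ n Z y v = Matrix.toEuclideanLin (P n y) (dirDeriv Γ n Z y v) := by
  ext k
  simp only [covMap, dirDeriv, toEuclideanLin_apply_coord, Matrix.mul_apply, Finset.sum_mul,
    Finset.mul_sum]
  rw [Finset.sum_comm]
  exact Finset.sum_congr rfl fun _ _ => Finset.sum_congr rfl fun _ _ => by ring

/-- The contraction of the second tangential derivatives of `Z` with `X` and `Y`. -/
def hessian (Γ : Set E3) (n X Y Z : E3 → E3) (y : E3) : E3 :=
  WithLp.toLp 2 fun k =>
    ∑ i, ∑ j, X y i * Y y j * tanDeriv Γ n i (tanDeriv Γ n j fun z => Z z k) y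

namespace IsOrientedSurface

theorem toEuclideanLin_P_of_tangent {v : E3} (hv : ⟪v, n y⟫ = 0) :
    Matrix.toEuclideanLin (P n y) v = v := by
  rw [toEuclideanLin_P, real_inner_comm, hv, zero_smul, sub_zero]

theorem toEuclideanLin_P_normal (S : IsOrientedSurface Γ n) (hy : y ∈ Γ) :
    Matrix.toEuclideanLin (P n y) (n y) = 0 := by
  rw [toEuclideanLin_P, real_inner_self_eq_norm_sq, S.normal.norm_eq_one y hy, one_pow, one_smul,
    sub_self]

theorem dirDeriv_normal (S : IsOrientedSurface Γ n) (hy : y ∈ Γ) (Z : E3 → E3) :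
    dirDeriv Γ n Z y (n y) = 0 := by
  ext k
  refine (Finset.sum_congr rfl fun i _ => mul_comm _ _).trans
    (S.sum_normal_mul_tanDeriv hy fun z => Z z k)

/-- The projection in the covariant derivative removes a multiple of n, along which tangential
derivatives vanish. -/
theorem dirDeriv_covMap (S : IsOrientedSurface Γ n) (hy : y ∈ Γ) (Z Y : E3 → E3) (v : E3) :
    dirDeriv Γ n Z y (covMap Γ n Y y v) = dirDeriv Γ n Z y (dirDeriv Γ n Y y v) := by
  rw [covMap_eq, toEuclideanLin_P, map_sub, map_smul, S.dirDeriv_normal hy, smul_zero, sub_zero]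

/-- Each term of the commutator carries a factor n_i or n_j, which tangential X and Y annihilate. -/
theorem hessian_comm (S : IsOrientedSurface Γ n) (hy : y ∈ Γ) (hX : ⟪X y, n y⟫ = 0)
    (hY : ⟪Y y, n y⟫ = 0) (hZ : ExtAt 2 Γ Z y) :
    hessian Γ n X Y Z y = hessian Γ n Y X Z y := by
  ext k
  rw [← sub_eq_zero]
  simp only [hessian]
  rw [Finset.sum_comm (f := fun i j => Y y i * X y j * _)]
  simp only [← Finset.sum_sub_distrib]
  rw [inner_eq_sum_mul] at hX hY
  have h : ∀ i j, X y i * Y y j * tanDeriv Γ n i (tanDeriv Γ n j fun z => Z z k) y -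
      Y y j * X y i * tanDeriv Γ n j (tanDeriv Γ n i fun z => Z z k) y =
      (X y i * n y i) * (Y y j * ∑ l, tanDeriv Γ n j (fun z => n z l) y *
        tanDeriv Γ n l (fun z => Z z k) y) -
      (Y y j * n y j) * (X y i * ∑ l, tanDeriv Γ n i (fun z => n z l) y *
        tanDeriv Γ n l (fun z => Z z k) y) := by
    intro i j
    linear_combination (X y i * Y y j) * S.tanDeriv_tanDeriv_sub hy (extAt_pi_iff.1 hZ k) i j
  simp only [h, Finset.sum_sub_distrib]
  simp only [← Finset.mul_sum, ← Finset.sum_mul]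
  rw [hX, hY]
  ring

theorem tanDeriv_covDeriv (S : IsOrientedSurface Γ n) (hy : y ∈ Γ) (hY : ExtAt 1 Γ Y y)
    (hZ : ExtAt 2 Γ Z y) (hZt : ∀ᶠ z in 𝓝[Γ] y, ⟪Z z, n z⟫ = 0) (i k : Fin 3) :
    tanDeriv Γ n i (fun z => covDeriv Γ n Y Z z k) y =
      ∑ j, (tanDeriv Γ n j (fun z => Z z k) y * tanDeriv Γ n i (fun z => Y z j) y +
        Y y j * tanDeriv Γ n i (tanDeriv Γ n j fun z => Z z k) y) -
      (n y k * tanDeriv Γ n i (fun z => ⟪shape Γ n Z z, Y z⟫) y +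
        ⟪shape Γ n Z y, Y y⟫ * tanDeriv Γ n i (fun z => n z k) y) := by
  -- Near y, and not only at y, the covariant derivative is the componentwise one minus (W Z · Y) n,
  -- so it may be differentiated again.
  have he : (fun z => covDeriv Γ n Y Z z k) =ᶠ[𝓝[Γ] y] fun z =>
      (∑ j, tanDeriv Γ n j (fun z => Z z k) z * Y z j) - n z k * ⟪shape Γ n Z z, Y z⟫ := by
    filter_upwards [(hZ.mono one_le_two).eventually, eventually_eventually_nhdsWithin.2 hZt,
      self_mem_nhdsWithin] with z h1 h2 hz
    rw [covDeriv, S.covMap_tangentField hz h2 h1, inner_eq_sum_mul, Finset.mul_sum,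
      ← Finset.sum_sub_distrib]
    exact Finset.sum_congr rfl fun _ _ => by ring
  have hD : ∀ j, ExtAt 1 Γ (tanDeriv Γ n j fun z => Z z k) y := fun j =>
    S.extAt_tanDeriv hy (extAt_pi_iff.1 hZ k) (by norm_num) j
  have hy' := extAt_pi_iff.1 hY
  have hnk := S.extAt_normal_apply hy (show 1 ≤ 2 by norm_num) k
  have hg := (S.extAt_shape hy le_rfl (hZ.mono one_le_two)).inner hY
  rw [tanDeriv_congr he, S.tanDeriv_sub hy (ExtAt.sum _ fun j _ => (hD j).mul (hy' j)) (hnk.mul hg),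
    S.tanDeriv_sum hy _ fun j _ => (hD j).mul (hy' j), S.tanDeriv_mul hy hnk hg]
  simp only [S.tanDeriv_mul hy (hD _) (hy' _)]

theorem dirDeriv_covDeriv (S : IsOrientedSurface Γ n) (hy : y ∈ Γ) (hY : ExtAt 1 Γ Y y)
    (hZ : ExtAt 2 Γ Z y) (hZt : ∀ᶠ z in 𝓝[Γ] y, ⟪Z z, n z⟫ = 0) (X : E3 → E3) :
    dirDeriv Γ n (covDeriv Γ n Y Z) y (X y) =
      hessian Γ n X Y Z y + dirDeriv Γ n Z y (dirDeriv Γ n Y y (X y)) -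
      (∑ i, tanDeriv Γ n i (fun z => ⟪shape Γ n Z z, Y z⟫) y * X y i) • n y +
      ⟪shape Γ n Z y, Y y⟫ • shape Γ n X y := by
  ext k
  simp only [PiLp.add_apply, PiLp.sub_apply, PiLp.smul_apply, smul_eq_mul, dirDeriv_apply,
    S.tanDeriv_covDeriv hy hY hZ hZt, shape_apply, S.W_symm hy k, W_apply, hessian]
  simp only [Fin.sum_univ_three]
  ring

/-- The projection kills the derivative of W Z · Y, while D n = -W leaves the last term. On
antisymmetrizing in X and Y the first term cancels and the second is absorbed by the bracket, so
only the last one reaches the Gauss equation. -/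
theorem covDeriv_covDeriv (S : IsOrientedSurface Γ n) (hy : y ∈ Γ) (hY : ExtAt 1 Γ Y y)
    (hZ : ExtAt 2 Γ Z y) (hZt : ∀ᶠ z in 𝓝[Γ] y, ⟪Z z, n z⟫ = 0) (X : E3 → E3) :
    covDeriv Γ n X (covDeriv Γ n Y Z) y =
      Matrix.toEuclideanLin (P n y) (hessian Γ n X Y Z y) +
      covMap Γ n Z y (covDeriv Γ n X Y y) + ⟪shape Γ n Z y, Y y⟫ • shape Γ n X y := by
  rw [covDeriv, covMap_eq, S.dirDeriv_covDeriv hy hY hZ hZt, map_add, map_sub, map_add, map_smul,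
    map_smul, S.toEuclideanLin_P_normal hy, smul_zero, sub_zero,
    toEuclideanLin_P_of_tangent (S.shape_tangent hy X), covDeriv, covMap_eq (Z := Z),
    S.dirDeriv_covMap hy]

/-- The Gauss equation. -/
theorem curvature_eq (S : IsOrientedSurface Γ n) (hy : y ∈ Γ) (hX : ExtAt 1 Γ X y)
    (hXt : ⟪X y, n y⟫ = 0) (hY : ExtAt 1 Γ Y y) (hYt : ⟪Y y, n y⟫ = 0)
    (hZ : ExtAt 2 Γ Z y) (hZt : ∀ᶠ z in 𝓝[Γ] y, ⟪Z z, n z⟫ = 0) :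
    curvature Γ n X Y Z y =
      ⟪shape Γ n Z y, Y y⟫ • shape Γ n X y - ⟪shape Γ n Z y, X y⟫ • shape Γ n Y y := by
  rw [curvature, S.covDeriv_covDeriv hy hY hZ hZt, S.covDeriv_covDeriv hy hX hZ hZt,
    S.hessian_comm hy hXt hYt hZ]
  have h : covDeriv Γ n (fun z => covDeriv Γ n X Y z - covDeriv Γ n Y X z) Z y =
      covMap Γ n Z y (covDeriv Γ n X Y y) - covMap Γ n Z y (covDeriv Γ n Y X y) := map_sub _ _ _
  rw [h]
  abel

/-- In the trace of the Gauss equation, Σ W t_i · t_i = H, and Σ (t_i · W X) t_i = W X since W X is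
tangential. -/
theorem sum_curvature (S : IsOrientedSurface Γ n) {O : Set E3} {t : Fin 2 → E3 → E3}
    (ht : IsLocalFrame Γ n O t) (hX : IsTangentField 1 Γ n X) (hy : y ∈ Γ ∩ O) :
    ∑ i, curvature Γ n X (t i) (t i) y =
      H Γ n y • shape Γ n X y - shape Γ n (shape Γ n X) y := by
  have hb := S.normal.isTangentBasis hy.1 (ht.orthonormal y hy) (fun i => ht.tangent i y hy)
  have h1 : ∀ i, curvature Γ n X (t i) (t i) y =
      ⟪shape Γ n (t i) y, t i y⟫ • shape Γ n X y -
        ⟪t i y, shape Γ n X y⟫ • shape Γ n (t i) y := by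
    intro i
    have h2 : ExtAt 2 Γ (t i) y := ht.isCkOn i y hy
    rw [S.curvature_eq hy.1 (hX.extAt hy.1) (hX.2 y hy.1) (h2.mono one_le_two) (ht.tangent i y hy)
      h2, S.inner_shape_comm hy.1 (t i) X]
    filter_upwards [self_mem_nhdsWithin, mem_nhdsWithin_of_mem_nhds (ht.isOpen.mem_nhds hy.2)]
      with z hz hz'
    exact ht.tangent i z ⟨hz, hz'⟩
  simp only [h1, Finset.sum_sub_distrib, ← Finset.sum_smul]
  congr 2
  · have hN := S.normal.sum_sq hy.1
    have h3 := hb.sum_bilin hN ((innerₗ E3).comp (Matrix.toEuclideanLin (W Γ n y)))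
    refine h3.trans ?_
    -- Since W n = 0, the trace over the tangent plane equals the trace of the full matrix.
    have h4 : ∀ k, (innerₗ E3).comp (Matrix.toEuclideanLin (W Γ n y)) (projE n k y)
        (projE n k y) = W Γ n y k k := by
      intro k
      have h5 := S.shape_tangent hy.1 (projE n k)
      refine (inner_projE_eq h5 k).trans ?_
      rw [shape_apply]
      simp only [projE, PiLp.sub_apply, PiLp.smul_apply, smul_eq_mul, mul_sub,
        Finset.sum_sub_distrib, PiLp.single_apply]
      have := S.sum_W_mul_normal hy.1 k
      simp only [mul_left_comm _ (n y k), ← Finset.mul_sum, this]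
      simp
    simp only [h4, H_eq]
  · simp only [shape, ← map_smul, ← map_sum]
    exact congrArg _ (hb.sum_eq _ (S.shape_tangent hy.1 X))

/-! ### Local orthonormal frames -/

/-- Some P e_i is nonzero at y, hence nearby; normalize it to q and complete it with n × q. Without
frames the condition `IsRicci` would not determine the field. -/
theorem exists_localFrame (S : IsOrientedSurface Γ n) (hy : y ∈ Γ) :
    ∃ (O : Set E3) (t : Fin 2 → E3 → E3), IsLocalFrame Γ n O t ∧ y ∈ O := by
  obtain ⟨i, hi⟩ : ∃ i, projE n i y ≠ 0 := by
    by_contra! h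
    have h1 : ∀ v : E3, ⟪v, n y⟫ = 0 → v = 0 := fun v hv => by
      rw [← sum_smul_projE v hv]; simp [h]
    have : Fact (Module.finrank ℝ E3 = 2 + 1) := ⟨by simp⟩
    have h2 : Module.finrank ℝ (Submodule.span ℝ {n y})ᗮ = 2 :=
      Submodule.finrank_orthogonal_span_singleton (S.normal.ne_zero hy)
    have h3 : (Submodule.span ℝ {n y})ᗮ = ⊥ :=
      (Submodule.eq_bot_iff _).2 fun v hv => h1 v (mem_tangentPlane_iff.1 hv)
    rw [h3] at h2
    simp at h2
  have hp := S.isTangentField_projE le_rfl i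
  have hev : ∀ᶠ z in 𝓝[Γ] y, projE n i z ≠ 0 :=
    ((hp.extAt hy).continuousWithinAt hy).eventually_ne hi
  obtain ⟨O, hO, hyO, hsub⟩ := mem_nhdsWithin.1 hev
  set q : E3 → E3 := fun z => (√⟪projE n i z, projE n i z⟫)⁻¹ • projE n i z with hq
  have hpos : ∀ z ∈ Γ ∩ O, ⟪projE n i z, projE n i z⟫ ≠ 0 := fun z hz => by
    rw [Ne, inner_self_eq_zero]
    exact hsub ⟨hz.2, hz.1⟩
  have hqe : ∀ z ∈ Γ ∩ O, ExtAt 2 Γ q z := fun z hz => extAt_pi_iff.2 fun j =>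
    ((((hp.extAt hz.1).inner (hp.extAt hz.1)).sqrt (hpos z hz) hz.1).inv
      (Real.sqrt_ne_zero'.2 (lt_of_le_of_ne real_inner_self_nonneg (hpos z hz).symm)) hz.1).mul
      (hp.extAt_apply hz.1 j)
  have hqt : ∀ z ∈ Γ ∩ O, ⟪q z, n z⟫ = 0 := fun z hz => by
    rw [hq, real_inner_smul_left, hp.2 z hz.1, mul_zero]
  have hq1 : ∀ z ∈ Γ ∩ O, ⟪q z, q z⟫ = 1 := fun z hz => by
    rw [hq, real_inner_smul_left, real_inner_smul_right]
    have := Real.mul_self_sqrt (real_inner_self_nonneg (x := projE n i z))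
    have h0 := Real.sqrt_ne_zero'.2 (lt_of_le_of_ne real_inner_self_nonneg (hpos z hz).symm)
    field_simp
    rw [sq, this]
  refine ⟨O, ![q, fun z => cross (n z) (q z)], ⟨hO, ?_, ?_, ?_⟩, hyO⟩
  · refine Fin.forall_fin_two.2 ⟨fun z hz => hqe z hz, fun z hz => ?_⟩
    have h1 := extAt_pi_iff.1 (S.extAt_normal hz.1)
    have h2 := extAt_pi_iff.1 (hqe z hz)
    exact extAt_pi_iff.2 (by
      intro j
      fin_cases j <;> simpa [cross] using ((h1 _).mul (h2 _)).sub ((h1 _).mul (h2 _)))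
  · refine Fin.forall_fin_two.2 ⟨hqt, fun z hz => ?_⟩
    simp only [inner_eq_sum, cross, Matrix.cons_val_one, Matrix.cons_val_zero]
    simp
    ring
  · intro z hz
    have h1 := hqt z hz
    have h2 := hq1 z hz
    have h3 := S.normal.sum_sq hz.1
    have h4 : ⟪q z, cross (n z) (q z)⟫ = 0 := by
      simp only [inner_eq_sum, cross]; simp; ring
    have h5 : ⟪cross (n z) (q z), cross (n z) (q z)⟫ = 1 := by
      simp only [inner_eq_sum, cross, Fin.sum_univ_three] at *
      simp
      linear_combination (q z 0 * q z 0 + q z 1 * q z 1 + q z 2 * q z 2) * h3 + h2 -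
        (q z 0 * n z 0 + q z 1 * n z 1 + q z 2 * n z 2) * h1
    rw [orthonormal_iff_ite]
    refine Fin.forall_fin_two.2 ⟨Fin.forall_fin_two.2 ⟨h2, h4⟩, Fin.forall_fin_two.2 ⟨?_, h5⟩⟩
    exact (real_inner_comm _ _).trans h4

theorem isRicci (S : IsOrientedSurface Γ n) (hX : IsTangentField 1 Γ n X) :
    IsRicci Γ n X fun y => H Γ n y • shape Γ n X y - shape Γ n (shape Γ n X) y := by
  have h1 := S.isTangentField_shape le_rfl hX
  refine ⟨⟨isCk_iff.2 fun y hy => extAt_pi_iff.2 fun j => ?_, fun y hy => ?_⟩,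
    fun O t ht y hy => (S.sum_curvature ht hX hy).symm⟩
  · exact ((S.extAt_H hy zero_le_one).mul ((h1.mono zero_le_one).extAt_apply hy j)).sub
      ((S.isTangentField_shape zero_le_one (h1.mono zero_le_one)).extAt_apply hy j)
  · rw [inner_sub_left, real_inner_smul_left, S.shape_tangent hy, S.shape_tangent hy, mul_zero,
      sub_zero]

theorem isRicci_ricci (S : IsOrientedSurface Γ n) (hX : IsTangentField 1 Γ n X) :
    IsRicci Γ n X (ricci Γ n X) :=
  Classical.epsilon_spec (p := IsRicci Γ n X) ⟨_, S.isRicci hX⟩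

theorem ricci_eq (S : IsOrientedSurface Γ n) (hX : IsTangentField 1 Γ n X) (hy : y ∈ Γ) :
    ricci Γ n X y = H Γ n y • shape Γ n X y - shape Γ n (shape Γ n X) y := by
  obtain ⟨O, t, ht, hyO⟩ := S.exists_localFrame hy
  rw [(S.isRicci_ricci hX).2 O t ht y ⟨hy, hyO⟩, S.sum_curvature ht hX ⟨hy, hyO⟩]

end IsOrientedSurface

end Gauss

end

section

/-! ### The Gaussian curvature -/

/-- The sum of the principal minors of order two of a `3 × 3` matrix. -/
def minorSum (M : Matrix (Fin 3) (Fin 3) ℝ) : ℝ :=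
  (M 0 0 * M 1 1 - M 0 1 * M 1 0) + (M 0 0 * M 2 2 - M 0 2 * M 2 0) +
    (M 1 1 * M 2 2 - M 1 2 * M 2 1)

/-- For a singular symmetric matrix of order three, the product of the eigenvalues other than one
eigenvalue zero is the sum of the principal minors of order two. -/
theorem prod_roots_charpoly_erase_zero {M : Matrix (Fin 3) (Fin 3) ℝ} (hM : M.IsHermitian)
    (h0 : M.det = 0) : (M.charpoly.roots.erase 0).prod = minorSum M := by
  have hs := hM.splits_charpoly
  have hcard : M.charpoly.roots.card = 3 := by
    rw [← hs.natDegree_eq_card_roots, Matrix.charpoly_natDegree_eq_dim, Fintype.card_fin]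
  have hroot : (0 : ℝ) ∈ M.charpoly.roots := by
    rw [Polynomial.mem_roots M.charpoly_monic.ne_zero, Polynomial.IsRoot, Matrix.eval_charpoly]
    simp [Matrix.det_neg, h0]
  have hcard' : (M.charpoly.roots.erase 0).card = 2 := by
    rw [Multiset.card_erase_of_mem hroot, hcard]
    rfl
  obtain ⟨a, b, hab⟩ := Multiset.card_eq_two.1 hcard'
  have hev : ∀ t : ℝ, M.charpoly.eval t = t * ((t - a) * (t - b)) := by
    intro t
    rw [hs.eval_eq_prod_roots_of_monic M.charpoly_monic, ← Multiset.cons_erase hroot, hab]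
    simp
  -- The difference of the values of t(t - a)(t - b) at 1 and -1 is 2 + 2ab; for the characteristic
  -- polynomial it is 2 plus twice the sum of the principal minors.
  have h1 := hev 1
  have h2 := hev (-1)
  rw [Matrix.eval_charpoly, Matrix.det_fin_three] at h1 h2
  rw [Matrix.det_fin_three] at h0
  simp [Matrix.scalar_apply] at h1 h2
  rw [hab, minorSum]
  simp
  linarith

namespace IsOrientedSurface

variable {Γ : Set E3} {n : E3 → E3} {y : E3} {X : E3 → E3}

theorem det_W (S : IsOrientedSurface Γ n) (hy : y ∈ Γ) : (W Γ n y).det = 0 := by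
  refine Matrix.exists_mulVec_eq_zero_iff.1 ⟨n y, ?_, ?_⟩
  · intro h
    exact S.normal.ne_zero hy (by ext i; exact congrFun h i)
  · ext i
    exact S.sum_W_mul_normal hy i

theorem K_eq (S : IsOrientedSurface Γ n) (hy : y ∈ Γ) : K Γ n y = minorSum (W Γ n y) :=
  prod_roots_charpoly_erase_zero (Matrix.IsHermitian.ext fun i j => by
    rw [star_trivial, S.W_symm hy]) (S.det_W hy)

/-- The Cayley-Hamilton theorem for the Weingarten map on the tangent plane. -/
theorem H_smul_shape_sub (S : IsOrientedSurface Γ n) (hy : y ∈ Γ) (hX : ⟪X y, n y⟫ = 0) :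
    H Γ n y • shape Γ n X y - shape Γ n (shape Γ n X) y = K Γ n y • X y := by
  -- The rows of W are tangential, so their cross products are normal and the adjugate W² - H W + K
  -- I, whose entries they supply, annihilates X.
  have hr : ∀ i, ⟪WithLp.toLp 2 (W Γ n y i), n y⟫ = 0 := fun i => by
    rw [inner_eq_sum_mul]; exact S.sum_W_mul_normal hy i
  have hc : ∀ i j, ⟪X y, cross (WithLp.toLp 2 (W Γ n y i)) (WithLp.toLp 2 (W Γ n y j))⟫ = 0 :=
    fun i j => inner_cross_eq_zero (S.normal.norm_eq_one y hy) hX (hr i) (hr j)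
  have h0 := hc 1 2
  have h1 := hc 2 0
  have h2 := hc 0 1
  have s1 := S.W_symm hy 1 0
  have s2 := S.W_symm hy 2 0
  have s3 := S.W_symm hy 2 1
  rw [S.K_eq hy, H_eq, minorSum]
  simp only [inner_eq_sum, cross] at h0 h1 h2
  simp at h0 h1 h2
  simp only [s1, s2, s3] at h0 h1 h2
  ext i
  fin_cases i <;> simp [shape_apply, Fin.sum_univ_three, s1, s2, s3]
  · linear_combination -h0
  · linear_combination -h1
  · linear_combination -h2

end IsOrientedSurface

end

end SurfaceCalculus

end

/-- Extrinsic forms of the Hodge and Bochner Laplacians of a tangential `C²` vector field on a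
closed surface, and the Weitzenböck formula. The first three conjuncts say that `Δ_H X`, `Δ_B X`
and `Ric(X)` are well defined, i.e. that the fields so denoted have their defining properties. -/
theorem lemmaC6 (Γ : Set E3) (hΓ : IsClosedSurface Γ) (n : E3 → E3) (hn : IsUnitNormal Γ n)
    (X : E3 → E3) (hX : IsTangentField 2 Γ n X) :
    IsHodgeLaplacian Γ n X (hodgeLaplacian Γ n X) ∧
    IsBochnerLaplacian Γ n X (bochnerLaplacian Γ n X) ∧
    IsRicci Γ n X (ricci Γ n X) ∧
    ∀ y ∈ Γ,
      hodgeLaplacian Γ n X y = Matrix.toEuclideanLin (P n y) (vecLaplacian Γ n X y) +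
        Matrix.toEuclideanLin ((2 : ℝ) • W Γ n y ^ 2 - H Γ n y • W Γ n y) (X y) ∧
      bochnerLaplacian Γ n X y = Matrix.toEuclideanLin (P n y) (vecLaplacian Γ n X y) +
        Matrix.toEuclideanLin (W Γ n y ^ 2) (X y) ∧
      bochnerLaplacian Γ n X y = hodgeLaplacian Γ n X y + ricci Γ n X y ∧
      ricci Γ n X y = K Γ n y • X y := by
  have S : IsOrientedSurface Γ n := ⟨hΓ, hn⟩
  have hX1 : IsTangentField 1 Γ n X := hX.mono one_le_two
  have hK : ∀ y ∈ Γ, ricci Γ n X y = K Γ n y • X y := fun y hy => by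
    rw [S.ricci_eq hX1 hy, S.H_smul_shape_sub hy (hX.2 y hy)]
  refine ⟨S.isHodgeLaplacian_hodgeLaplacian hX, S.isBochnerLaplacian_bochnerLaplacian hX,
    S.isRicci_ricci hX1, fun y hy => ⟨S.hodgeLaplacian_eq hX hy, ?_, ?_, hK y hy⟩⟩
  · rw [S.bochnerLaplacian_eq hX hy, IsOrientedSurface.toEuclideanLin_W_sq]
  -- The identity reduces to (2 W² - H W) + (H W - W²) = W² and does not need the form K X of the
  -- Ricci term.
  · rw [S.bochnerLaplacian_eq hX hy, S.hodgeLaplacian_eq hX hy, hodgeField,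
      IsOrientedSurface.toEuclideanLin_hodge, S.ricci_eq hX1 hy]
    module
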